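/- Let $R$ be a commutative ring containing $\mathbb Q$; "graded" means graded over $\mathbb Z$ (externally, i.e. one works with homogeneous constituents), differentials have degree $-1$, unadorned $\mathrm{Hom}$ and $\otimes$ are over $R$, and the Eilenberg–Koszul sign rule is used throughout. Let $A$ be a differential graded commutative $R$-algebra and $L$ a differential graded $A$-module such that the canonical map $L\to \mathrm{Hom}_A(\mathrm{Hom}_A(L,A),A)$, $x\mapsto (f\mapsto (-1)^{|x||f|}f(x))$, of graded $A$-modules is injective. Let $sL$ be the suspension of $L$ ($(sL)_i=L_{i-1}$, $a\,(s x)=(-1)^{|a|}s(a x)$, $d(s x)=-s(dx)$), let $C=S[sL]$ be the graded symmetric $R$-algebra on $sL$, with the shuffle diagonal $\Delta$, with the differential $d^0$ induced by that of $L$, and with the coaugmentation filtration $C_n=\bigoplus_{m\le n}S^m[sL]$. Let $\partial$ be a degree $-1$ coderivation of $C$ which lowers the coaugmentation filtration ($\partial C_0=0$ and $\partial C_{n+1}\subseteq C_n$), and write $\partial=\partial^1+\partial^2+\cdots$, where $\partial^j$ is the constituent that lowers the symmetric power by exactly $j$ (equivalently, the coderivation determined by the component $S^{j+1}[sL]\to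 sL$ of $\partial$). Let $t\colon C\to \mathrm{Der}(A|R)$ be an $R$-linear map of degree $-1$ that vanishes on $C_0=R$, and write $t=t_1+t_2+\cdots$, where $t_j$ is the component of $t$ on $S^j[sL]$. The data $(A,L,\partial,t)$ are an *sh Lie–Rinehart algebra* when: (1) $(d^0+\partial)^2=0$; (2) $t$ is a Lie algebra twisting cochain $(C,d^0+\partial)\to \mathrm{Der}(A|R)$, that is, $[d,t(x)]+t((d^0+\partial)x)+\tfrac12[t,t](x)=0$ for all $x \in C$, where $d$ is the differential of $A$ and $[t,t]$ is the cup bracket; (3) $t$ is graded $A$-multilinear; (4) for all $j\ge 1$ and all homogeneous $\alpha_1,\dots,\alpha_{j+1}\in sL$ and $a\in A$, $$\partial^j(\alpha_1,\dots,\alpha_j,a\alpha_{j+1})=t_j(\alpha_1,\dots,\alpha_j)(a)\,\alpha_{j+1}+(-1)^{(|\alpha_1|+\cdots+|\alpha_j|+1)|a|}\,a\,\partial^j(\alpha_1,\dots,\alpha_j,\alpha_{j+1}).$$ A *multi derivation chain algebra* $(\mathcal A,\mathcal D_0,\mathcal D_1,\dots)$ is a graded commutative $R$-algebra $\mathcal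 A$ with a descending filtration $\mathcal A=\mathcal A^0\supseteq\mathcal A^1\supseteq\cdots$ and degree $-1$ derivations $\mathcal D_j$ of $\mathcal A$ ($j\ge0$) such that $\mathcal D_0$ is a differential, $\mathcal D_j\mathcal A^\ell\subseteq\mathcal A^{\ell+j}$ for all $j,\ell \geq 0$, for $j\ge1$ a non-zero $\mathcal D_j$ does not satisfy $\mathcal D_j\mathcal A^\ell\subseteq\mathcal A^{\ell+j+1}$ for all $\ell$, and the series $\sum_{j\ge0}\mathcal D_j$ converges (either with only finitely many non-zero terms on each homogeneous element, or with respect to the filtration, which is then required to be complete) to a derivation of square zero. In $\mathrm{Hom}(C,A)$, with the cup product, let $\mathcal D_0\varphi=d\varphi+(-1)^{|\varphi|+1}\varphi d^0$ and, for $j\ge1$, $\mathcal D_j\varphi=[t_j,\varphi]+(-1)^{|\varphi|+1}\varphi\,\partial^j$, where $[t_j,\varphi](x)=\sum(-1)^{|\varphi||x_1|}t_j(x_1)(\varphi(x_2))$ for $\Delta x=\sum x_1\otimes x_2$. Let $\mathrm{Sym}_A(sL,A)\subseteq \mathrm{Hom}(C,A)$ be the graded algebra of graded symmetric, graded $A$-multilinear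 $A$-valued forms on $sL$, where the $\ell$-th filtration constituent ($\ell\ge1$) consists of the forms that vanish on $C_{\ell-1}$. **Theorem.** $(A,L,\partial,t)$ is an sh Lie–Rinehart algebra if and only if the operators $\mathcal D_0,\mathcal D_1,\mathcal D_2,\dots$ pass to $\mathrm{Sym}_A(sL,A)$ and $(\mathrm{Sym}_A(sL,A),\mathcal D_0,\mathcal D_1,\mathcal D_2,\dots)$ is a multi derivation chain algebra. In that case the latter is the multi derivation Maurer–Cartan algebra associated to the sh Lie–Rinehart algebra $(A,L,\partial,t)$, i.e. the multi derivation chain algebra formed by $\mathrm{Sym}_A(sL,A)$ and the operators $\mathcal D_j$ determined by these data. -/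

import Mathlib

open scoped TensorProduct DirectSum

namespace SHLR

noncomputable section

universe u v w

section Sign

variable {R : Type u} [CommRing R] {V : Type v} [AddCommGroup V] [Module R V]

/-- The `R`-linear operator on a graded module `V` which multiplies the component of degree `i`
by `(-1) ^ (q * i)`. -/
def sgn (𝒱 : ℤ → Submodule R V) [DirectSum.Decomposition 𝒱] (q : ℤ) : V →ₗ[R] V :=
  DirectSum.toModule R ℤ V (fun i => (q * i).negOnePow • (𝒱 i).subtype) ∘ₗ
    (DirectSum.decomposeLinearEquiv 𝒱).toLinearMap

theorem sgn_apply (𝒱 : ℤ → Submodule R V) [DirectSum.Decomposition 𝒱] (q : ℤ) {i : ℤ} {x : V}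
    (hx : x ∈ 𝒱 i) : sgn 𝒱 q x = (q * i).negOnePow • x := by
  lift x to 𝒱 i using hx
  simp only [sgn, LinearMap.comp_apply, LinearEquiv.coe_coe,
    DirectSum.decomposeLinearEquiv_apply, DirectSum.decompose_coe]
  rw [← DirectSum.lof_eq_of R, DirectSum.toModule_lof]
  rfl

/-- A differential of a graded module: a linear operator of degree `-1` with square zero. -/
structure Differential (𝒱 : ℤ → Submodule R V) where
  /-- the underlying operator -/
  toLin : V →ₗ[R] V
  degree : ∀ n, ∀ x ∈ 𝒱 n, toLin x ∈ 𝒱 (n - 1)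
  sq_zero : ∀ x, toLin (toLin x) = 0

end Sign

section GradedSym

variable {R : Type u} [CommRing R] {V : Type v} [AddCommGroup V] [Module R V]

/-- The relations of graded commutativity `x y = (-1) ^ (|x| |y|) y x` in the tensor algebra. -/
inductive GSymRel (𝒱 : ℤ → Submodule R V) : TensorAlgebra R V → TensorAlgebra R V → Prop
  | swap {i j : ℤ} {x y : V} (hx : x ∈ 𝒱 i) (hy : y ∈ 𝒱 j) :
      GSymRel 𝒱 (TensorAlgebra.ι R x * TensorAlgebra.ι R y)
        ((i * j).negOnePow • (TensorAlgebra.ι R y * TensorAlgebra.ι R x))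

/-- The graded symmetric `R`-algebra `S[V]` on the graded `R`-module `V = ⨁ 𝒱 i`. -/
def GSym (𝒱 : ℤ → Submodule R V) : Type (max u v) := RingQuot (GSymRel 𝒱)

namespace GSym

variable (𝒱 : ℤ → Submodule R V)

instance : Ring (GSym 𝒱) := inferInstanceAs (Ring (RingQuot (GSymRel 𝒱)))

instance : Algebra R (GSym 𝒱) := inferInstanceAs (Algebra R (RingQuot (GSymRel 𝒱)))

/-- The quotient map from the tensor algebra. -/
def mk : TensorAlgebra R V →ₐ[R] GSym 𝒱 := RingQuot.mkAlgHom R (GSymRel 𝒱)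

/-- The canonical map `V → S[V]`. -/
def ι : V →ₗ[R] GSym 𝒱 := (mk 𝒱).toLinearMap ∘ₗ TensorAlgebra.ι R

theorem ι_mul_ι {i j : ℤ} {x y : V} (hx : x ∈ 𝒱 i) (hy : y ∈ 𝒱 j) :
    ι 𝒱 x * ι 𝒱 y = (i * j).negOnePow • (ι 𝒱 y * ι 𝒱 x) := by
  have h : mk 𝒱 _ = mk 𝒱 _ := RingQuot.mkAlgHom_rel R (GSymRel.swap (𝒱 := 𝒱) hx hy)
  rcases Int.units_eq_one_or (i * j).negOnePow with h1 | h1 <;> rw [h1] at h ⊢ <;>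
    simpa only [ι, LinearMap.comp_apply, AlgHom.toLinearMap_apply, one_smul, Units.neg_smul,
      map_mul, map_neg] using h

variable {𝒱} in
/-- The universal property of `S[V]`. -/
def lift {B : Type w} [Ring B] [Algebra R B] (f : V →ₗ[R] B)
    (hf : ∀ (i j : ℤ) (x y : V), x ∈ 𝒱 i → y ∈ 𝒱 j → f x * f y = (i * j).negOnePow • (f y * f x)) :
    GSym 𝒱 →ₐ[R] B :=
  RingQuot.liftAlgHom R ⟨TensorAlgebra.lift R f, by
    rintro _ _ ⟨hx, hy⟩
    rename_i i j x y
    have h := hf i j x y hx hy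
    rcases Int.units_eq_one_or (i * j).negOnePow with h1 | h1 <;> rw [h1] at h ⊢ <;>
      simpa using h⟩

@[simp]
theorem lift_ι {B : Type w} [Ring B] [Algebra R B] (f : V →ₗ[R] B)
    (hf : ∀ (i j : ℤ) (x y : V), x ∈ 𝒱 i → y ∈ 𝒱 j → f x * f y = (i * j).negOnePow • (f y * f x))
    (x : V) : lift f hf (ι 𝒱 x) = f x := by
  have : lift f hf (ι 𝒱 x) = TensorAlgebra.lift R f (TensorAlgebra.ι R x) :=
    RingQuot.liftAlgHom_mkAlgHom_apply R _ _ _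
  simpa using this

variable {𝒱} in
theorem algHom_ext {B : Type w} [Ring B] [Algebra R B] {f g : GSym 𝒱 →ₐ[R] B}
    (h : ∀ x, f (ι 𝒱 x) = g (ι 𝒱 x)) : f = g := by
  apply RingQuot.ringQuot_ext'
  apply TensorAlgebra.hom_ext
  ext x
  exact h x

/-- The product `x₁ ⋯ xₙ` in `S[V]` of a finite list of homogeneous elements of `V`. -/
def listProd (l : List (Σ i, 𝒱 i)) : GSym 𝒱 := (l.map fun x => ι 𝒱 (x.2 : V)).prod

/-- If homogeneous elements of degree `i` of `V` get the weight `w i`, then `piece 𝒱 w m` is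
spanned by the products `x₁ ⋯ xₙ` of homogeneous elements of `V` of total weight `m`. -/
def piece {M : Type w} [AddCommMonoid M] (w : ℤ → M) (m : M) : Submodule R (GSym 𝒱) :=
  Submodule.span R {x | ∃ l : List (Σ i, 𝒱 i), (l.map fun y => w y.1).sum = m ∧ listProd 𝒱 l = x}

section Piece

variable {M : Type w} [AddCommMonoid M] (w : ℤ → M)

theorem listProd_mem (l : List (Σ i, 𝒱 i)) :
    listProd 𝒱 l ∈ piece 𝒱 w (l.map fun y => w y.1).sum :=
  Submodule.subset_span ⟨l, rfl, rfl⟩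

theorem ι_mem_piece {i : ℤ} (x : 𝒱 i) : ι 𝒱 (x : V) ∈ piece 𝒱 w (w i) :=
  Submodule.subset_span ⟨[⟨i, x⟩], by simp, by simp [listProd]⟩

instance piece_gradedMonoid : SetLike.GradedMonoid (piece 𝒱 w) where
  one_mem := Submodule.subset_span ⟨[], by simp, by simp [listProd]⟩
  mul_mem := by
    intro m n x y hx hy
    have := Submodule.mul_mem_mul hx hy
    rw [piece, piece, Submodule.span_mul_span] at this
    refine Submodule.span_mono ?_ this
    rintro _ ⟨_, ⟨l, rfl, rfl⟩, _, ⟨l', rfl, rfl⟩, rfl⟩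
    exact ⟨l ++ l', by simp, by simp [listProd]⟩

variable [DecidableEq M] [DirectSum.Decomposition 𝒱]

/-- Auxiliary construction for `GSym.pieceGradedAlgebra`. -/
def pieceι : V →ₗ[R] ⨁ m, piece 𝒱 w m :=
  DirectSum.toModule R ℤ _ (fun i => DirectSum.lof R M (fun m => piece 𝒱 w m) (w i) ∘ₗ
      ((ι 𝒱 ∘ₗ (𝒱 i).subtype).codRestrict (piece 𝒱 w (w i)) fun x => ι_mem_piece 𝒱 w x)) ∘ₗ
    (DirectSum.decomposeLinearEquiv 𝒱).toLinearMap

theorem pieceι_apply {i : ℤ} (x : 𝒱 i) :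
    pieceι 𝒱 w (x : V) =
      DirectSum.of (fun m => piece 𝒱 w m) (w i) ⟨ι 𝒱 (x : V), ι_mem_piece 𝒱 w x⟩ := by
  simp only [pieceι, LinearMap.comp_apply, LinearEquiv.coe_coe,
    DirectSum.decomposeLinearEquiv_apply, DirectSum.decompose_coe]
  rw [← DirectSum.lof_eq_of R, DirectSum.toModule_lof]
  rfl

theorem pieceι_mul (i j : ℤ) (x y : V) (hx : x ∈ 𝒱 i) (hy : y ∈ 𝒱 j) :
    pieceι 𝒱 w x * pieceι 𝒱 w y = (i * j).negOnePow • (pieceι 𝒱 w y * pieceι 𝒱 w x) := by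
  lift x to 𝒱 i using hx
  lift y to 𝒱 j using hy
  have h := ι_mul_ι 𝒱 x.2 y.2
  rw [pieceι_apply, pieceι_apply, DirectSum.of_mul_of, DirectSum.of_mul_of]
  rcases Int.units_eq_one_or (i * j).negOnePow with h1 | h1 <;> rw [h1] at h ⊢
  · rw [one_smul] at h ⊢
    exact DirectSum.of_eq_of_gradedMonoid_eq (Sigma.subtype_ext (add_comm _ _) h)
  · rw [Units.neg_smul, one_smul] at h
    rw [Units.smul_def, Units.val_neg, Units.val_one]
    refine Eq.trans ?_ (neg_one_zsmul _).symm
    refine Eq.trans ?_ (map_neg (DirectSum.of (fun m => piece 𝒱 w m) (w j + w i)) _)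
    exact DirectSum.of_eq_of_gradedMonoid_eq (Sigma.subtype_ext (add_comm _ _) h)

/-- Auxiliary construction for `GSym.pieceGradedAlgebra`. -/
def pieceLift : GSym 𝒱 →ₐ[R] ⨁ m, piece 𝒱 w m :=
  lift (B := ⨁ m, piece 𝒱 w m) (pieceι 𝒱 w) (pieceι_mul 𝒱 w)

theorem pieceLift_ι (x : V) : pieceLift 𝒱 w (ι 𝒱 x) = pieceι 𝒱 w x :=
  lift_ι (B := ⨁ m, piece 𝒱 w m) 𝒱 _ (pieceι_mul 𝒱 w) x

theorem pieceLift_listProd (l : List (Σ i, 𝒱 i)) :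
    pieceLift 𝒱 w (listProd 𝒱 l) =
      DirectSum.of (fun m => piece 𝒱 w m) _ ⟨listProd 𝒱 l, listProd_mem 𝒱 w l⟩ := by
  induction l with
  | nil => exact map_one _
  | cons a l ih =>
    have h : listProd 𝒱 (a :: l) = ι 𝒱 (a.2 : V) * listProd 𝒱 l := by simp [listProd]
    have h2 : pieceLift 𝒱 w (listProd 𝒱 (a :: l)) =
        pieceLift 𝒱 w (ι 𝒱 (a.2 : V)) * pieceLift 𝒱 w (listProd 𝒱 l) := by rw [h, map_mul]
    rw [h2, ih, pieceLift_ι, pieceι_apply, DirectSum.of_mul_of]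
    exact DirectSum.of_eq_of_gradedMonoid_eq (Sigma.subtype_ext List.sum_cons.symm h.symm)

theorem pieceLift_coe (m : M) (x : piece 𝒱 w m) :
    pieceLift 𝒱 w (x : GSym 𝒱) = DirectSum.of (fun m => piece 𝒱 w m) m x := by
  obtain ⟨x, hx⟩ := x
  dsimp only
  induction hx using Submodule.span_induction with
  | mem x hx =>
    obtain ⟨l, rfl, rfl⟩ := hx
    exact pieceLift_listProd 𝒱 w l
  | zero => rw [map_zero]; exact (map_zero _).symm
  | add x y hx hy ihx ihy => rw [map_add, ihx, ihy, ← map_add]; rfl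
  | smul r x hx ih =>
    rw [map_smul, ih, ← DirectSum.lof_eq_of R, ← map_smul]; rfl

instance pieceGradedAlgebra : GradedAlgebra (piece 𝒱 w) :=
  GradedAlgebra.ofAlgHom _ (pieceLift 𝒱 w)
    (by
      apply algHom_ext
      intro x
      induction x using DirectSum.Decomposition.inductionOn 𝒱 with
      | zero => simp
      | homogeneous x =>
        rw [AlgHom.comp_apply, pieceLift_ι, pieceι_apply, DirectSum.coeAlgHom_of]; rfl
      | add x y hx hy => rw [map_add, map_add, map_add, hx, hy])
    (pieceLift_coe 𝒱 w)

end Piece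

end GSym
end GradedSym

section Coalgebra

open TensorProduct

variable {R : Type u} [CommRing R] {V : Type v} [AddCommGroup V] [Module R V]
variable (𝒱 : ℤ → Submodule R V)

namespace GSym

/-- The total degree on `S[V]`: `deg 𝒱 n` is spanned by the products of homogeneous elements of
`V` whose degrees add up to `n`. -/
abbrev deg : ℤ → Submodule R (GSym 𝒱) := piece 𝒱 (fun i => i)

/-- The symmetric powers: `wt 𝒱 n` is `Sⁿ[V]`, spanned by the products of `n` elements of `V`. -/
abbrev wt : ℕ → Submodule R (GSym 𝒱) := piece 𝒱 (fun _ => 1)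

/-- The coaugmentation filtration `C₀ ⊆ C₁ ⊆ ⋯` of `S[V]`, `Cₙ = S⁰[V] ⊕ ⋯ ⊕ Sⁿ[V]`. -/
def coaugFiltration (n : ℕ) : Submodule R (GSym 𝒱) := ⨆ m ≤ n, wt 𝒱 m

/-- The counit `ε : S[V] → R`. -/
def counit : GSym 𝒱 →ₐ[R] R := lift (𝒱 := 𝒱) 0 (by simp)

/-- The projection of `S[V]` onto `S¹[V] = V`. -/
def projV : GSym 𝒱 →ₗ[R] V :=
  letI : Module Rᵐᵒᵖ V := Module.compHom _ ((RingHom.id R).fromOpposite mul_comm)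
  haveI : IsCentralScalar R V := ⟨fun r m => rfl⟩
  TrivSqZeroExt.sndHom R V ∘ₗ
    (lift (𝒱 := 𝒱) (B := TrivSqZeroExt R V) (TrivSqZeroExt.inrHom R V) (by simp)).toLinearMap

variable [DirectSum.Decomposition 𝒱]

/-- The projection `S[V] → Sⁿ[V] ⊆ S[V]`. -/
def projWt (n : ℕ) : GSym 𝒱 →ₗ[R] GSym 𝒱 :=
  (wt 𝒱 n).subtype ∘ₗ DirectSum.component R ℕ (fun n => wt 𝒱 n) n ∘ₗ
    (DirectSum.decomposeLinearEquiv (wt 𝒱)).toLinearMap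

theorem sgn_ι (q : ℤ) {i : ℤ} {x : V} (hx : x ∈ 𝒱 i) :
    sgn (deg 𝒱) q (ι 𝒱 x) = (q * i).negOnePow • ι 𝒱 x :=
  sgn_apply (deg 𝒱) q (ι_mem_piece 𝒱 (fun i => i) ⟨x, hx⟩)

/-- The map `v ↦ v ⊗ 1 + 1 ⊗ v` from `V` into the graded tensor product of algebras
`S[V] ⊗ S[V]`. -/
def comulι : V →ₗ[R] (deg 𝒱 ᵍ⊗[R] deg 𝒱) :=
  (GradedTensorProduct.includeLeft (deg 𝒱) (deg 𝒱)).toLinearMap ∘ₗ ι 𝒱 +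
    (GradedTensorProduct.includeRight (deg 𝒱) (deg 𝒱)).toLinearMap ∘ₗ ι 𝒱

theorem comulι_apply (x : V) :
    comulι 𝒱 x = (ι 𝒱 x ᵍ⊗ₜ[R] 1 + 1 ᵍ⊗ₜ[R] ι 𝒱 x : deg 𝒱 ᵍ⊗[R] deg 𝒱) := rfl

theorem comulι_mul (i j : ℤ) (x y : V) (hx : x ∈ 𝒱 i) (hy : y ∈ 𝒱 j) :
    comulι 𝒱 x * comulι 𝒱 y = (i * j).negOnePow • (comulι 𝒱 y * comulι 𝒱 x) := by
  rw [comulι_apply, comulι_apply]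
  have mx := ι_mem_piece 𝒱 (fun i => i) ⟨x, hx⟩
  have my := ι_mem_piece 𝒱 (fun i => i) ⟨y, hy⟩
  have h1 : ∀ z w : GSym 𝒱, (z ᵍ⊗ₜ[R] 1 : deg 𝒱 ᵍ⊗[R] deg 𝒱) * (w ᵍ⊗ₜ[R] 1) =
      ((z * w) ᵍ⊗ₜ[R] 1) := fun z w => (map_mul (GradedTensorProduct.includeLeft _ _) z w).symm
  have h2 : ∀ z w : GSym 𝒱, (1 ᵍ⊗ₜ[R] z : deg 𝒱 ᵍ⊗[R] deg 𝒱) * (1 ᵍ⊗ₜ[R] w) =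
      (1 ᵍ⊗ₜ[R] (z * w)) := fun z w => (map_mul (GradedTensorProduct.includeRight _ _) z w).symm
  have h3 : ∀ z w : GSym 𝒱, (z ᵍ⊗ₜ[R] 1 : deg 𝒱 ᵍ⊗[R] deg 𝒱) * (1 ᵍ⊗ₜ[R] w) =
      (z ᵍ⊗ₜ[R] w) := fun z w => GradedTensorProduct.tmul_one_mul_one_tmul _ _ z w
  have h4 : ∀ (k l : ℤ) (z w : GSym 𝒱), z ∈ deg 𝒱 k → w ∈ deg 𝒱 l →
      (1 ᵍ⊗ₜ[R] z : deg 𝒱 ᵍ⊗[R] deg 𝒱) * (w ᵍ⊗ₜ[R] 1) =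
        (k * l).negOnePow • (w ᵍ⊗ₜ[R] z : deg 𝒱 ᵍ⊗[R] deg 𝒱) := by
    intro k l z w hz hw
    have := GradedTensorProduct.tmul_coe_mul_coe_tmul (R := R) (𝒜 := deg 𝒱) (ℬ := deg 𝒱)
      1 ⟨z, hz⟩ ⟨w, hw⟩ 1
    rw [one_mul, mul_one] at this
    exact this
  have h5 : ∀ z w : GSym 𝒱, ((-z) ᵍ⊗ₜ[R] w : deg 𝒱 ᵍ⊗[R] deg 𝒱) = -(z ᵍ⊗ₜ[R] w) := fun z w =>
    (congrArg (GradedTensorProduct.of R (deg 𝒱) (deg 𝒱)) (TensorProduct.neg_tmul z w)).trans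
      (map_neg _ _)
  have h6 : ∀ z w : GSym 𝒱, (z ᵍ⊗ₜ[R] (-w) : deg 𝒱 ᵍ⊗[R] deg 𝒱) = -(z ᵍ⊗ₜ[R] w) := fun z w =>
    (congrArg (GradedTensorProduct.of R (deg 𝒱) (deg 𝒱)) (TensorProduct.tmul_neg z w)).trans
      (map_neg _ _)
  have hc : (j * i).negOnePow = (i * j).negOnePow := by rw [mul_comm]
  simp only [add_mul, mul_add, h1, h2, h3, h4 _ _ _ _ mx my, h4 _ _ _ _ my mx, hc,
    ι_mul_ι 𝒱 hx hy]
  rcases Int.units_eq_one_or (i * j).negOnePow with h | h <;> rw [h]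
  · simp only [one_smul]; abel
  · simp only [Units.neg_smul, one_smul, h5, h6]
    abel

/-- The shuffle diagonal, as the morphism of algebras `S[V] → S[V] ⊗ S[V]` into the graded
tensor product (with the Koszul sign in its product) which extends `v ↦ v ⊗ 1 + 1 ⊗ v`. -/
def comulAlgHom : GSym 𝒱 →ₐ[R] (deg 𝒱 ᵍ⊗[R] deg 𝒱) :=
  lift (B := deg 𝒱 ᵍ⊗[R] deg 𝒱) (comulι 𝒱) (comulι_mul 𝒱)

theorem comulAlgHom_ι (x : V) :
    comulAlgHom 𝒱 (ι 𝒱 x) = (ι 𝒱 x ᵍ⊗ₜ[R] 1 + 1 ᵍ⊗ₜ[R] ι 𝒱 x : deg 𝒱 ᵍ⊗[R] deg 𝒱) :=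
  (lift_ι (B := deg 𝒱 ᵍ⊗[R] deg 𝒱) 𝒱 (comulι 𝒱) (comulι_mul 𝒱) x).trans (comulι_apply 𝒱 x)

/-- The shuffle diagonal `Δ : S[V] → S[V] ⊗ S[V]`. -/
def comul : GSym 𝒱 →ₗ[R] GSym 𝒱 ⊗[R] GSym 𝒱 :=
  (GradedTensorProduct.of R (deg 𝒱) (deg 𝒱)).symm.toLinearMap ∘ₗ (comulAlgHom 𝒱).toLinearMap

/-- The graded interchange map `x ⊗ y ↦ (-1) ^ (|x| |y|) y ⊗ x`. -/
def swap : GSym 𝒱 ⊗[R] GSym 𝒱 →ₗ[R] GSym 𝒱 ⊗[R] GSym 𝒱 :=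
  (GradedTensorProduct.of R (deg 𝒱) (deg 𝒱)).symm.toLinearMap ∘ₗ
    (GradedTensorProduct.comm (deg 𝒱) (deg 𝒱)).toLinearMap ∘ₗ
      (GradedTensorProduct.of R (deg 𝒱) (deg 𝒱)).toLinearMap

/-- `∂` is a coderivation of degree `-1` of `S[V]`: `Δ ∂ = (∂ ⊗ 1 + 1 ⊗ ∂) Δ`, where
`(1 ⊗ ∂) (x ⊗ y) = (-1) ^ |x| x ⊗ ∂ y`. -/
structure IsCoderivation (δ : GSym 𝒱 →ₗ[R] GSym 𝒱) : Prop where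
  degree : ∀ n, ∀ x ∈ deg 𝒱 n, δ x ∈ deg 𝒱 (n - 1)
  comul_comp : comul 𝒱 ∘ₗ δ =
    (TensorProduct.map δ LinearMap.id + TensorProduct.map (sgn (deg 𝒱) 1) δ) ∘ₗ comul 𝒱

/-- The component of a linear operator on `S[V]` which lowers the symmetric power by exactly `j`,
that is, whose restriction to `Sⁿ[V]` is the composite `Sⁿ[V] → S[V] → Sⁿ⁻ʲ[V]` for `j ≤ n` and
is zero for `n < j`. For a coderivation, this is the coderivation which is determined by the
constituent `Sʲ⁺¹[V] → V`. -/
def lowerPart (j : ℕ) (δ : GSym 𝒱 →ₗ[R] GSym 𝒱) : GSym 𝒱 →ₗ[R] GSym 𝒱 :=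
  DirectSum.toModule R ℕ (GSym 𝒱)
      (fun n => if j ≤ n then projWt 𝒱 (n - j) ∘ₗ δ ∘ₗ (wt 𝒱 n).subtype else 0) ∘ₗ
    (DirectSum.decomposeLinearEquiv (wt 𝒱)).toLinearMap

/-- A filtered filtration lowering coderivation of degree `-1`: the coaugmentation filtration is
lowered by `δ`, so that `δ` is the sum of its constituents `lowerPart 𝒱 j δ`, `j ≥ 1`. -/
structure IsFilteredCoderivation (δ : GSym 𝒱 →ₗ[R] GSym 𝒱) : Prop extends IsCoderivation 𝒱 δ where
  map_zero : ∀ x ∈ coaugFiltration 𝒱 0, δ x = 0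
  map_succ : ∀ n, ∀ x ∈ coaugFiltration 𝒱 (n + 1), δ x ∈ coaugFiltration 𝒱 n

/-- Auxiliary construction for `GSym.diff`. -/
def diffMatrix (d : Differential 𝒱) : V →ₗ[R] Matrix (Fin 2) (Fin 2) (GSym 𝒱) where
  toFun x := !![sgn (deg 𝒱) 1 (ι 𝒱 x), ι 𝒱 (d.toLin x); 0, ι 𝒱 x]
  map_add' x y := by simp
  map_smul' r x := by simp

theorem diffMatrix_mul (d : Differential 𝒱) (i j : ℤ) (x y : V) (hx : x ∈ 𝒱 i) (hy : y ∈ 𝒱 j) :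
    diffMatrix 𝒱 d x * diffMatrix 𝒱 d y =
      (i * j).negOnePow • (diffMatrix 𝒱 d y * diffMatrix 𝒱 d x) := by
  have e1 : (1 * i).negOnePow = i.negOnePow := by rw [one_mul]
  have e2 : (1 * j).negOnePow = j.negOnePow := by rw [one_mul]
  have e3 : (i * (j - 1)).negOnePow = (i * j).negOnePow * i.negOnePow := by
    rw [mul_sub, mul_one, Int.negOnePow_sub]
  have e4 : ((i - 1) * j).negOnePow = (i * j).negOnePow * j.negOnePow := by
    rw [sub_mul, one_mul, Int.negOnePow_sub]
  have h1 := ι_mul_ι 𝒱 hx hy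
  have h2 := ι_mul_ι 𝒱 hx (d.degree j y hy)
  have h3 := ι_mul_ι 𝒱 (d.degree i x hx) hy
  rw [e3] at h2
  rw [e4] at h3
  simp only [diffMatrix, LinearMap.coe_mk, AddHom.coe_mk, Matrix.mul_fin_two, sgn_ι 𝒱 1 hx,
    sgn_ι 𝒱 1 hy, e1, e2]
  rcases Int.units_eq_one_or (i * j).negOnePow with h | h <;>
  rcases Int.units_eq_one_or i.negOnePow with h' | h' <;>
  rcases Int.units_eq_one_or j.negOnePow with h'' | h'' <;>
  · rw [h] at h1 h2 h3 ⊢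
    rw [h'] at h2 ⊢
    rw [h''] at h3 ⊢
    simp only [Units.neg_smul, one_smul, mul_one, mul_neg, neg_neg] at h1 h2 h3 ⊢
    ext a b
    fin_cases a <;> fin_cases b <;> simp [h1, h2, h3, add_comm]

/-- The morphism of algebras `x ↦ !![(-1) ^ |x| x, d x; 0, x]`; that it is multiplicative says
that `d (x y) = (d x) y + (-1) ^ |x| x (d y)`. -/
def diffAlgHom (d : Differential 𝒱) : GSym 𝒱 →ₐ[R] Matrix (Fin 2) (Fin 2) (GSym 𝒱) :=
  lift (𝒱 := 𝒱) (diffMatrix 𝒱 d) (diffMatrix_mul 𝒱 d)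

/-- The differential `d⁰` of `S[V]` which is induced by the differential of `V`: the derivation
(and coderivation) of degree `-1` which extends it. -/
def diff (d : Differential 𝒱) : GSym 𝒱 →ₗ[R] GSym 𝒱 :=
  Matrix.entryLinearMap R (GSym 𝒱) 0 1 ∘ₗ (diffAlgHom 𝒱 d).toLinearMap

end GSym

end Coalgebra

section DG

variable {R : Type u} [CommRing R] {A : Type v} [Ring A] [Algebra R A]

/-- `A` is a differential graded commutative `R`-algebra with differential `d`. -/
structure IsDGCommAlgebra (𝒜 : ℤ → Submodule R A) [GradedAlgebra 𝒜] (d : Differential 𝒜) :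
    Prop where
  comm : ∀ i j, ∀ a ∈ 𝒜 i, ∀ b ∈ 𝒜 j, a * b = (i * j).negOnePow • (b * a)
  leibniz : ∀ i, ∀ a ∈ 𝒜 i, ∀ b, d.toLin (a * b) = d.toLin a * b + i.negOnePow • (a * d.toLin b)

/-- `L` is a differential graded (left) module, with differential `dL`, over the differential
graded algebra `A`. -/
structure IsDGModule {L : Type w} [AddCommGroup L] [Module R L] [Module A L]
    {𝒜 : ℤ → Submodule R A} (dA : Differential 𝒜) {ℒ : ℤ → Submodule R L} (dL : Differential ℒ) :
    Prop where
  smul_mem : ∀ i j, ∀ a ∈ 𝒜 i, ∀ x ∈ ℒ j, a • x ∈ ℒ (i + j)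
  leibniz : ∀ i, ∀ a ∈ 𝒜 i, ∀ x : L,
    dL.toLin (a • x) = dA.toLin a • x + i.negOnePow • (a • dL.toLin x)

/-- The component of degree `k` of `Der(A|R)`: the `R`-linear operators `δ` on `A` of degree `k`
such that `δ (a b) = (δ a) b + (-1) ^ (k |a|) a (δ b)`. -/
def derPiece (𝒜 : ℤ → Submodule R A) (k : ℤ) : Submodule R (Module.End R A) where
  carrier := {δ | (∀ i, ∀ a ∈ 𝒜 i, δ a ∈ 𝒜 (i + k)) ∧
    ∀ i, ∀ a ∈ 𝒜 i, ∀ b, δ (a * b) = δ a * b + (k * i).negOnePow • (a * δ b)}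
  zero_mem' := ⟨fun _ _ _ => by simp, fun _ _ _ _ => by simp⟩
  add_mem' := by
    rintro δ δ' ⟨h1, h2⟩ ⟨h1', h2'⟩
    refine ⟨fun i a ha => add_mem (h1 i a ha) (h1' i a ha), fun i a ha b => ?_⟩
    simp only [LinearMap.add_apply, h2 i a ha, h2' i a ha, add_mul, mul_add, smul_add]
    abel
  smul_mem' := by
    rintro r δ ⟨h1, h2⟩
    refine ⟨fun i a ha => Submodule.smul_mem _ r (h1 i a ha), fun i a ha b => ?_⟩
    simp only [LinearMap.smul_apply, h2 i a ha, smul_add, smul_mul_assoc, mul_smul_comm,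
      smul_comm r]

/-- The component of degree `q` of the graded `A`-dual `Hom_A(L, A)` of a graded `A`-module `L`:
the maps `f` of degree `q` such that `f (a x) = (-1) ^ (q |a|) a (f x)`. -/
def dualPiece (𝒜 : ℤ → Submodule R A) {L : Type w} [AddCommGroup L] [Module R L] [Module A L]
    (ℒ : ℤ → Submodule R L) (q : ℤ) : Submodule R (L →ₗ[R] A) where
  carrier := {f | (∀ i, ∀ x ∈ ℒ i, f x ∈ 𝒜 (i + q)) ∧
    ∀ i, ∀ a ∈ 𝒜 i, ∀ x, f (a • x) = (q * i).negOnePow • (a * f x)}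
  zero_mem' := ⟨fun _ _ _ => by simp, fun _ _ _ _ => by simp⟩
  add_mem' := by
    rintro f f' ⟨h1, h2⟩ ⟨h1', h2'⟩
    refine ⟨fun i a ha => add_mem (h1 i a ha) (h1' i a ha), fun i a ha b => ?_⟩
    simp only [LinearMap.add_apply, h2 i a ha, h2' i a ha, mul_add, smul_add]
  smul_mem' := by
    rintro r f ⟨h1, h2⟩
    refine ⟨fun i a ha => Submodule.smul_mem _ r (h1 i a ha), fun i a ha b => ?_⟩
    simp only [LinearMap.smul_apply, h2 i a ha, mul_smul_comm, smul_comm r]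

/-- The canonical map from `L` to its double `A`-dual `Hom_A(Hom_A(L, A), A)`, in degree `i`:
`x` goes to the family, indexed by `q`, of the maps `f ↦ (-1) ^ (i q) f x` on the component of
degree `q` of `Hom_A(L, A)`. -/
def toDoubleDual (𝒜 : ℤ → Submodule R A) {L : Type w} [AddCommGroup L] [Module R L] [Module A L]
    (ℒ : ℤ → Submodule R L) (i : ℤ) : ℒ i →ₗ[R] (∀ q, dualPiece 𝒜 ℒ q →ₗ[R] A) :=
  LinearMap.pi fun q => (i * q).negOnePow •
    ((dualPiece 𝒜 ℒ q).subtype.flip ∘ₗ (ℒ i).subtype)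

end DG

section Suspension

variable {R : Type u} [CommRing R] {A : Type v} [Ring A] [Algebra R A]
variable (𝒜 : ℤ → Submodule R A) {L : Type w} [AddCommGroup L] [Module R L]

/-- The suspension `sL` of a graded `A`-module `L`. -/
def Susp (_ : ℤ → Submodule R A) (L : Type w) : Type w := L

namespace Susp

instance : AddCommGroup (Susp 𝒜 L) := inferInstanceAs (AddCommGroup L)

instance : Module R (Susp 𝒜 L) := inferInstanceAs (Module R L)

/-- The canonical map `s : L → sL`, of degree `1`. -/
def s : L ≃ₗ[R] Susp 𝒜 L := LinearEquiv.refl R L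

/-- The automorphism `a ↦ (-1) ^ |a| a` of the graded algebra `A`. -/
def signHom [GradedAlgebra 𝒜] : A →+* A where
  toFun := sgn 𝒜 1
  map_zero' := map_zero _
  map_add' := map_add _
  map_one' := by
    rw [sgn_apply 𝒜 1 (SetLike.GradedOne.one_mem : (1 : A) ∈ 𝒜 0)]; simp
  map_mul' a b := by
    induction a using DirectSum.Decomposition.inductionOn 𝒜 with
    | zero => simp
    | add a a' h h' => simp only [add_mul, map_add, h, h']
    | @homogeneous i a =>
      induction b using DirectSum.Decomposition.inductionOn 𝒜 with
      | zero => simp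
      | add b b' h h' => simp only [mul_add, map_add, h, h']
      | @homogeneous j b =>
        rw [sgn_apply 𝒜 1 a.2, sgn_apply 𝒜 1 b.2, sgn_apply 𝒜 1 (SetLike.mul_mem_graded a.2 b.2),
          mul_add, Int.negOnePow_add]
        rcases Int.units_eq_one_or (1 * i).negOnePow with h | h <;>
        rcases Int.units_eq_one_or (1 * j).negOnePow with h' | h' <;> rw [h, h'] <;>
        simp

/-- The `A`-module structure of `sL`, given by `a (s x) = (-1) ^ |a| s (a x)`. -/
instance [Module A L] [GradedAlgebra 𝒜] : Module A (Susp 𝒜 L) :=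
  Module.compHom L (signHom 𝒜)

theorem smul_s [Module A L] [GradedAlgebra 𝒜] {i : ℤ} {a : A} (ha : a ∈ 𝒜 i) (x : L) :
    a • s 𝒜 x = i.negOnePow • s 𝒜 (a • x) := by
  have h : a • s 𝒜 x = s 𝒜 (sgn 𝒜 1 a • x) := rfl
  rw [h, sgn_apply 𝒜 1 ha, one_mul]
  rcases Int.units_eq_one_or i.negOnePow with h | h <;> rw [h] <;> simp

/-- The grading of the suspension, `(sL)ᵢ = s (Lᵢ₋₁)`. -/
def grading (ℒ : ℤ → Submodule R L) (i : ℤ) : Submodule R (Susp 𝒜 L) :=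
  (ℒ (i - 1)).map (s 𝒜).toLinearMap

instance (ℒ : ℤ → Submodule R L) [DirectSum.Decomposition ℒ] :
    DirectSum.Decomposition (grading 𝒜 ℒ) :=
  DirectSum.IsInternal.chooseDecomposition _ (by
    have h := DirectSum.Decomposition.isInternal ℒ
    rw [DirectSum.isInternal_submodule_iff_iSupIndep_and_iSup_eq_top] at h ⊢
    refine ⟨?_, ?_⟩
    · have h2 := (h.1.comp (f := fun i : ℤ => i - 1) (fun i j hij => by simpa using hij))
      exact h2.map_orderIso (Submodule.orderIsoMapComap (s 𝒜 (L := L)))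
    · have h2 : (⨆ i : ℤ, ℒ (i - 1)) = ⊤ := by
        rw [← h.2]
        exact (Equiv.subRight (1 : ℤ)).iSup_comp (g := ℒ)
      change (⨆ i : ℤ, (ℒ (i - 1)).map (s 𝒜).toLinearMap) = ⊤
      rw [← Submodule.map_iSup, h2, Submodule.map_top]
      exact LinearEquiv.range _)

/-- The differential `d (s x) = - s (d x)` of the suspension. -/
def differential {ℒ : ℤ → Submodule R L} (d : Differential ℒ) : Differential (grading 𝒜 ℒ) where
  toLin := -((s 𝒜).toLinearMap ∘ₗ d.toLin ∘ₗ (s 𝒜).symm.toLinearMap)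
  degree := by
    rintro n _ ⟨x, hx, rfl⟩
    exact neg_mem ⟨d.toLin x, d.degree _ x hx, by simp⟩
  sq_zero x := by simp [d.sq_zero]

end Susp

end Suspension

section Forms

open TensorProduct

variable {R : Type u} [CommRing R] {A : Type v} [Ring A] [Algebra R A]
variable {V : Type w} [AddCommGroup V] [Module R V]
variable (𝒜 : ℤ → Submodule R A) (𝒱 : ℤ → Submodule R V)

/-- Graded `A`-multilinearity of a map `f` of degree `q` from `S[V]` to an `A`-module `N`, viewed
as a family of graded symmetric functions `f (α₁, …, αₙ) = f (α₁ ⋯ αₙ)`: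
`f (a α₁, α₂, …, αₙ) = (-1) ^ (q |a|) a f (α₁, …, αₙ)`. By graded symmetry this determines the
corresponding rule for the other arguments. -/
def IsMultilinear [Module A V] {N : Type*} [AddCommGroup N] [Module R N] [Module A N] (q : ℤ)
    (f : GSym 𝒱 →ₗ[R] N) : Prop :=
  ∀ i, ∀ a ∈ 𝒜 i, ∀ (v : V) (x : GSym 𝒱),
    f (GSym.ι 𝒱 (a • v) * x) = (q * i).negOnePow • (a • f (GSym.ι 𝒱 v * x))

/-- The component of degree `q` of the graded algebra `Sym_A(V, A)` of graded symmetric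
`A`-multilinear `A`-valued forms on `V`, as a part of `Hom(S[V], A)`. -/
def symPiece [Module A V] (q : ℤ) : Submodule R (GSym 𝒱 →ₗ[R] A) where
  carrier := {φ | (∀ i, ∀ x ∈ GSym.deg 𝒱 i, φ x ∈ 𝒜 (i + q)) ∧ IsMultilinear 𝒜 𝒱 q φ}
  zero_mem' := ⟨fun _ _ _ => by simp, fun _ _ _ _ => by simp⟩
  add_mem' := by
    rintro f f' ⟨h1, h2⟩ ⟨h1', h2'⟩
    refine ⟨fun i a ha => add_mem (h1 i a ha) (h1' i a ha), fun i a ha b x => ?_⟩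
    simp only [LinearMap.add_apply, h2 i a ha, h2' i a ha, smul_add]
  smul_mem' := by
    rintro r f ⟨h1, h2⟩
    refine ⟨fun i a ha => Submodule.smul_mem _ r (h1 i a ha), fun i a ha b x => ?_⟩
    simp only [LinearMap.smul_apply, h2 i a ha, smul_eq_mul, mul_smul_comm, smul_comm r]

/-- The descending filtration of `Sym_A(V, A)`: `symFiltration (l + 1)` consists of the forms that
vanish on the constituent `C_l` of the coaugmentation filtration of `S[V]`. -/
def symFiltration [Module A V] (l : ℕ) (q : ℤ) : Submodule R (GSym 𝒱 →ₗ[R] A) where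
  carrier := {φ | φ ∈ symPiece 𝒜 𝒱 q ∧ ∀ m < l, ∀ x ∈ GSym.coaugFiltration 𝒱 m, φ x = 0}
  zero_mem' := ⟨zero_mem _, fun _ _ _ _ => rfl⟩
  add_mem' := by
    rintro f f' ⟨h1, h2⟩ ⟨h1', h2'⟩
    refine ⟨add_mem h1 h1', fun m hm x hx => ?_⟩
    rw [LinearMap.add_apply, h2 m hm x hx, h2' m hm x hx, add_zero]
  smul_mem' := by
    rintro r f ⟨h1, h2⟩
    refine ⟨Submodule.smul_mem _ r h1, fun m hm x hx => ?_⟩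
    rw [LinearMap.smul_apply, h2 m hm x hx, smul_zero]

/-- The unit of `Hom(S[V], A)`. -/
def formOne : GSym 𝒱 →ₗ[R] A := Algebra.linearMap R A ∘ₗ (GSym.counit 𝒱).toLinearMap

variable [DirectSum.Decomposition 𝒱]

/-- The (cup) product `φ ψ` of `φ` with a form `ψ` of degree `q`:
`(φ ψ) (x) = ∑ (-1) ^ (q |x₁|) φ (x₁) ψ (x₂)` where `Δ x = ∑ x₁ ⊗ x₂`. -/
def formMul (q : ℤ) (φ ψ : GSym 𝒱 →ₗ[R] A) : GSym 𝒱 →ₗ[R] A :=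
  LinearMap.mul' R A ∘ₗ TensorProduct.map (φ ∘ₗ sgn (GSym.deg 𝒱) q) ψ ∘ₗ GSym.comul 𝒱

/-- The pairing `[t, φ]` of `t : S[V] → Der(A|R)` with a form `φ` of degree `q`:
`[t, φ] (x) = ∑ (-1) ^ (q |x₁|) t (x₁) (φ (x₂))` where `Δ x = ∑ x₁ ⊗ x₂`. -/
def derPairing (q : ℤ) (t : GSym 𝒱 →ₗ[R] Module.End R A) (φ : GSym 𝒱 →ₗ[R] A) :
    GSym 𝒱 →ₗ[R] A :=
  TensorProduct.lift (LinearMap.id : Module.End R A →ₗ[R] A →ₗ[R] A) ∘ₗ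
    TensorProduct.map (t ∘ₗ sgn (GSym.deg 𝒱) q) φ ∘ₗ GSym.comul 𝒱

/-- The cup bracket of `f, g : S[V] → Der(A|R)` of degrees `p` and `q`:
`[f, g] (x) = ∑ (-1) ^ (q |x₁|) [f (x₁), g (x₂)]` where `Δ x = ∑ x₁ ⊗ x₂` and where
`[δ, δ'] = δ δ' - (-1) ^ (|δ| |δ'|) δ' δ`. -/
def cupBracket (p q : ℤ) (f g : GSym 𝒱 →ₗ[R] Module.End R A) : GSym 𝒱 →ₗ[R] Module.End R A :=
  LinearMap.mul' R (Module.End R A) ∘ₗ TensorProduct.map (f ∘ₗ sgn (GSym.deg 𝒱) q) g ∘ₗ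
      GSym.comul 𝒱 -
    (p * q).negOnePow • (LinearMap.mul' R (Module.End R A) ∘ₗ
      TensorProduct.map (g ∘ₗ sgn (GSym.deg 𝒱) p) f ∘ₗ GSym.swap 𝒱 ∘ₗ GSym.comul 𝒱)

/-- A filtered morphism `t : S[V] → Der(A|R)` of degree `-1`: it vanishes on `C₀ = R`, so that
it is the sum of its constituents `t ∘ projWt 𝒱 j`, `j ≥ 1`. -/
structure IsFilteredMorphism (t : GSym 𝒱 →ₗ[R] Module.End R A) : Prop where
  degree : ∀ n, ∀ x ∈ GSym.deg 𝒱 n, t x ∈ derPiece 𝒜 (n - 1)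
  map_zero : ∀ x ∈ GSym.coaugFiltration 𝒱 0, t x = 0

variable {𝒜 𝒱}

/-- `t` is a Lie algebra twisting cochain `(S[V], dC) → Der(A|R)`: `𝒟 t + t ∧ t = 0`, where
`t ∧ t = ½ [t, t]` and `𝒟 t (x) = d (t (x)) + t (dC x)`, with the differential
`d δ = dA δ - (-1) ^ |δ| δ dA` of `Der(A|R)`. -/
structure IsTwistingCochain [Algebra ℚ R] (dA : Differential 𝒜) (dC : GSym 𝒱 →ₗ[R] GSym 𝒱)
    (t : GSym 𝒱 →ₗ[R] Module.End R A) : Prop extends IsFilteredMorphism 𝒜 𝒱 t where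
  twisting : ∀ n, ∀ x ∈ GSym.deg 𝒱 n,
    (dA.toLin ∘ₗ t x - (n - 1).negOnePow • (t x ∘ₗ dA.toLin)) + t (dC x) +
      algebraMap ℚ R (1 / 2) • cupBracket 𝒱 (-1) (-1) t t x = 0

/-- The operator `𝒟₀` on forms `φ` of degree `q`: `𝒟₀ φ = dA φ + (-1) ^ (q + 1) φ d⁰`. -/
def homDiff (dA : Differential 𝒜) (dV : Differential 𝒱) (q : ℤ) (φ : GSym 𝒱 →ₗ[R] A) :
    GSym 𝒱 →ₗ[R] A :=
  dA.toLin ∘ₗ φ + (q + 1).negOnePow • (φ ∘ₗ GSym.diff 𝒱 dV)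

/-- The operators `𝒟₀, 𝒟₁, 𝒟₂, …` on forms `φ` of degree `q`: for `j ≥ 1`,
`𝒟ⱼ φ = [tⱼ, φ] + (-1) ^ (q + 1) φ ∂ʲ`, with the constituents `tⱼ` of `t` and `∂ʲ` of `∂`. -/
def multiDiff (dA : Differential 𝒜) (dV : Differential 𝒱) (δ : GSym 𝒱 →ₗ[R] GSym 𝒱)
    (t : GSym 𝒱 →ₗ[R] Module.End R A) (j : ℕ) (q : ℤ) (φ : GSym 𝒱 →ₗ[R] A) : GSym 𝒱 →ₗ[R] A :=
  if j = 0 then homDiff dA dV q φ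
  else derPairing 𝒱 q (t ∘ₗ GSym.projWt 𝒱 j) φ +
    (q + 1).negOnePow • (φ ∘ₗ GSym.lowerPart 𝒱 j δ)

end Forms

section MultiDerivation

variable {R : Type u} [CommRing R] {X : Type v} [AddCommGroup X] [Module R X]

/-- `(𝒳, mul, one)` is a graded commutative `R`-algebra. It is externally graded, with homogeneous
constituents `𝒳 q` that are given as submodules of some `R`-module `X`; `mul p q` is the product
of an element of degree `p` and an element of degree `q`. -/
structure IsGradedCommAlgebra (𝒳 : ℤ → Submodule R X) (mul : ℤ → ℤ → X → X → X) (one : X) :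
    Prop where
  one_mem : one ∈ 𝒳 0
  mul_mem : ∀ p q, ∀ x ∈ 𝒳 p, ∀ y ∈ 𝒳 q, mul p q x y ∈ 𝒳 (p + q)
  add_mul : ∀ p q, ∀ x ∈ 𝒳 p, ∀ x' ∈ 𝒳 p, ∀ y ∈ 𝒳 q,
    mul p q (x + x') y = mul p q x y + mul p q x' y
  smul_mul : ∀ (r : R) (p q : ℤ), ∀ x ∈ 𝒳 p, ∀ y ∈ 𝒳 q, mul p q (r • x) y = r • mul p q x y
  one_mul : ∀ q, ∀ x ∈ 𝒳 q, mul 0 q one x = x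
  mul_assoc : ∀ p q r, ∀ x ∈ 𝒳 p, ∀ y ∈ 𝒳 q, ∀ z ∈ 𝒳 r,
    mul (p + q) r (mul p q x y) z = mul p (q + r) x (mul q r y z)
  mul_comm : ∀ p q, ∀ x ∈ 𝒳 p, ∀ y ∈ 𝒳 q, mul p q x y = (p * q).negOnePow • mul q p y x

/-- `δ` is an (`R`-linear) derivation of degree `-1` of the externally graded algebra `(𝒳, mul)`;
`δ p` is its restriction to the elements of degree `p`. -/
structure IsGradedDerivation (𝒳 : ℤ → Submodule R X) (mul : ℤ → ℤ → X → X → X) (δ : ℤ → X → X) :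
    Prop where
  degree : ∀ p, ∀ x ∈ 𝒳 p, δ p x ∈ 𝒳 (p - 1)
  map_add : ∀ p, ∀ x ∈ 𝒳 p, ∀ y ∈ 𝒳 p, δ p (x + y) = δ p x + δ p y
  map_smul : ∀ (r : R) (p : ℤ), ∀ x ∈ 𝒳 p, δ p (r • x) = r • δ p x
  leibniz : ∀ p q, ∀ x ∈ 𝒳 p, ∀ y ∈ 𝒳 q,
    δ (p + q) (mul p q x y) =
      mul (p - 1) q (δ p x) y + p.negOnePow • mul p (q - 1) x (δ q y)

/-- The descending filtration `F` of `𝒳` is complete: the canonical map from `𝒳 q` to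
`lim 𝒳 q / F l q` is an isomorphism. -/
def IsCompleteFiltration (𝒳 : ℤ → Submodule R X) (F : ℕ → ℤ → Submodule R X) : Prop :=
  ∀ (q : ℤ) (u : ℕ → X), (∀ l, u l ∈ 𝒳 q) → (∀ l, u (l + 1) - u l ∈ F l q) →
    ∃! x, x ∈ 𝒳 q ∧ ∀ l, x - u l ∈ F l q

/-- The operator `T` (of degree `-1`) is the sum of the series `∑ D j`, which converges, either
naively, with only finitely many non-zero values at any homogeneous element, or in the sense of
the complete filtration `F`. -/
def IsSumOf (𝒳 : ℤ → Submodule R X) (F : ℕ → ℤ → Submodule R X) (D : ℕ → ℤ → X → X)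
    (T : ℤ → X → X) : Prop :=
  (∀ q, ∀ x ∈ 𝒳 q, {j | D j q x ≠ 0}.Finite ∧ T q x = ∑ᶠ j, D j q x) ∨
  (IsCompleteFiltration 𝒳 F ∧ ∀ q, ∀ x ∈ 𝒳 q, ∀ l, ∃ N, ∀ m ≥ N,
    T q x - ∑ j ∈ Finset.range m, D j q x ∈ F l (q - 1))

/-- `(𝒳, D 0, D 1, D 2, …)` is a multi derivation chain algebra, with respect to the descending
filtration `F` of the (externally graded) graded commutative algebra `𝒳`. -/
structure IsMultiDerivationChainAlgebra (𝒳 : ℤ → Submodule R X) (mul : ℤ → ℤ → X → X → X)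
    (one : X) (F : ℕ → ℤ → Submodule R X) (D : ℕ → ℤ → X → X) : Prop where
  algebra : IsGradedCommAlgebra 𝒳 mul one
  filtration_zero : ∀ q, F 0 q = 𝒳 q
  filtration_succ : ∀ l q, F (l + 1) q ≤ F l q
  /-- each `D j` is a derivation of degree `-1` of `𝒳` -/
  derivation : ∀ j, IsGradedDerivation 𝒳 mul (D j)
  /-- `D 0` is a differential -/
  sq_zero : ∀ q, ∀ x ∈ 𝒳 q, D 0 (q - 1) (D 0 q x) = 0
  /-- `D j` lowers the filtration by `j`; for `j = 0`, the filtration is compatible with the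
  differential `D 0` -/
  lowers : ∀ j l q, ∀ x ∈ F l q, D j q x ∈ F (l + j) (q - 1)
  /-- for `j ≥ 1`, the operator `D j`, when non-zero, does not lower the filtration by `j + 1` -/
  not_lowers : ∀ j, 1 ≤ j → (∃ q, ∃ x ∈ 𝒳 q, D j q x ≠ 0) →
    ¬ ∀ l q, ∀ x ∈ F l q, D j q x ∈ F (l + j + 1) (q - 1)
  /-- the sum of the `D j` converges and is an (algebra) differential, that is, the sum of the
  `D j` with `j ≥ 1` is an algebra perturbation of `D 0` -/
  perturbation : ∃ T : ℤ → X → X, IsSumOf 𝒳 F D T ∧ IsGradedDerivation 𝒳 mul T ∧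
    ∀ q, ∀ x ∈ 𝒳 q, T (q - 1) (T q x) = 0

end MultiDerivation

section LieRinehart

variable {R : Type u} [CommRing R] {A : Type v} [Ring A] [Algebra R A]
variable {L : Type w} [AddCommGroup L] [Module R L]
variable {𝒜 : ℤ → Submodule R A} {ℒ : ℤ → Submodule R L}

variable (𝒜 ℒ) in
/-- The graded coalgebra `S[sL]`. -/
abbrev SsL : Type (max u w) := GSym (Susp.grading 𝒜 ℒ)

variable [DirectSum.Decomposition ℒ]

/-- `(L, ∂)` is an sh Lie algebra: `∂` is a coaugmentation filtration lowering coalgebra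
perturbation of the coalgebra differential `d⁰` on `S[sL]`. -/
structure IsSHLieAlgebra (dL : Differential ℒ) (δ : SsL 𝒜 ℒ →ₗ[R] SsL 𝒜 ℒ) : Prop
    extends GSym.IsFilteredCoderivation (Susp.grading 𝒜 ℒ) δ where
  sq_zero : (GSym.diff _ (Susp.differential 𝒜 dL) + δ) ∘ₗ
    (GSym.diff _ (Susp.differential 𝒜 dL) + δ) = 0

variable [Algebra ℚ R] [GradedAlgebra 𝒜] [Module A L]

/-- `(A, L, ∂, t)` is an sh Lie-Rinehart algebra: `(L, ∂)` is an sh Lie algebra, `t` is an sh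
action of it on `A` by derivations, `t` is graded `A`-multilinear, and
`∂ʲ (α₁, …, αⱼ, a β) = tⱼ (α₁, …, αⱼ) (a) β + (-1) ^ ((|α₁| + ⋯ + |αⱼ| + 1) |a|) a ∂ʲ (α₁, …, αⱼ, β)`
in `sL`, for `j ≥ 1` and homogeneous elements of `sL` and `A`. -/
structure IsSHLieRinehart (dA : Differential 𝒜) (dL : Differential ℒ)
    (δ : SsL 𝒜 ℒ →ₗ[R] SsL 𝒜 ℒ) (t : SsL 𝒜 ℒ →ₗ[R] Module.End R A) : Prop where
  shLie : IsSHLieAlgebra dL δ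
  twisting : IsTwistingCochain dA (GSym.diff _ (Susp.differential 𝒜 dL) + δ) t
  multilinear : IsMultilinear 𝒜 (Susp.grading 𝒜 ℒ) (-1) t
  anchor : ∀ (j : ℕ), 1 ≤ j → ∀ (n : Fin j → ℤ) (α : Fin j → Susp 𝒜 L) (k : ℤ) (β : Susp 𝒜 L)
    (i : ℤ) (a : A), (∀ l, α l ∈ Susp.grading 𝒜 ℒ (n l)) → β ∈ Susp.grading 𝒜 ℒ k → a ∈ 𝒜 i →
    let x : SsL 𝒜 ℒ := (List.ofFn fun l => GSym.ι (Susp.grading 𝒜 ℒ) (α l)).prod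
    GSym.projV _ (GSym.lowerPart _ j δ (x * GSym.ι _ (a • β))) =
      t (GSym.projWt _ j x) a • β + (((∑ l, n l) + 1) * i).negOnePow •
        (a • GSym.projV _ (GSym.lowerPart _ j δ (x * GSym.ι _ β)))

/-- The data `(Sym_A(sL, A), 𝒟₀, 𝒟₁, 𝒟₂, …)` form a multi derivation chain algebra, where
`𝒟₀, 𝒟₁, 𝒟₂, …` are the operators determined by `(A, L, ∂, t)`. In particular, each `𝒟ⱼ` passes
to a derivation of `Sym_A(sL, A)`. -/
def SymIsMultiDerivationChainAlgebra (dA : Differential 𝒜) (dL : Differential ℒ)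
    (δ : SsL 𝒜 ℒ →ₗ[R] SsL 𝒜 ℒ) (t : SsL 𝒜 ℒ →ₗ[R] Module.End R A) : Prop :=
  IsMultiDerivationChainAlgebra (symPiece 𝒜 (Susp.grading 𝒜 ℒ))
    (fun _ q => formMul (Susp.grading 𝒜 ℒ) q) (formOne (Susp.grading 𝒜 ℒ))
    (symFiltration 𝒜 (Susp.grading 𝒜 ℒ)) (multiDiff dA (Susp.differential 𝒜 dL) δ t)

/-- The family of operators `D` on `Sym_A(sL, A)` is the multi derivation Maurer-Cartan algebra
associated to the sh Lie-Rinehart algebra `(A, L, ∂, t)`: these data are an sh Lie-Rinehart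
algebra, the operators `D 0, D 1, D 2, …` are the operators `𝒟₀, 𝒟₁, 𝒟₂, …` determined by the
data, and they turn `Sym_A(sL, A)` into a multi derivation chain algebra. -/
structure IsAssociatedMaurerCartanAlgebra (dA : Differential 𝒜) (dL : Differential ℒ)
    (δ : SsL 𝒜 ℒ →ₗ[R] SsL 𝒜 ℒ) (t : SsL 𝒜 ℒ →ₗ[R] Module.End R A)
    (D : ℕ → ℤ → (SsL 𝒜 ℒ →ₗ[R] A) → (SsL 𝒜 ℒ →ₗ[R] A)) : Prop where
  shLieRinehart : IsSHLieRinehart dA dL δ t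
  operators : ∀ j q, ∀ φ ∈ symPiece 𝒜 (Susp.grading 𝒜 ℒ) q,
    D j q φ = multiDiff dA (Susp.differential 𝒜 dL) δ t j q φ
  multiDerivation : IsMultiDerivationChainAlgebra (symPiece 𝒜 (Susp.grading 𝒜 ℒ))
    (fun _ q => formMul (Susp.grading 𝒜 ℒ) q) (formOne (Susp.grading 𝒜 ℒ))
    (symFiltration 𝒜 (Susp.grading 𝒜 ℒ)) D

end LieRinehart

end

end SHLR

/-! Write V = sL and fold all data into one pair: τ = t + d·ε (`totalCochain`, with d placed on S⁰
and t on the positive symmetric powers) and γ = d⁰ + ∂. All the 𝒟ⱼ, including 𝒟₀, are then the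
constituents of the single operator D φ = [τ, φ] ± φγ on forms (`multiDiff_eq_formOpPart`). On Cₙ
only the constituents with j ≤ n contribute, so that D is their sum in the complete filtration of
Sym_A(sL, A).

Three facts about D carry the proof. It is a derivation of the cup product, since τ takes values in
derivations and γ is a coderivation (`formOp_leibniz`). Its square is D²φ = [τ ∪ τ + τγ, φ] − φγγ
(`formOp_formOp`), and the vanishing of τ ∪ τ + τγ is exactly the twisting cochain condition
(`conv_totalCochain`). Finally, D preserves A-multilinearity as soon as t is multilinear and γ obeys
the anchor rule: the failure of τ(x) to be A-linear is cancelled by the summand τ(x)(a) v of that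
rule (`formOp_multilinear`). For γ and τ the anchor rule combines condition (4), for j ≥ 1, with the
Leibniz rule of the dg module L, for j = 0. Characteristic zero enters because γ has to be recovered
from its component g : S[V] → V, as γ x = ∑ g(x₁) x₂ (`IsCoderivation.eq_cofreeCoderivation`).

For the converse, D is tested on two kinds of forms. On a constant ε·b one has D(ε·b)(x) = ±
τ(x)(b); stability of Sym_A under D then yields multilinearity of t, and D² = 0 yields the twisting
equation. On f ∘ pr_V, with f in the graded dual of sL, stability yields the anchor rule and D² = 0
yields pr_V γγ = 0, both after applying f. Injectivity of L into its double dual removes f. A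
coderivation without component in V vanishes, because in characteristic zero all primitive elements
lie in V (`coderivation_eq_zero`); hence γγ = 0. -/

namespace SHLR

/-! ### Koszul signs as scalars of the ground ring -/

section KoszulSign

variable (R : Type*) [CommRing R]

/-- The sign `(-1) ^ n` as an element of `R`. -/
def ksgn (n : ℤ) : R := ((n.negOnePow : ℤ) : R)

theorem ksgn_add (m n : ℤ) : ksgn R (m + n) = ksgn R m * ksgn R n := by
  simp [ksgn, Int.negOnePow_add]

theorem ksgn_neg (n : ℤ) : ksgn R (-n) = ksgn R n := by
  simp [ksgn, Int.negOnePow_neg]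

theorem ksgn_sub (m n : ℤ) : ksgn R (m - n) = ksgn R m * ksgn R n := by
  rw [sub_eq_add_neg, ksgn_add, ksgn_neg]

@[simp] theorem ksgn_zero : ksgn R 0 = 1 := by simp [ksgn]

@[simp] theorem ksgn_one : ksgn R 1 = -1 := by simp [ksgn]

theorem ksgn_sq (n : ℤ) : ksgn R n * ksgn R n = 1 := by
  rw [← ksgn_add, ← two_mul, ksgn, Int.negOnePow_two_mul]; simp

variable {R} in
theorem ksgn_congr {m n : ℤ} (h : Even (m - n)) : ksgn R m = ksgn R n := by
  rw [ksgn, ksgn, (Int.negOnePow_eq_iff m n).2 h]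

/-- Signs are moved from the units of ℤ into `R`, so that linear maps commute with them and
`match_scalars` collects them; each sign identity then becomes a parity statement about exponents.
-/
theorem negOnePow_smul {M : Type*} [AddCommGroup M] [Module R M] (n : ℤ) (x : M) :
    n.negOnePow • x = ksgn R n • x := by
  rw [ksgn, Int.cast_smul_eq_zsmul, Units.smul_def]

end KoszulSign

section Sgn

variable {R : Type*} [CommRing R] {V : Type*} [AddCommGroup V] [Module R V]
  (𝒱 : ℤ → Submodule R V) [DirectSum.Decomposition 𝒱]

theorem sgn_of_mem (q : ℤ) {i : ℤ} {x : V} (hx : x ∈ 𝒱 i) : sgn 𝒱 q x = ksgn R (q * i) • x := by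
  rw [sgn_apply 𝒱 q hx, negOnePow_smul R]

theorem sgn_mem (q : ℤ) {i : ℤ} {x : V} (hx : x ∈ 𝒱 i) : sgn 𝒱 q x ∈ 𝒱 i := by
  rw [sgn_of_mem 𝒱 q hx]
  exact Submodule.smul_mem _ _ hx

/-- Two linear maps that agree on homogeneous elements are equal. -/
theorem homogeneous_ext {M : Type*} [AddCommMonoid M] [Module R M] {f g : V →ₗ[R] M}
    (h : ∀ i, ∀ x ∈ 𝒱 i, f x = g x) : f = g := by
  ext x
  induction x using DirectSum.Decomposition.inductionOn 𝒱 with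
  | zero => simp
  | homogeneous x => exact h _ x x.2
  | add x y hx hy => rw [map_add, map_add, hx, hy]

end Sgn

/-! ### The graded symmetric algebra: induction, graded commutativity, counit, projection to V -/

namespace GSym

section Basic

variable {R : Type*} [CommRing R] {V : Type*} [AddCommGroup V] [Module R V]
  (𝒱 : ℤ → Submodule R V)

theorem ι_mul_ι_ksgn {i j : ℤ} {x y : V} (hx : x ∈ 𝒱 i) (hy : y ∈ 𝒱 j) :
    ι 𝒱 x * ι 𝒱 y = ksgn R (i * j) • (ι 𝒱 y * ι 𝒱 x) := by
  rw [ι_mul_ι 𝒱 hx hy, negOnePow_smul R]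

@[simp] theorem listProd_nil : listProd 𝒱 [] = 1 := rfl

@[simp] theorem listProd_cons (a : Σ i, 𝒱 i) (l : List (Σ i, 𝒱 i)) :
    listProd 𝒱 (a :: l) = ι 𝒱 (a.2 : V) * listProd 𝒱 l := by simp [listProd]

theorem ι_mem {M : Type*} [AddCommMonoid M] (w : ℤ → M) {i : ℤ} {v : V} (hv : v ∈ 𝒱 i) :
    ι 𝒱 v ∈ piece 𝒱 w (w i) := ι_mem_piece 𝒱 w ⟨v, hv⟩

theorem ι_mul_mem {M : Type*} [AddCommMonoid M] (w : ℤ → M) {i : ℤ} {v : V} (hv : v ∈ 𝒱 i) {m : M}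
    {x : GSym 𝒱} (hx : x ∈ piece 𝒱 w m) : ι 𝒱 v * x ∈ piece 𝒱 w (w i + m) :=
  SetLike.mul_mem_graded (ι_mem 𝒱 w hv) hx

/-- Induction principle for the homogeneous components of `S[V]`. -/
theorem piece_induction {M : Type*} [AddCommMonoid M] (w : ℤ → M) {p : M → GSym 𝒱 → Prop}
    (zero : ∀ m, p m 0) (add : ∀ m x y, p m x → p m y → p m (x + y))
    (smul : ∀ m (r : R) x, p m x → p m (r • x)) (one : p 0 1)
    (ι_mul : ∀ i, ∀ v ∈ 𝒱 i, ∀ m, ∀ x ∈ piece 𝒱 w m, p m x → p (w i + m) (ι 𝒱 v * x))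
    {m : M} {x : GSym 𝒱} (hx : x ∈ piece 𝒱 w m) : p m x := by
  refine Submodule.span_induction ?_ (zero m) (fun x y _ _ => add m x y)
    (fun r x _ => smul m r x) hx
  clear hx
  rintro _ ⟨l, rfl, rfl⟩
  induction l with
  | nil => exact one
  | cons a l ih =>
    rw [listProd_cons, List.map_cons, List.sum_cons]
    exact ι_mul _ _ a.2.2 _ _ (listProd_mem 𝒱 w l) ih

theorem ι_mul_comm {i : ℤ} {v : V} (hv : v ∈ 𝒱 i) {n : ℤ} {y : GSym 𝒱} (hy : y ∈ deg 𝒱 n) :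
    ι 𝒱 v * y = ksgn R (i * n) • (y * ι 𝒱 v) := by
  refine piece_induction 𝒱 _ (p := fun n y => ι 𝒱 v * y = ksgn R (i * n) • (y * ι 𝒱 v))
    ?_ ?_ ?_ ?_ ?_ hy
  · simp
  · intro m x y hx hy; rw [mul_add, add_mul, hx, hy, smul_add]
  · intro m r x hx; rw [mul_smul_comm, hx, smul_mul_assoc, smul_comm]
  · simp
  · intro j u hu m x _ ih
    rw [← mul_assoc, ι_mul_ι_ksgn 𝒱 hv hu, smul_mul_assoc, mul_assoc, ih, mul_smul_comm, smul_smul,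
      mul_add, ksgn_add, mul_assoc]

theorem mul_comm_ksgn {m n : ℤ} {x y : GSym 𝒱} (hx : x ∈ deg 𝒱 m) (hy : y ∈ deg 𝒱 n) :
    x * y = ksgn R (m * n) • (y * x) := by
  refine piece_induction 𝒱 _ (p := fun m x => x * y = ksgn R (m * n) • (y * x))
    ?_ ?_ ?_ ?_ ?_ hx
  · simp
  · intro m x y hx hy; rw [mul_add, add_mul, hx, hy, smul_add]
  · intro m r x hx; rw [mul_smul_comm, smul_mul_assoc, hx, smul_comm]
  · simp
  · intro j u hu m x _ ih
    rw [mul_assoc, ih, mul_smul_comm, ← mul_assoc, ι_mul_comm 𝒱 hu hy, smul_mul_assoc, smul_smul,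
      mul_assoc, add_mul, ksgn_add, mul_comm]

@[simp] theorem counit_ι (v : V) : counit 𝒱 (ι 𝒱 v) = 0 := by
  rw [counit, lift_ι]; rfl

theorem counit_ι_mul (v : V) (x : GSym 𝒱) : counit 𝒱 (ι 𝒱 v * x) = 0 := by
  rw [map_mul, counit_ι, zero_mul]

theorem projV_one : projV 𝒱 1 = 0 := by
  -- `projV` is defined through this local right module structure; it has to be put back before the
  -- definition can be unfolded.
  let _ : Module Rᵐᵒᵖ V := Module.compHom _ ((RingHom.id R).fromOpposite mul_comm)
  have : IsCentralScalar R V := ⟨fun r m => rfl⟩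
  simp only [projV, LinearMap.comp_apply, AlgHom.toLinearMap_apply, map_one]
  simp

theorem projV_ι_mul (v : V) (x : GSym 𝒱) : projV 𝒱 (ι 𝒱 v * x) = counit 𝒱 x • v := by
  let _ : Module Rᵐᵒᵖ V := Module.compHom _ ((RingHom.id R).fromOpposite mul_comm)
  have : IsCentralScalar R V := ⟨fun r m => rfl⟩
  -- In the square-zero extension R ⊕ V one has (0, v)(r, w) = (0, r v), so only the first component
  -- of the image of `x` matters, and that is the counit.
  have h : ∀ x, (lift (𝒱 := 𝒱) (B := TrivSqZeroExt R V) (TrivSqZeroExt.inrHom R V) (by simp) x).fst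
      = counit 𝒱 x := by
    intro x
    have : (TrivSqZeroExt.fstHom R R V).comp (lift (𝒱 := 𝒱) (B := TrivSqZeroExt R V)
        (TrivSqZeroExt.inrHom R V) (by simp)) = counit 𝒱 := by
      apply algHom_ext
      intro x
      simp [counit]
    exact DFunLike.congr_fun this x
  simp only [projV, LinearMap.comp_apply, AlgHom.toLinearMap_apply, map_mul, lift_ι]
  simp [← h]

theorem projV_ι (v : V) : projV 𝒱 (ι 𝒱 v) = v := by
  have := projV_ι_mul 𝒱 v 1
  simpa using this

variable [DirectSum.Decomposition 𝒱]

/-- Two linear maps on `S[V]` that agree on the products of homogeneous elements of `V` are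
equal. -/
theorem listProd_ext {N : Type*} [AddCommMonoid N] [Module R N] {f g : GSym 𝒱 →ₗ[R] N}
    (h : ∀ l, f (listProd 𝒱 l) = g (listProd 𝒱 l)) : f = g := by
  refine homogeneous_ext (deg 𝒱) fun i x hx => ?_
  refine LinearMap.eqOn_span (f := f) (g := g) ?_ hx
  rintro _ ⟨l, -, rfl⟩
  exact h l

/-- Two linear maps on `S[V]` are equal if they agree at `1` and if they agree at `v x` whenever
they agree at `x`. -/
theorem ι_mul_ext {N : Type*} [AddCommMonoid N] [Module R N] {f g : GSym 𝒱 →ₗ[R] N}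
    (h1 : f 1 = g 1)
    (h : ∀ i, ∀ v ∈ 𝒱 i, ∀ x, f x = g x → f (ι 𝒱 v * x) = g (ι 𝒱 v * x)) : f = g := by
  refine listProd_ext 𝒱 fun l => ?_
  induction l with
  | nil => exact h1
  | cons a l ih => rw [listProd_cons]; exact h _ _ a.2.2 _ ih

theorem sgn_one (q : ℤ) : sgn (deg 𝒱) q (1 : GSym 𝒱) = 1 := by
  rw [sgn_of_mem (deg 𝒱) q (SetLike.GradedOne.one_mem : (1 : GSym 𝒱) ∈ deg 𝒱 0)]; simp

theorem sgn_ι_mul (q : ℤ) {i : ℤ} {v : V} (hv : v ∈ 𝒱 i) (x : GSym 𝒱) :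
    sgn (deg 𝒱) q (ι 𝒱 v * x) = ksgn R (q * i) • (ι 𝒱 v * sgn (deg 𝒱) q x) := by
  have : sgn (deg 𝒱) q ∘ₗ LinearMap.mulLeft R (ι 𝒱 v) =
      ksgn R (q * i) • (LinearMap.mulLeft R (ι 𝒱 v) ∘ₗ sgn (deg 𝒱) q) := by
    refine homogeneous_ext (deg 𝒱) fun n x hx => ?_
    simp only [LinearMap.comp_apply, LinearMap.mulLeft_apply, LinearMap.smul_apply,
      sgn_of_mem (deg 𝒱) q hx, sgn_of_mem (deg 𝒱) q (ι_mul_mem 𝒱 (fun i => i) hv hx),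
      mul_smul_comm, smul_smul, mul_add, ksgn_add]
  exact LinearMap.congr_fun this x

theorem sgn_mem_piece {M : Type*} [AddCommMonoid M] (w : ℤ → M) (q : ℤ) {m : M} {x : GSym 𝒱}
    (hx : x ∈ piece 𝒱 w m) : sgn (deg 𝒱) q x ∈ piece 𝒱 w m := by
  refine piece_induction 𝒱 w (p := fun m x => sgn (deg 𝒱) q x ∈ piece 𝒱 w m)
    ?_ ?_ ?_ ?_ ?_ hx
  · simp
  · intro m x y hx hy; rw [map_add]; exact add_mem hx hy
  · intro m r x hx; rw [map_smul]; exact Submodule.smul_mem _ _ hx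
  · rw [sgn_one]; exact SetLike.GradedOne.one_mem
  · intro j u hu m x _ ih
    rw [sgn_ι_mul 𝒱 q hu]
    exact Submodule.smul_mem _ _ (ι_mul_mem 𝒱 w hu ih)

end Basic

end GSym

set_option linter.unusedSectionVars false

noncomputable section

open TensorProduct

theorem tensor_homogeneous_ext {R : Type*} [CommRing R] {V W : Type*} [AddCommGroup V] [Module R V]
    [AddCommGroup W] [Module R W] (𝒱 : ℤ → Submodule R V) [DirectSum.Decomposition 𝒱]
    (𝒲 : ℤ → Submodule R W) [DirectSum.Decomposition 𝒲] {M : Type*} [AddCommMonoid M] [Module R M]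
    {f g : V ⊗[R] W →ₗ[R] M}
    (h : ∀ i, ∀ x ∈ 𝒱 i, ∀ j, ∀ y ∈ 𝒲 j, f (x ⊗ₜ y) = g (x ⊗ₜ y)) : f = g := by
  apply TensorProduct.ext
  refine homogeneous_ext 𝒱 fun i x hx => homogeneous_ext 𝒲 fun j y hy => ?_
  exact h i x hx j y hy

/-! ### The shuffle diagonal: coassociative, counital and graded cocommutative -/

namespace GSym

variable {R : Type*} [CommRing R] {V : Type*} [AddCommGroup V] [Module R V]
  (𝒱 : ℤ → Submodule R V)

/-- The homogeneous components of `S[V] ⊗ S[V]` for the grading determined by the weights `w`. -/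
def tensorPiece {M : Type*} [AddCommMonoid M] (w : ℤ → M) (m : M) :
    Submodule R (GSym 𝒱 ⊗[R] GSym 𝒱) :=
  Submodule.span R {z | ∃ k l, k + l = m ∧ ∃ x ∈ piece 𝒱 w k, ∃ y ∈ piece 𝒱 w l, x ⊗ₜ y = z}

theorem tmul_mem_tensorPiece {M : Type*} [AddCommMonoid M] (w : ℤ → M) {k l : M} {x y : GSym 𝒱}
    (hx : x ∈ piece 𝒱 w k) (hy : y ∈ piece 𝒱 w l) : x ⊗ₜ[R] y ∈ tensorPiece 𝒱 w (k + l) :=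
  Submodule.subset_span ⟨k, l, rfl, x, hx, y, hy, rfl⟩

variable [DirectSum.Decomposition 𝒱]

/-- The operator on `S[V] ⊗ S[V]` which corresponds, under the diagonal, to the multiplication
by `v ∈ V` of degree `i`. -/
def comulMulLeft (i : ℤ) (v : V) : GSym 𝒱 ⊗[R] GSym 𝒱 →ₗ[R] GSym 𝒱 ⊗[R] GSym 𝒱 :=
  TensorProduct.map (LinearMap.mulLeft R (ι 𝒱 v)) LinearMap.id +
    TensorProduct.map (sgn (deg 𝒱) i) (LinearMap.mulLeft R (ι 𝒱 v))

theorem comulMulLeft_tmul (i : ℤ) (v : V) (x y : GSym 𝒱) :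
    comulMulLeft 𝒱 i v (x ⊗ₜ y) = (ι 𝒱 v * x) ⊗ₜ y + sgn (deg 𝒱) i x ⊗ₜ (ι 𝒱 v * y) := rfl

theorem comul_one : comul 𝒱 1 = 1 ⊗ₜ 1 := by
  simp only [comul, LinearMap.comp_apply, AlgHom.toLinearMap_apply, map_one]
  rfl

/-- Δ is multiplicative, so Δ(v x) = (v ⊗ 1 + 1 ⊗ v) Δ x; on the plain tensor product the second
summand acquires the Koszul sign of moving `v` past the first factor. This recursion in the leading
factor is the basis of the inductive identities for Δ below. -/
theorem comul_ι_mul {i : ℤ} {v : V} (hv : v ∈ 𝒱 i) (x : GSym 𝒱) :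
    comul 𝒱 (ι 𝒱 v * x) = comulMulLeft 𝒱 i v (comul 𝒱 x) := by
  have key : ∀ z : GSym 𝒱 ⊗[R] GSym 𝒱, (GradedTensorProduct.of R (deg 𝒱) (deg 𝒱)).symm
      ((ι 𝒱 v ᵍ⊗ₜ[R] 1 + 1 ᵍ⊗ₜ[R] ι 𝒱 v : deg 𝒱 ᵍ⊗[R] deg 𝒱) *
        GradedTensorProduct.of R (deg 𝒱) (deg 𝒱) z) = comulMulLeft 𝒱 i v z := by
    intro z
    have : (GradedTensorProduct.of R (deg 𝒱) (deg 𝒱)).symm.toLinearMap ∘ₗ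
        GradedTensorProduct.mulHom (R := R) (deg 𝒱) (deg 𝒱)
          (ι 𝒱 v ᵍ⊗ₜ[R] 1 + 1 ᵍ⊗ₜ[R] ι 𝒱 v : deg 𝒱 ᵍ⊗[R] deg 𝒱) ∘ₗ
        (GradedTensorProduct.of R (deg 𝒱) (deg 𝒱)).toLinearMap = comulMulLeft 𝒱 i v := by
      refine tensor_homogeneous_ext (deg 𝒱) (deg 𝒱) fun m x hx n y hy => ?_
      have h1 := GradedTensorProduct.tmul_one_mul_coe_tmul (R := R) (𝒜 := deg 𝒱) (ℬ := deg 𝒱)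
        (ι 𝒱 v) ⟨x, hx⟩ y
      have h2 := GradedTensorProduct.tmul_coe_mul_coe_tmul (R := R) (𝒜 := deg 𝒱) (ℬ := deg 𝒱)
        1 ⟨ι 𝒱 v, ι_mem 𝒱 (fun i => i) hv⟩ ⟨x, hx⟩ y
      simp only [LinearMap.comp_apply, LinearEquiv.coe_coe, comulMulLeft_tmul]
      rw [← GradedTensorProduct.mul_def, add_mul]
      refine (congrArg _ (congrArg₂ _ h1 h2)).trans ?_
      rw [map_add, ← Int.negOnePow_def, negOnePow_smul R, map_smul, one_mul,
        sgn_of_mem (deg 𝒱) i hx,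
        ← TensorProduct.smul_tmul']
      rfl
    exact LinearMap.congr_fun this z
  rw [← key]
  simp only [comul, LinearMap.comp_apply, AlgHom.toLinearMap_apply, LinearEquiv.coe_coe,
    LinearEquiv.apply_symm_apply]
  rw [map_mul, comulAlgHom_ι]

theorem swap_tmul {m n : ℤ} {x y : GSym 𝒱} (hx : x ∈ deg 𝒱 m) (hy : y ∈ deg 𝒱 n) :
    swap 𝒱 (x ⊗ₜ y) = ksgn R (m * n) • (y ⊗ₜ x) := by
  have := GradedTensorProduct.comm_coe_tmul_coe (R := R) (𝒜 := deg 𝒱) (ℬ := deg 𝒱)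
    ⟨x, hx⟩ ⟨y, hy⟩
  refine (congrArg (GradedTensorProduct.of R (deg 𝒱) (deg 𝒱)).symm this).trans ?_
  rw [← Int.negOnePow_def, negOnePow_smul R, map_smul, mul_comm n m]
  rfl

/-- The interchange commutes with the action of v ⊗ 1 + 1 ⊗ v, whose two summands it exchanges. -/
theorem swap_comp_comul : swap 𝒱 ∘ₗ comul 𝒱 = comul 𝒱 := by
  have hmem1 : (1 : GSym 𝒱) ∈ deg 𝒱 0 := SetLike.GradedOne.one_mem
  refine ι_mul_ext 𝒱 ?_ fun i v hv x hx => ?_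
  · simp only [LinearMap.comp_apply, comul_one]
    rw [swap_tmul 𝒱 hmem1 hmem1]
    simp
  · have : swap 𝒱 ∘ₗ comulMulLeft 𝒱 i v = comulMulLeft 𝒱 i v ∘ₗ swap 𝒱 := by
      refine tensor_homogeneous_ext (deg 𝒱) (deg 𝒱) fun m x hx n y hy => ?_
      have hvx := ι_mul_mem 𝒱 (fun i => i) hv hx
      have hvy := ι_mul_mem 𝒱 (fun i => i) hv hy
      simp only [LinearMap.comp_apply, comulMulLeft_tmul, map_add, swap_tmul 𝒱 hx hy,
        swap_tmul 𝒱 hvx hy, map_smul, sgn_of_mem (deg 𝒱) i hx, sgn_of_mem (deg 𝒱) i hy,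
        ← TensorProduct.smul_tmul', swap_tmul 𝒱 hx hvy, smul_add, smul_smul]
      rw [add_comm]
      congr 2
      · rw [← ksgn_add]
        apply ksgn_congr
        simp only [Int.even_add, Int.even_sub, Int.even_mul]
        tauto
      · rw [← ksgn_add]
        apply ksgn_congr
        simp only [Int.even_add, Int.even_sub, Int.even_mul]
        tauto
    simp only [LinearMap.comp_apply] at hx ⊢
    rw [comul_ι_mul 𝒱 hv, ← LinearMap.comp_apply, this, LinearMap.comp_apply, hx]

theorem comul_sgn (q : ℤ) :
    comul 𝒱 ∘ₗ sgn (deg 𝒱) q = TensorProduct.map (sgn (deg 𝒱) q) (sgn (deg 𝒱) q) ∘ₗ comul 𝒱 := by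
  refine ι_mul_ext 𝒱 ?_ fun i v hv x hx => ?_
  · simp [sgn_one, comul_one]
  · have : TensorProduct.map (sgn (deg 𝒱) q) (sgn (deg 𝒱) q) ∘ₗ comulMulLeft 𝒱 i v =
        ksgn R (q * i) • (comulMulLeft 𝒱 i v ∘ₗ
          TensorProduct.map (sgn (deg 𝒱) q) (sgn (deg 𝒱) q)) := by
      refine tensor_homogeneous_ext (deg 𝒱) (deg 𝒱) fun m x hx n y hy => ?_
      simp only [LinearMap.comp_apply, comulMulLeft_tmul, map_add, TensorProduct.map_tmul,
        sgn_ι_mul 𝒱 q hv, LinearMap.smul_apply, sgn_of_mem (deg 𝒱) _ hx, map_smul,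
        TensorProduct.tmul_smul, ← TensorProduct.smul_tmul', smul_smul, smul_add, mul_smul_comm]
      match_scalars <;> ring
    simp only [LinearMap.comp_apply] at hx ⊢
    rw [sgn_ι_mul 𝒱 q hv, map_smul, comul_ι_mul 𝒱 hv, comul_ι_mul 𝒱 hv,
      ← LinearMap.comp_apply (TensorProduct.map _ _), this, LinearMap.smul_apply,
      LinearMap.comp_apply, hx]

theorem coassoc : (TensorProduct.assoc R _ _ _).toLinearMap ∘ₗ (comul 𝒱).rTensor (GSym 𝒱) ∘ₗ
    comul 𝒱 = (comul 𝒱).lTensor (GSym 𝒱) ∘ₗ comul 𝒱 := by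
  refine ι_mul_ext 𝒱 ?_ fun i v hv x hx => ?_
  · simp [comul_one]
  -- `M` is the action of v ⊗ 1 ⊗ 1 + 1 ⊗ v ⊗ 1 + 1 ⊗ 1 ⊗ v; both iterated diagonals turn
  -- multiplication by `v` into `M`.
  · let M : GSym 𝒱 ⊗[R] (GSym 𝒱 ⊗[R] GSym 𝒱) →ₗ[R] GSym 𝒱 ⊗[R] (GSym 𝒱 ⊗[R] GSym 𝒱) :=
      TensorProduct.map (LinearMap.mulLeft R (ι 𝒱 v)) LinearMap.id +
        TensorProduct.map (sgn (deg 𝒱) i) (comulMulLeft 𝒱 i v)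
    have h1 : (TensorProduct.assoc R _ _ _).toLinearMap ∘ₗ (comul 𝒱).rTensor (GSym 𝒱) ∘ₗ
        comulMulLeft 𝒱 i v = M ∘ₗ (TensorProduct.assoc R _ _ _).toLinearMap ∘ₗ
          (comul 𝒱).rTensor (GSym 𝒱) := by
      ext x y
      simp only [TensorProduct.AlgebraTensorModule.curry_apply, LinearMap.restrictScalars_self,
        TensorProduct.curry_apply, LinearMap.comp_apply, comulMulLeft_tmul, map_add,
        LinearMap.rTensor_tmul, comul_ι_mul 𝒱 hv]
      have hs := LinearMap.congr_fun (comul_sgn 𝒱 i) x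
      simp only [LinearMap.comp_apply] at hs
      rw [hs]
      generalize comul 𝒱 x = u
      induction u with
      | zero => simp
      | add u u' hu hu' =>
        simp only [map_add, TensorProduct.add_tmul] at hu hu' ⊢
        rw [← hu, ← hu']
        abel
      | tmul a b =>
        simp [M, comulMulLeft_tmul, TensorProduct.add_tmul, TensorProduct.tmul_add, add_assoc]
    have h2 : (comul 𝒱).lTensor (GSym 𝒱) ∘ₗ comulMulLeft 𝒱 i v =
        M ∘ₗ (comul 𝒱).lTensor (GSym 𝒱) := by
      ext x y
      simp [comulMulLeft_tmul, comul_ι_mul 𝒱 hv, M]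
    have h1' := LinearMap.congr_fun h1 (comul 𝒱 x)
    have h2' := LinearMap.congr_fun h2 (comul 𝒱 x)
    simp only [LinearMap.comp_apply] at hx h1' h2' ⊢
    rw [comul_ι_mul 𝒱 hv, h1', h2', hx]

theorem counit_sgn (q : ℤ) (x : GSym 𝒱) : counit 𝒱 (sgn (deg 𝒱) q x) = counit 𝒱 x := by
  have : (counit 𝒱).toLinearMap ∘ₗ sgn (deg 𝒱) q = (counit 𝒱).toLinearMap := by
    refine ι_mul_ext 𝒱 (by simp [sgn_one]) fun i v hv x hx => ?_
    simp [sgn_ι_mul 𝒱 q hv]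
  exact LinearMap.congr_fun this x

theorem counit_rTensor_comul (x : GSym 𝒱) :
    TensorProduct.lid R _ ((counit 𝒱).toLinearMap.rTensor (GSym 𝒱) (comul 𝒱 x)) = x := by
  have : (TensorProduct.lid R _).toLinearMap ∘ₗ (counit 𝒱).toLinearMap.rTensor (GSym 𝒱) ∘ₗ
      comul 𝒱 = LinearMap.id := by
    refine ι_mul_ext 𝒱 (by simp [comul_one]) fun i v hv x hx => ?_
    have h : (TensorProduct.lid R _).toLinearMap ∘ₗ (counit 𝒱).toLinearMap.rTensor (GSym 𝒱) ∘ₗ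
        comulMulLeft 𝒱 i v = LinearMap.mulLeft R (ι 𝒱 v) ∘ₗ
          (TensorProduct.lid R _).toLinearMap ∘ₗ (counit 𝒱).toLinearMap.rTensor (GSym 𝒱) := by
      ext x y
      simp [comulMulLeft_tmul, counit_sgn]
    have h' := LinearMap.congr_fun h (comul 𝒱 x)
    simp only [LinearMap.comp_apply] at h' hx ⊢
    rw [comul_ι_mul 𝒱 hv, h', hx]
    rfl
  exact LinearMap.congr_fun this x

theorem counit_lTensor_comul (x : GSym 𝒱) :
    TensorProduct.rid R _ ((counit 𝒱).toLinearMap.lTensor (GSym 𝒱) (comul 𝒱 x)) = x := by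
  have : (TensorProduct.rid R _).toLinearMap ∘ₗ (counit 𝒱).toLinearMap.lTensor (GSym 𝒱) ∘ₗ
      comul 𝒱 = LinearMap.id := by
    refine ι_mul_ext 𝒱 (by simp [comul_one]) fun i v hv x hx => ?_
    have h : (TensorProduct.rid R _).toLinearMap ∘ₗ (counit 𝒱).toLinearMap.lTensor (GSym 𝒱) ∘ₗ
        comulMulLeft 𝒱 i v = LinearMap.mulLeft R (ι 𝒱 v) ∘ₗ
          (TensorProduct.rid R _).toLinearMap ∘ₗ (counit 𝒱).toLinearMap.lTensor (GSym 𝒱) := by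
      ext x y
      simp [comulMulLeft_tmul]
    have h' := LinearMap.congr_fun h (comul 𝒱 x)
    simp only [LinearMap.comp_apply] at h' hx ⊢
    rw [comul_ι_mul 𝒱 hv, h', hx]
    rfl
  exact LinearMap.congr_fun this x

/-- The weight is arbitrary so that a single induction covers the total degree and the symmetric
power. -/
theorem comul_mem {M : Type*} [AddCommMonoid M] (w : ℤ → M) {m : M} {x : GSym 𝒱}
    (hx : x ∈ piece 𝒱 w m) : comul 𝒱 x ∈ tensorPiece 𝒱 w m := by
  refine piece_induction 𝒱 w (p := fun m x => comul 𝒱 x ∈ tensorPiece 𝒱 w m) ?_ ?_ ?_ ?_ ?_ hx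
  · simp
  · intro m x y hx hy; rw [map_add]; exact add_mem hx hy
  · intro m r x hx; rw [map_smul]; exact Submodule.smul_mem _ _ hx
  · rw [comul_one]
    have h1 : (1 : GSym 𝒱) ∈ piece 𝒱 w 0 := SetLike.GradedOne.one_mem
    simpa using tmul_mem_tensorPiece 𝒱 w h1 h1
  · intro i v hv m x _ ih
    rw [comul_ι_mul 𝒱 hv]
    refine Submodule.span_induction (p := fun z _ => comulMulLeft 𝒱 i v z ∈
      tensorPiece 𝒱 w (w i + m)) ?_ ?_ ?_ ?_ ih
    · rintro _ ⟨k, l, rfl, x, hx, y, hy, rfl⟩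
      rw [comulMulLeft_tmul]
      refine add_mem ?_ ?_
      · rw [← add_assoc]
        exact tmul_mem_tensorPiece 𝒱 w (ι_mul_mem 𝒱 w hv hx) hy
      · rw [add_left_comm]
        exact tmul_mem_tensorPiece 𝒱 w (sgn_mem_piece 𝒱 w i hx) (ι_mul_mem 𝒱 w hv hy)
    · simp
    · intro x y _ _ hx hy; rw [map_add]; exact add_mem hx hy
    · intro r x _ hx; rw [map_smul]; exact Submodule.smul_mem _ _ hx

end GSym

/-! ### Symmetric powers, the coaugmentation filtration and the constituents of a coderivation -/

namespace GSym

variable {R : Type*} [CommRing R] {V : Type*} [AddCommGroup V] [Module R V]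
  (𝒱 : ℤ → Submodule R V) [DirectSum.Decomposition 𝒱]

theorem projWt_apply (n : ℕ) (x : GSym 𝒱) :
    projWt 𝒱 n x = (DirectSum.decompose (wt 𝒱) x n : GSym 𝒱) := rfl

theorem projWt_mem (n : ℕ) (x : GSym 𝒱) : projWt 𝒱 n x ∈ wt 𝒱 n := by
  rw [projWt_apply]; exact SetLike.coe_mem _

theorem projWt_of_mem {n : ℕ} {x : GSym 𝒱} (hx : x ∈ wt 𝒱 n) : projWt 𝒱 n x = x := by
  rw [projWt_apply, DirectSum.decompose_of_mem_same _ hx]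

theorem projWt_of_mem_ne {m n : ℕ} {x : GSym 𝒱} (hx : x ∈ wt 𝒱 m) (h : m ≠ n) :
    projWt 𝒱 n x = 0 := by
  rw [projWt_apply, DirectSum.decompose_of_mem_ne _ hx h]

/-- Two linear maps on `S[V]` that agree on the symmetric powers are equal. -/
theorem wt_ext {N : Type*} [AddCommMonoid N] [Module R N] {f g : GSym 𝒱 →ₗ[R] N}
    (h : ∀ n, ∀ x ∈ wt 𝒱 n, f x = g x) : f = g :=
  listProd_ext 𝒱 fun l => h _ _ (listProd_mem 𝒱 (fun _ => 1) l)

theorem one_mem_wt : (1 : GSym 𝒱) ∈ wt 𝒱 0 := SetLike.GradedOne.one_mem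

theorem ι_mul_mem_wt {i : ℤ} {v : V} (hv : v ∈ 𝒱 i) {m : ℕ} {x : GSym 𝒱} (hx : x ∈ wt 𝒱 m) :
    ι 𝒱 v * x ∈ wt 𝒱 (m + 1) := by
  rw [add_comm]; exact ι_mul_mem 𝒱 (fun _ => 1) hv hx

theorem ι_mul_mem_wt' (v : V) {m : ℕ} {x : GSym 𝒱} (hx : x ∈ wt 𝒱 m) :
    ι 𝒱 v * x ∈ wt 𝒱 (m + 1) := by
  induction v using DirectSum.Decomposition.inductionOn 𝒱 with
  | zero => simp
  | homogeneous v => exact ι_mul_mem_wt 𝒱 v.2 hx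
  | add v w hv hw => rw [map_add, add_mul]; exact add_mem hv hw

theorem projWt_succ_ι_mul (n : ℕ) (v : V) (x : GSym 𝒱) :
    projWt 𝒱 (n + 1) (ι 𝒱 v * x) = ι 𝒱 v * projWt 𝒱 n x := by
  have : projWt 𝒱 (n + 1) ∘ₗ LinearMap.mulLeft R (ι 𝒱 v) =
      LinearMap.mulLeft R (ι 𝒱 v) ∘ₗ projWt 𝒱 n := by
    refine wt_ext 𝒱 fun m x hx => ?_
    simp only [LinearMap.comp_apply, LinearMap.mulLeft_apply]
    by_cases h : m = n
    · subst h
      rw [projWt_of_mem 𝒱 hx, projWt_of_mem 𝒱 (ι_mul_mem_wt' 𝒱 v hx)]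
    · rw [projWt_of_mem_ne 𝒱 hx h, projWt_of_mem_ne 𝒱 (ι_mul_mem_wt' 𝒱 v hx) (by omega), mul_zero]
  exact LinearMap.congr_fun this x

theorem projWt_zero_ι_mul (v : V) (x : GSym 𝒱) : projWt 𝒱 0 (ι 𝒱 v * x) = 0 := by
  have : projWt 𝒱 0 ∘ₗ LinearMap.mulLeft R (ι 𝒱 v) = 0 := by
    refine wt_ext 𝒱 fun m x hx => ?_
    simp only [LinearMap.comp_apply, LinearMap.mulLeft_apply]
    rw [projWt_of_mem_ne 𝒱 (ι_mul_mem_wt' 𝒱 v hx) (by omega), LinearMap.zero_apply]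
  exact LinearMap.congr_fun this x

theorem projWt_mem_deg (n : ℕ) {m : ℤ} {x : GSym 𝒱} (hx : x ∈ deg 𝒱 m) :
    projWt 𝒱 n x ∈ deg 𝒱 m := by
  refine Submodule.span_induction ?_ ?_ ?_ ?_ hx
  · rintro _ ⟨l, rfl, rfl⟩
    have h := listProd_mem 𝒱 (fun _ => 1) l
    by_cases hn : (l.map fun _ => 1).sum = n
    · rw [hn] at h
      rw [projWt_of_mem 𝒱 h]
      exact listProd_mem 𝒱 (fun i => i) l
    · rw [projWt_of_mem_ne 𝒱 h hn]; exact zero_mem _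
  · simp
  · intro x y _ _ hx hy; rw [map_add]; exact add_mem hx hy
  · intro r x _ hx; rw [map_smul]; exact Submodule.smul_mem _ _ hx

theorem projWt_zero (x : GSym 𝒱) : projWt 𝒱 0 x = algebraMap R _ (counit 𝒱 x) := by
  have : projWt 𝒱 0 = Algebra.linearMap R _ ∘ₗ (counit 𝒱).toLinearMap := by
    refine ι_mul_ext 𝒱 ?_ fun i v hv x _ => ?_
    · simp [projWt_of_mem 𝒱 (one_mem_wt 𝒱)]
    · simp [projWt_zero_ι_mul]
  exact LinearMap.congr_fun this x

theorem projWt_one (x : GSym 𝒱) : projWt 𝒱 1 x = ι 𝒱 (projV 𝒱 x) := by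
  have : projWt 𝒱 1 = ι 𝒱 ∘ₗ projV 𝒱 := by
    refine ι_mul_ext 𝒱 ?_ fun i v hv x _ => ?_
    · simp [projWt_of_mem_ne 𝒱 (one_mem_wt 𝒱), projV_one]
    · rw [projWt_succ_ι_mul, projWt_zero, LinearMap.comp_apply, projV_ι_mul, map_smul,
        Algebra.smul_def, Algebra.commutes]
  exact LinearMap.congr_fun this x

theorem counit_of_mem_wt {n : ℕ} {x : GSym 𝒱} (hx : x ∈ wt 𝒱 n) (hn : n ≠ 0) :
    counit 𝒱 x = 0 := by
  have h := projWt_of_mem_ne 𝒱 hx hn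
  rw [projWt_zero] at h
  have := congrArg (counit 𝒱) h
  simpa using this

theorem projV_projWt_one (x : GSym 𝒱) : projV 𝒱 (projWt 𝒱 1 x) = projV 𝒱 x := by
  rw [projWt_one, projV_ι]

theorem projV_of_mem_wt {n : ℕ} {x : GSym 𝒱} (hx : x ∈ wt 𝒱 n) (hn : n ≠ 1) :
    projV 𝒱 x = 0 := by
  rw [← projV_projWt_one, projWt_of_mem_ne 𝒱 hx hn, map_zero]

theorem mem_coaugFiltration {n : ℕ} {x : GSym 𝒱} :
    x ∈ coaugFiltration 𝒱 n ↔ ∀ m, n < m → projWt 𝒱 m x = 0 := by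
  classical
  constructor
  · intro hx m hm
    have : coaugFiltration 𝒱 n ≤ LinearMap.ker (projWt 𝒱 m) := by
      refine iSup₂_le fun k hk y hy => ?_
      exact projWt_of_mem_ne 𝒱 hy (by omega)
    exact this hx
  · intro h
    rw [← DirectSum.sum_support_decompose (wt 𝒱) x]
    refine sum_mem fun m hm => ?_
    have hm' : ¬ n < m := by
      intro hlt
      have := h m hlt
      rw [projWt_apply] at this
      exact (DFinsupp.mem_support_iff.1 hm) (Subtype.ext this)
    exact (le_iSup₂ (f := fun m (_ : m ≤ n) => wt 𝒱 m) m (not_lt.1 hm')) (SetLike.coe_mem _)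

theorem wt_le_coaugFiltration {m n : ℕ} (h : m ≤ n) : wt 𝒱 m ≤ coaugFiltration 𝒱 n :=
  le_iSup₂ (f := fun m (_ : m ≤ n) => wt 𝒱 m) m h

theorem exists_mem_coaugFiltration (x : GSym 𝒱) : ∃ n, x ∈ coaugFiltration 𝒱 n := by
  classical
  refine ⟨(DirectSum.decompose (wt 𝒱) x).support.sup id, (mem_coaugFiltration 𝒱).2 fun m hm => ?_⟩
  by_contra h
  rw [projWt_apply] at h
  have : m ∈ (DirectSum.decompose (wt 𝒱) x).support := by
    rw [DFinsupp.mem_support_iff]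
    exact fun h' => h (by rw [h']; rfl)
  exact absurd (Finset.le_sup (f := id) this) (by simpa using hm)

theorem sum_projWt {n N : ℕ} {x : GSym 𝒱} (hx : x ∈ coaugFiltration 𝒱 n) (hN : n < N) :
    ∑ m ∈ Finset.range N, projWt 𝒱 m x = x := by
  have : coaugFiltration 𝒱 n ≤ LinearMap.eqLocus (∑ m ∈ Finset.range N, projWt 𝒱 m)
      LinearMap.id := by
    refine iSup₂_le fun k hk y hy => ?_
    rw [LinearMap.mem_eqLocus, LinearMap.sum_apply, Finset.sum_eq_single k]
    · rw [projWt_of_mem 𝒱 hy, LinearMap.id_apply]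
    · exact fun b _ hb => projWt_of_mem_ne 𝒱 hy hb.symm
    · exact fun h => absurd (Finset.mem_range.2 (by omega)) h
  simpa using this hx

theorem coaugFiltration_mono {m n : ℕ} (h : m ≤ n) :
    coaugFiltration 𝒱 m ≤ coaugFiltration 𝒱 n :=
  fun _ hx => (mem_coaugFiltration 𝒱).2 fun k hk => (mem_coaugFiltration 𝒱).1 hx k (by omega)

/-- The projection of `S[V] ⊗ S[V]` onto the component of weight `n`. -/
def tensorProjWt (n : ℕ) : GSym 𝒱 ⊗[R] GSym 𝒱 →ₗ[R] GSym 𝒱 ⊗[R] GSym 𝒱 :=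
  ∑ p ∈ Finset.HasAntidiagonal.antidiagonal n, TensorProduct.map (projWt 𝒱 p.1) (projWt 𝒱 p.2)

theorem tensorProjWt_tmul_right (n : ℕ) {l : ℕ} (x : GSym 𝒱) {y : GSym 𝒱} (hy : y ∈ wt 𝒱 l) :
    tensorProjWt 𝒱 n (x ⊗ₜ y) = if l ≤ n then projWt 𝒱 (n - l) x ⊗ₜ y else 0 := by
  rw [tensorProjWt, LinearMap.sum_apply]
  split_ifs with h
  · rw [Finset.sum_eq_single (n - l, l)]
    · rw [TensorProduct.map_tmul, projWt_of_mem 𝒱 hy]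
    · rintro ⟨a, b⟩ hab hne
      have hab' : a + b = n := Finset.HasAntidiagonal.mem_antidiagonal.1 hab
      have : l ≠ b := by
        rintro rfl
        exact hne (by rw [← hab', Nat.add_sub_cancel])
      rw [TensorProduct.map_tmul, projWt_of_mem_ne 𝒱 hy this, tmul_zero]
    · intro hn
      exact absurd (Finset.HasAntidiagonal.mem_antidiagonal.2 (Nat.sub_add_cancel h)) hn
  · refine Finset.sum_eq_zero ?_
    rintro ⟨a, b⟩ hab
    have hab' : a + b = n := Finset.HasAntidiagonal.mem_antidiagonal.1 hab
    rw [TensorProduct.map_tmul, projWt_of_mem_ne 𝒱 hy (by omega), tmul_zero]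

theorem tensorProjWt_tmul_left (n : ℕ) {k : ℕ} {x : GSym 𝒱} (y : GSym 𝒱) (hx : x ∈ wt 𝒱 k) :
    tensorProjWt 𝒱 n (x ⊗ₜ y) = if k ≤ n then x ⊗ₜ projWt 𝒱 (n - k) y else 0 := by
  rw [tensorProjWt, LinearMap.sum_apply]
  split_ifs with h
  · rw [Finset.sum_eq_single (k, n - k)]
    · rw [TensorProduct.map_tmul, projWt_of_mem 𝒱 hx]
    · rintro ⟨a, b⟩ hab hne
      have hab' : a + b = n := Finset.HasAntidiagonal.mem_antidiagonal.1 hab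
      have : k ≠ a := by
        rintro rfl
        exact hne (by rw [← hab', Nat.add_sub_cancel_left])
      rw [TensorProduct.map_tmul, projWt_of_mem_ne 𝒱 hx this, zero_tmul]
    · intro hn
      exact absurd (Finset.HasAntidiagonal.mem_antidiagonal.2 (Nat.add_sub_cancel' h)) hn
  · refine Finset.sum_eq_zero ?_
    rintro ⟨a, b⟩ hab
    have hab' : a + b = n := Finset.HasAntidiagonal.mem_antidiagonal.1 hab
    rw [TensorProduct.map_tmul, projWt_of_mem_ne 𝒱 hx (by omega), zero_tmul]

theorem tensorProjWt_of_mem {m n : ℕ} {z : GSym 𝒱 ⊗[R] GSym 𝒱}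
    (hz : z ∈ tensorPiece 𝒱 (fun _ => (1 : ℕ)) m) :
    tensorProjWt 𝒱 n z = if m = n then z else 0 := by
  refine Submodule.span_induction
    (p := fun z _ => tensorProjWt 𝒱 n z = if m = n then z else 0) ?_ ?_ ?_ ?_ hz
  · rintro _ ⟨k, l, rfl, x, hx, y, hy, rfl⟩
    rw [tensorProjWt_tmul_right 𝒱 n x hy]
    by_cases h : k + l = n
    · rw [if_pos (by omega), if_pos h, projWt_of_mem 𝒱 (by rwa [← h, Nat.add_sub_cancel])]
    · rw [if_neg h]
      split_ifs with hl
      · rw [projWt_of_mem_ne 𝒱 hx (by omega), zero_tmul]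
      · rfl
  · simp
  · intro x y _ _ hx hy
    rw [map_add, hx, hy]
    split_ifs <;> simp
  · intro r x _ hx
    rw [map_smul, hx]
    split_ifs <;> simp

theorem comul_projWt (n : ℕ) (x : GSym 𝒱) :
    comul 𝒱 (projWt 𝒱 n x) = tensorProjWt 𝒱 n (comul 𝒱 x) := by
  have : comul 𝒱 ∘ₗ projWt 𝒱 n = tensorProjWt 𝒱 n ∘ₗ comul 𝒱 := by
    refine wt_ext 𝒱 fun m x hx => ?_
    simp only [LinearMap.comp_apply]
    rw [tensorProjWt_of_mem 𝒱 (comul_mem 𝒱 _ hx)]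
    split_ifs with h
    · subst h; rw [projWt_of_mem 𝒱 hx]
    · rw [projWt_of_mem_ne 𝒱 hx h, map_zero]
  exact LinearMap.congr_fun this x

/-- Two linear maps that agree on `piece ⊗ piece` agree on `tensorPiece`. -/
theorem eq_on_tensorPiece {M : Type*} [AddCommMonoid M] (w : ℤ → M) {m : M}
    {N : Type*} [AddCommMonoid N] [Module R N] {f g : GSym 𝒱 ⊗[R] GSym 𝒱 →ₗ[R] N}
    (h : ∀ k l, k + l = m → ∀ x ∈ piece 𝒱 w k, ∀ y ∈ piece 𝒱 w l, f (x ⊗ₜ y) = g (x ⊗ₜ y))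
    {z : GSym 𝒱 ⊗[R] GSym 𝒱} (hz : z ∈ tensorPiece 𝒱 w m) : f z = g z := by
  refine LinearMap.eqOn_span (f := f) (g := g) ?_ hz
  rintro _ ⟨k, l, hkl, x, hx, y, hy, rfl⟩
  exact h k l hkl x hx y hy

theorem lowerPart_of_mem (j : ℕ) (γ : GSym 𝒱 →ₗ[R] GSym 𝒱) {n : ℕ} {x : GSym 𝒱}
    (hx : x ∈ wt 𝒱 n) :
    lowerPart 𝒱 j γ x = if j ≤ n then projWt 𝒱 (n - j) (γ x) else 0 := by
  have h := DirectSum.decompose_of_mem (wt 𝒱) hx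
  simp only [lowerPart, LinearMap.comp_apply, LinearEquiv.coe_coe,
    DirectSum.decomposeLinearEquiv_apply]
  rw [h, ← DirectSum.lof_eq_of R, DirectSum.toModule_lof]
  split_ifs <;> simp

theorem projWt_lowerPart (j k : ℕ) (γ : GSym 𝒱 →ₗ[R] GSym 𝒱) (x : GSym 𝒱) :
    projWt 𝒱 k (lowerPart 𝒱 j γ x) = projWt 𝒱 k (γ (projWt 𝒱 (k + j) x)) := by
  have : projWt 𝒱 k ∘ₗ lowerPart 𝒱 j γ = projWt 𝒱 k ∘ₗ γ ∘ₗ projWt 𝒱 (k + j) := by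
    refine wt_ext 𝒱 fun n x hx => ?_
    simp only [LinearMap.comp_apply]
    rw [lowerPart_of_mem 𝒱 j γ hx]
    by_cases h : n = k + j
    · subst h
      rw [if_pos (by omega), projWt_of_mem 𝒱 hx, Nat.add_sub_cancel,
        projWt_of_mem 𝒱 (projWt_mem 𝒱 _ _)]
    · rw [projWt_of_mem_ne 𝒱 hx h, map_zero, map_zero]
      split_ifs
      · exact projWt_of_mem_ne 𝒱 (projWt_mem 𝒱 _ _) (by omega)
      · exact map_zero _
  exact LinearMap.congr_fun this x

theorem lowerPart_add (j : ℕ) (γ γ' : GSym 𝒱 →ₗ[R] GSym 𝒱) :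
    lowerPart 𝒱 j (γ + γ') = lowerPart 𝒱 j γ + lowerPart 𝒱 j γ' := by
  refine wt_ext 𝒱 fun n x hx => ?_
  rw [LinearMap.add_apply, lowerPart_of_mem 𝒱 j _ hx, lowerPart_of_mem 𝒱 j _ hx,
    lowerPart_of_mem 𝒱 j _ hx]
  split_ifs <;> simp

/-- Δ respects the grading by symmetric powers, so the coderivation identity splits according to the
amount by which weight drops: projection to total weight n − j turns γ ⊗ 1 and 1 ⊗ γ on Sᵏ ⊗ Sˡ, k +
l = n, into their parts that lower by j. -/
theorem isCoderivation_lowerPart (j : ℕ) {γ : GSym 𝒱 →ₗ[R] GSym 𝒱} (hγ : IsCoderivation 𝒱 γ) :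
    IsCoderivation 𝒱 (lowerPart 𝒱 j γ) where
  degree n x hx := by
    obtain ⟨N, hN⟩ := exists_mem_coaugFiltration 𝒱 x
    rw [← sum_projWt 𝒱 hN N.lt_succ_self, map_sum]
    refine sum_mem fun m _ => ?_
    rw [lowerPart_of_mem 𝒱 j γ (projWt_mem 𝒱 m x)]
    split_ifs
    · exact projWt_mem_deg 𝒱 _ (hγ.degree _ _ (projWt_mem_deg 𝒱 _ hx))
    · exact zero_mem _
  comul_comp := by
    refine wt_ext 𝒱 fun n x hx => ?_
    simp only [LinearMap.comp_apply]
    have hz := comul_mem 𝒱 (fun _ => (1 : ℕ)) hx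
    rw [lowerPart_of_mem 𝒱 j γ hx]
    split_ifs with hj
    · have hc := LinearMap.congr_fun hγ.comul_comp x
      simp only [LinearMap.comp_apply] at hc
      rw [comul_projWt, hc, ← LinearMap.comp_apply]
      refine eq_on_tensorPiece 𝒱 _ (fun k l hkl x hx y hy => ?_) hz
      simp only [LinearMap.comp_apply, LinearMap.add_apply, map_add, TensorProduct.map_tmul,
        LinearMap.id_apply]
      rw [tensorProjWt_tmul_right 𝒱 _ _ hy,
        tensorProjWt_tmul_left 𝒱 _ _ (sgn_mem_piece 𝒱 _ 1 hx), lowerPart_of_mem 𝒱 j γ hx,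
        lowerPart_of_mem 𝒱 j γ hy]
      congr 1
      -- For j > k one has l > n − j, so γ x ⊗ y with y ∈ Sˡ has no component of total weight n − j.
      · by_cases h : j ≤ k
        · rw [if_pos (by omega), if_pos h]
          congr 3; omega
        · rw [if_neg (by omega), if_neg h, zero_tmul]
      · by_cases h : j ≤ l
        · rw [if_pos (by omega), if_pos h]
          congr 3; omega
        · rw [if_neg (by omega), if_neg h, tmul_zero]
    · rw [map_zero]
      symm
      refine eq_on_tensorPiece 𝒱 _ (g := 0) (fun k l hkl x hx y hy => ?_) hz
      simp only [LinearMap.add_apply, TensorProduct.map_tmul, LinearMap.id_apply]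
      rw [lowerPart_of_mem 𝒱 j γ hx, lowerPart_of_mem 𝒱 j γ hy, if_neg (by omega),
        if_neg (by omega)]
      simp

end GSym

/-! ### Coderivations in characteristic zero, and the induced differential -/

namespace GSym

variable {R : Type*} [CommRing R] {V : Type*} [AddCommGroup V] [Module R V]
  (𝒱 : ℤ → Submodule R V) [DirectSum.Decomposition 𝒱]

theorem counit_of_mem_deg {m : ℤ} {x : GSym 𝒱} (hx : x ∈ deg 𝒱 m) (hm : m ≠ 0) :
    counit 𝒱 x = 0 := by
  refine piece_induction 𝒱 _ (p := fun m x => m ≠ 0 → counit 𝒱 x = 0) ?_ ?_ ?_ ?_ ?_ hx hm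
  · simp
  · intro m x y hx hy hm; rw [map_add, hx hm, hy hm, add_zero]
  · intro m r x hx hm; rw [map_smul, hx hm, smul_zero]
  · intro h; exact absurd rfl h
  · intro i v hv m x _ _ _; exact counit_ι_mul 𝒱 v x

theorem projV_mem {m : ℤ} {x : GSym 𝒱} (hx : x ∈ deg 𝒱 m) : projV 𝒱 x ∈ 𝒱 m := by
  refine piece_induction 𝒱 _ (p := fun m x => projV 𝒱 x ∈ 𝒱 m) ?_ ?_ ?_ ?_ ?_ hx
  · simp
  · intro m x y hx hy; rw [map_add]; exact add_mem hx hy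
  · intro m r x hx; rw [map_smul]; exact Submodule.smul_mem _ _ hx
  · rw [projV_one]; exact zero_mem _
  · intro i v hv m x hx _
    rw [projV_ι_mul]
    by_cases hm : m = 0
    · subst hm; rw [add_zero]; exact Submodule.smul_mem _ _ hv
    · rw [counit_of_mem_deg 𝒱 hx hm, zero_smul]; exact zero_mem _

theorem lTensor_counit_comul (x : GSym 𝒱) :
    (counit 𝒱).toLinearMap.lTensor (GSym 𝒱) (comul 𝒱 x) = x ⊗ₜ 1 := by
  have := counit_lTensor_comul 𝒱 x
  rw [← LinearEquiv.eq_symm_apply] at this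
  rw [this]; rfl

theorem rTensor_counit_comul (x : GSym 𝒱) :
    (counit 𝒱).toLinearMap.rTensor (GSym 𝒱) (comul 𝒱 x) = 1 ⊗ₜ x := by
  have := counit_rTensor_comul 𝒱 x
  rw [← LinearEquiv.eq_symm_apply] at this
  rw [this]; rfl

theorem map_projWt_zero_comul {N : Type*} [AddCommGroup N] [Module R N] (f : GSym 𝒱 →ₗ[R] N)
    (x : GSym 𝒱) : TensorProduct.map f (projWt 𝒱 0) (comul 𝒱 x) = f x ⊗ₜ 1 := by
  have h : projWt 𝒱 0 = Algebra.linearMap R _ ∘ₗ (counit 𝒱).toLinearMap :=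
    LinearMap.ext (projWt_zero 𝒱)
  have h2 : TensorProduct.map f (projWt 𝒱 0) =
      TensorProduct.map f (Algebra.linearMap R (GSym 𝒱)) ∘ₗ
        (counit 𝒱).toLinearMap.lTensor (GSym 𝒱) := by
    rw [h]; ext; simp
  rw [h2, LinearMap.comp_apply, lTensor_counit_comul]
  simp

theorem map_projWt_zero_left_comul {N : Type*} [AddCommGroup N] [Module R N] (f : GSym 𝒱 →ₗ[R] N)
    (x : GSym 𝒱) : TensorProduct.map (projWt 𝒱 0) f (comul 𝒱 x) = 1 ⊗ₜ f x := by
  have h : projWt 𝒱 0 = Algebra.linearMap R _ ∘ₗ (counit 𝒱).toLinearMap :=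
    LinearMap.ext (projWt_zero 𝒱)
  have h2 : TensorProduct.map (projWt 𝒱 0) f =
      TensorProduct.map (Algebra.linearMap R (GSym 𝒱)) f ∘ₗ
        (counit 𝒱).toLinearMap.rTensor (GSym 𝒱) := by
    rw [h]; ext; simp
  rw [h2, LinearMap.comp_apply, rTensor_counit_comul]
  simp

theorem mul_comul_ι_mul {i : ℤ} {v : V} (hv : v ∈ 𝒱 i) (z : GSym 𝒱 ⊗[R] GSym 𝒱) :
    LinearMap.mul' R _ (comulMulLeft 𝒱 i v z) = (2 : R) • (ι 𝒱 v * LinearMap.mul' R _ z) := by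
  have : LinearMap.mul' R _ ∘ₗ comulMulLeft 𝒱 i v =
      (2 : R) • (LinearMap.mulLeft R (ι 𝒱 v) ∘ₗ LinearMap.mul' R _) := by
    refine tensor_homogeneous_ext (deg 𝒱) (deg 𝒱) fun m x hx n y hy => ?_
    simp only [LinearMap.comp_apply, comulMulLeft_tmul, map_add, LinearMap.mul'_apply,
      LinearMap.smul_apply, LinearMap.mulLeft_apply, sgn_of_mem (deg 𝒱) i hx]
    rw [two_smul, ← mul_assoc, ← mul_assoc, smul_mul_assoc, ← ι_mul_comm 𝒱 hv hx]
  exact LinearMap.congr_fun this z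

/-- Each of the 2ⁿ ways of distributing the n factors over the two tensor slots multiplies back to
`x`, graded commutativity absorbing the Koszul sign. The eigenvalue 2 of primitive elements
therefore singles out S¹. -/
theorem mul_comul {n : ℕ} {x : GSym 𝒱} (hx : x ∈ wt 𝒱 n) :
    LinearMap.mul' R _ (comul 𝒱 x) = (2 : R) ^ n • x := by
  refine piece_induction 𝒱 _
    (p := fun n x => LinearMap.mul' R _ (comul 𝒱 x) = (2 : R) ^ n • x) ?_ ?_ ?_ ?_ ?_ hx
  · simp
  · intro m x y hx hy; rw [map_add, map_add, hx, hy, smul_add]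
  · intro m r x hx; rw [map_smul, map_smul, hx, smul_comm]
  · simp [comul_one]
  · intro i v hv m x _ ih
    rw [comul_ι_mul 𝒱 hv, mul_comul_ι_mul 𝒱 hv, ih, mul_smul_comm, smul_smul, pow_add, pow_one]

/-- In characteristic zero, primitive elements of `S[V]` without component in `V` vanish. -/
theorem eq_zero_of_primitive [Algebra ℚ R] {x : GSym 𝒱}
    (hx : LinearMap.mul' R _ (comul 𝒱 x) = (2 : R) • x) (h1 : projV 𝒱 x = 0) : x = 0 := by
  obtain ⟨n, hn⟩ := exists_mem_coaugFiltration 𝒱 x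
  have hp : ∀ m, projWt 𝒱 m (LinearMap.mul' R _ (comul 𝒱 x)) = (2 : R) ^ m • projWt 𝒱 m x := by
    intro m
    have : projWt 𝒱 m ∘ₗ LinearMap.mul' R _ ∘ₗ comul 𝒱 = (2 : R) ^ m • projWt 𝒱 m := by
      refine wt_ext 𝒱 fun k y hy => ?_
      rw [LinearMap.comp_apply, LinearMap.comp_apply, mul_comul 𝒱 hy, LinearMap.smul_apply,
        map_smul]
      by_cases hk : k = m
      · rw [hk]
      · rw [projWt_of_mem_ne 𝒱 hy hk, smul_zero, smul_zero]
    exact LinearMap.congr_fun this x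
  rw [← sum_projWt 𝒱 hn n.lt_succ_self]
  refine Finset.sum_eq_zero fun m _ => ?_
  by_cases hm : m = 1
  · rw [hm, projWt_one, h1, map_zero]
  · have h := hp m
    rw [hx, map_smul] at h
    -- `h` says (2 ^ m - 2) x_m = 0 for the component x_m of `x`; the integer 2 ^ m - 2, which is -1
    -- for m = 0, is non-zero for m ≠ 1 and hence invertible in a ring containing ℚ.
    have hu : IsUnit ((2 : R) ^ m - 2) := by
      have h2 : ((2 : ℚ) ^ m - 2) ≠ 0 := by
        rcases m with _ | _ | m
        · norm_num
        · exact absurd rfl hm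
        · have : (1 : ℚ) ≤ 2 ^ m := one_le_pow₀ (by norm_num)
          rw [pow_succ, pow_succ]
          intro h
          linarith
      simpa only [map_sub, map_pow, map_ofNat] using (IsUnit.mk0 _ h2).map (algebraMap ℚ R)
    rw [← hu.smul_eq_zero, sub_smul, h, sub_self]

variable {𝒱} in
/-- A coderivation of `S[V]` preserves the kernel of the counit. -/
theorem counit_coderivation {q : ℤ} {γ : GSym 𝒱 →ₗ[R] GSym 𝒱} (hγ : comul 𝒱 ∘ₗ γ =
      (TensorProduct.map γ LinearMap.id + TensorProduct.map (sgn (deg 𝒱) q) γ) ∘ₗ comul 𝒱)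
    (x : GSym 𝒱) : counit 𝒱 (γ x) = 0 := by
  have h := LinearMap.congr_fun hγ x
  simp only [LinearMap.comp_apply] at h
  have h2 : (counit 𝒱).toLinearMap.rTensor (GSym 𝒱) ∘ₗ
      (TensorProduct.map γ LinearMap.id + TensorProduct.map (sgn (deg 𝒱) q) γ) =
      ((counit 𝒱).toLinearMap ∘ₗ γ).rTensor (GSym 𝒱) +
        γ.lTensor R ∘ₗ (counit 𝒱).toLinearMap.rTensor (GSym 𝒱) := by
    ext; simp [counit_sgn]
  -- Applying ε ⊗ 1 to the formula for Δ γ x produces 1 ⊗ γ x on both sides. What is left is (εγ ⊗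
  -- 1) Δ x = 0, and 1 ⊗ ε extracts ε γ x from it.
  have h3 := congrArg ((counit 𝒱).toLinearMap.rTensor (GSym 𝒱)) h
  rw [rTensor_counit_comul, ← LinearMap.comp_apply, h2, LinearMap.add_apply, LinearMap.comp_apply,
    rTensor_counit_comul, LinearMap.lTensor_tmul, right_eq_add] at h3
  have h4 : (counit 𝒱).toLinearMap.lTensor R ∘ₗ ((counit 𝒱).toLinearMap ∘ₗ γ).rTensor (GSym 𝒱) =
      ((counit 𝒱).toLinearMap ∘ₗ γ).rTensor R ∘ₗ (counit 𝒱).toLinearMap.lTensor (GSym 𝒱) := by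
    ext; simp
  have h5 := congrArg ((counit 𝒱).toLinearMap.lTensor R) h3
  rw [← LinearMap.comp_apply, h4, LinearMap.comp_apply, lTensor_counit_comul] at h5
  have h6 := congrArg (TensorProduct.rid R R) h5
  simpa using h6

variable {𝒱} in
/-- In characteristic zero, a coderivation of `S[V]` is determined by its constituent with values
in `V`. -/
theorem coderivation_eq_zero [Algebra ℚ R] {q : ℤ} {γ : GSym 𝒱 →ₗ[R] GSym 𝒱}
    (hγ : comul 𝒱 ∘ₗ γ =
      (TensorProduct.map γ LinearMap.id + TensorProduct.map (sgn (deg 𝒱) q) γ) ∘ₗ comul 𝒱)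
    (h0 : ∀ x, projV 𝒱 (γ x) = 0) : γ = 0 := by
  have key : ∀ n, ∀ x ∈ wt 𝒱 n, γ x = 0 := by
    intro n
    induction n using Nat.strong_induction_on with
    | _ n ih =>
      intro x hx
      have hz := comul_mem 𝒱 (fun _ => (1 : ℕ)) hx
      have h := LinearMap.congr_fun hγ x
      simp only [LinearMap.comp_apply, LinearMap.add_apply] at h
      -- By induction γ kills every factor of weight below n, so only the extreme terms x ⊗ 1 and 1
      -- ⊗ x of Δ x survive: γ x is primitive.
      have h1 : TensorProduct.map γ LinearMap.id (comul 𝒱 x) = γ x ⊗ₜ 1 := by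
        rw [← map_projWt_zero_comul]
        refine eq_on_tensorPiece 𝒱 _ (fun k l hkl x hx y hy => ?_) hz
        rw [TensorProduct.map_tmul, TensorProduct.map_tmul]
        by_cases hl : l = 0
        · subst hl; rw [projWt_of_mem 𝒱 hy]; rfl
        · rw [ih k (by omega) x hx, zero_tmul, zero_tmul]
      have h2 : TensorProduct.map (sgn (deg 𝒱) q) γ (comul 𝒱 x) = 1 ⊗ₜ γ x := by
        rw [← map_projWt_zero_left_comul]
        refine eq_on_tensorPiece 𝒱 _ (fun k l hkl x hx y hy => ?_) hz
        rw [TensorProduct.map_tmul, TensorProduct.map_tmul]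
        by_cases hk : k = 0
        · subst hk
          have : sgn (deg 𝒱) q x = x := by
            rw [← projWt_of_mem 𝒱 hx, projWt_zero, Algebra.algebraMap_eq_smul_one, map_smul,
              sgn_one]
          rw [projWt_of_mem 𝒱 hx, this]
        · rw [ih l (by omega) y hy, tmul_zero, tmul_zero]
      rw [h1, h2] at h
      refine eq_zero_of_primitive 𝒱 ?_ (h0 x)
      rw [h, map_add, LinearMap.mul'_apply, LinearMap.mul'_apply, mul_one, one_mul, two_smul]
  exact wt_ext 𝒱 fun n x hx => by rw [key n x hx, LinearMap.zero_apply]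

/-- The coderivation of `S[V]` determined by a linear map `g : S[V] → V` of degree `-1`. -/
def cofreeCoderivation (g : GSym 𝒱 →ₗ[R] V) : GSym 𝒱 →ₗ[R] GSym 𝒱 :=
  LinearMap.mul' R _ ∘ₗ TensorProduct.map (ι 𝒱 ∘ₗ g) LinearMap.id ∘ₗ comul 𝒱

/-- Expanding Δ(g(x₁) x₂) by multiplicativity gives the terms g(x₁) x₂ ⊗ x₃ and ± x₂ ⊗ g(x₁) x₃,
which is the map `F` below. Coassociativity handles the first; for the second, x₁ and x₂ must be
exchanged, which is cocommutativity. -/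
theorem comul_comp_cofreeCoderivation {g : GSym 𝒱 →ₗ[R] V}
    (hg : ∀ n, ∀ x ∈ deg 𝒱 n, g x ∈ 𝒱 (n - 1)) :
    comul 𝒱 ∘ₗ cofreeCoderivation 𝒱 g =
      (TensorProduct.map (cofreeCoderivation 𝒱 g) LinearMap.id +
        TensorProduct.map (sgn (deg 𝒱) 1) (cofreeCoderivation 𝒱 g)) ∘ₗ comul 𝒱 := by
  let m : GSym 𝒱 ⊗[R] GSym 𝒱 →ₗ[R] GSym 𝒱 :=
    LinearMap.mul' R _ ∘ₗ TensorProduct.map (ι 𝒱 ∘ₗ g) LinearMap.id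
  let al : (GSym 𝒱 ⊗[R] GSym 𝒱) ⊗[R] GSym 𝒱 →ₗ[R] GSym 𝒱 ⊗[R] (GSym 𝒱 ⊗[R] GSym 𝒱) :=
    (TensorProduct.assoc R _ _ _).toLinearMap
  let al' : GSym 𝒱 ⊗[R] (GSym 𝒱 ⊗[R] GSym 𝒱) →ₗ[R] (GSym 𝒱 ⊗[R] GSym 𝒱) ⊗[R] GSym 𝒱 :=
    (TensorProduct.assoc R _ _ _).symm.toLinearMap
  let F : GSym 𝒱 ⊗[R] (GSym 𝒱 ⊗[R] GSym 𝒱) →ₗ[R] GSym 𝒱 ⊗[R] GSym 𝒱 :=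
    TensorProduct.map m LinearMap.id ∘ₗ al' + TensorProduct.map (sgn (deg 𝒱) 1) m ∘ₗ al ∘ₗ
      (swap 𝒱).rTensor (GSym 𝒱) ∘ₗ al'
  have hF : comul 𝒱 ∘ₗ m = F ∘ₗ (comul 𝒱).lTensor (GSym 𝒱) := by
    refine TensorProduct.ext (homogeneous_ext (deg 𝒱) fun i x hx => LinearMap.ext fun y => ?_)
    have hgx := hg i x hx
    change comul 𝒱 (ι 𝒱 (g x) * y) = F (x ⊗ₜ comul 𝒱 y)
    rw [comul_ι_mul 𝒱 hgx]
    generalize comul 𝒱 y = u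
    have : comulMulLeft 𝒱 (i - 1) (g x) = F ∘ₗ TensorProduct.mk R _ _ x := by
      refine tensor_homogeneous_ext (deg 𝒱) (deg 𝒱) fun k a ha l b hb => ?_
      simp only [comulMulLeft_tmul, F, LinearMap.comp_apply, TensorProduct.mk_apply,
        LinearMap.add_apply, al', al, LinearEquiv.coe_coe, TensorProduct.assoc_symm_tmul,
        TensorProduct.map_tmul, LinearMap.rTensor_tmul, swap_tmul 𝒱 hx ha,
        sgn_of_mem (deg 𝒱) _ ha, m, LinearMap.mul'_apply, LinearMap.id_apply,
        ← TensorProduct.smul_tmul', map_smul, TensorProduct.assoc_tmul, smul_smul]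
      congr 2
      rw [← ksgn_add]
      apply ksgn_congr
      simp only [Int.even_add, Int.even_sub, Int.even_mul, Int.not_even_one]
      tauto
    exact LinearMap.congr_fun this u
  ext x
  have hx := LinearMap.congr_fun hF (comul 𝒱 x)
  have hco : (comul 𝒱).lTensor (GSym 𝒱) (comul 𝒱 x) = al ((comul 𝒱).rTensor (GSym 𝒱) (comul 𝒱 x)) :=
    (LinearMap.congr_fun (coassoc 𝒱) x).symm
  have hsw : ∀ z, (swap 𝒱).rTensor (GSym 𝒱) ((comul 𝒱).rTensor (GSym 𝒱) z) =
      (comul 𝒱).rTensor (GSym 𝒱) z := by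
    intro z
    rw [← LinearMap.comp_apply, ← LinearMap.rTensor_comp, swap_comp_comul]
  have hG : cofreeCoderivation 𝒱 g = m ∘ₗ comul 𝒱 := rfl
  simp only [LinearMap.comp_apply] at hx
  rw [LinearMap.comp_apply, hG, LinearMap.comp_apply, hx, hco]
  simp only [F, LinearMap.add_apply, LinearMap.comp_apply, al, al', LinearEquiv.coe_coe,
    LinearEquiv.symm_apply_apply, hsw]
  congr 1
  · generalize comul 𝒱 x = z
    induction z with
    | zero => simp
    | add z w hz hw => simp only [map_add, hz, hw]
    | tmul a b => rfl
  · have h3 := LinearMap.congr_fun (coassoc 𝒱) x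
    simp only [LinearMap.comp_apply, LinearEquiv.coe_coe] at h3
    rw [h3]
    generalize comul 𝒱 x = z
    induction z with
    | zero => simp
    | add z w hz hw => simp only [map_add, hz, hw]
    | tmul a b => rfl

theorem projV_cofreeCoderivation (g : GSym 𝒱 →ₗ[R] V) (x : GSym 𝒱) :
    projV 𝒱 (cofreeCoderivation 𝒱 g x) = g x := by
  have h : projV 𝒱 ∘ₗ LinearMap.mul' R _ ∘ₗ TensorProduct.map (ι 𝒱 ∘ₗ g) LinearMap.id =
      g ∘ₗ (TensorProduct.rid R _).toLinearMap ∘ₗ (counit 𝒱).toLinearMap.lTensor (GSym 𝒱) := by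
    ext x y
    simp [projV_ι_mul]
  have h2 := LinearMap.congr_fun h (comul 𝒱 x)
  simp only [LinearMap.comp_apply, LinearEquiv.coe_coe, counit_lTensor_comul] at h2
  exact h2

/-- The difference of the two sides is a coderivation without component in V. The resulting formula
γ x = ∑ g(x₁) x₂ makes φ ∘ γ computable from g alone. -/
theorem IsCoderivation.eq_cofreeCoderivation [Algebra ℚ R] {γ : GSym 𝒱 →ₗ[R] GSym 𝒱}
    (hγ : IsCoderivation 𝒱 γ) : γ = cofreeCoderivation 𝒱 (projV 𝒱 ∘ₗ γ) := by
  rw [← sub_eq_zero]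
  refine coderivation_eq_zero (q := 1) ?_ fun x => ?_
  · have h1 := hγ.comul_comp
    have h2 := comul_comp_cofreeCoderivation 𝒱 (g := projV 𝒱 ∘ₗ γ)
      (fun n x hx => projV_mem 𝒱 (hγ.degree n x hx))
    rw [LinearMap.comp_sub, h1, h2, ← LinearMap.sub_comp]
    congr 1
    ext x y
    simp only [TensorProduct.AlgebraTensorModule.curry_apply, LinearMap.restrictScalars_self,
      TensorProduct.curry_apply, LinearMap.sub_apply, LinearMap.add_apply, TensorProduct.map_tmul,
      TensorProduct.sub_tmul, TensorProduct.tmul_sub]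
    abel
  · rw [LinearMap.sub_apply, map_sub, projV_cofreeCoderivation, LinearMap.comp_apply, sub_self]

theorem diffAlgHom_snd (d : Differential 𝒱) (x : GSym 𝒱) :
    diffAlgHom 𝒱 d x 1 0 = 0 ∧ diffAlgHom 𝒱 d x 1 1 = x := by
  have hι : ∀ v, diffAlgHom 𝒱 d (ι 𝒱 v) = diffMatrix 𝒱 d v := fun v => lift_ι 𝒱 _ _ v
  have h1 : Matrix.entryLinearMap R (GSym 𝒱) (1 : Fin 2) (0 : Fin 2) ∘ₗ
      (diffAlgHom 𝒱 d).toLinearMap = 0 := by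
    refine ι_mul_ext 𝒱 (by simp) fun i v hv x hx => ?_
    simp only [LinearMap.comp_apply, AlgHom.toLinearMap_apply, Matrix.entryLinearMap_apply,
      LinearMap.zero_apply] at hx ⊢
    rw [map_mul, Matrix.mul_apply, Fin.sum_univ_two, hι, hx]
    simp [diffMatrix]
  have h2 : Matrix.entryLinearMap R (GSym 𝒱) (1 : Fin 2) (1 : Fin 2) ∘ₗ
      (diffAlgHom 𝒱 d).toLinearMap = LinearMap.id := by
    refine ι_mul_ext 𝒱 (by simp) fun i v hv x hx => ?_
    simp only [LinearMap.comp_apply, AlgHom.toLinearMap_apply, Matrix.entryLinearMap_apply,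
      LinearMap.id_apply] at hx ⊢
    rw [map_mul, Matrix.mul_apply, Fin.sum_univ_two, hι, hx]
    simp [diffMatrix]
  exact ⟨LinearMap.congr_fun h1 x, LinearMap.congr_fun h2 x⟩

theorem diff_one (d : Differential 𝒱) : diff 𝒱 d 1 = 0 := by
  simp [diff]

theorem diff_ι_mul (d : Differential 𝒱) {i : ℤ} {v : V} (hv : v ∈ 𝒱 i) (x : GSym 𝒱) :
    diff 𝒱 d (ι 𝒱 v * x) = ι 𝒱 (d.toLin v) * x + ksgn R i • (ι 𝒱 v * diff 𝒱 d x) := by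
  have hι : diffAlgHom 𝒱 d (ι 𝒱 v) = diffMatrix 𝒱 d v := lift_ι 𝒱 _ _ v
  simp only [diff, LinearMap.comp_apply, AlgHom.toLinearMap_apply, Matrix.entryLinearMap_apply]
  rw [map_mul, Matrix.mul_apply, Fin.sum_univ_two, hι, (diffAlgHom_snd 𝒱 d x).2]
  simp only [diffMatrix, LinearMap.coe_mk, AddHom.coe_mk, Matrix.of_apply, Matrix.cons_val',
    Matrix.cons_val_zero, Matrix.cons_val_one]
  rw [sgn_of_mem (deg 𝒱) 1 (ι_mem 𝒱 (fun i => i) hv), one_mul, smul_mul_assoc, add_comm]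

theorem diff_mem_deg (d : Differential 𝒱) {n : ℤ} {x : GSym 𝒱} (hx : x ∈ deg 𝒱 n) :
    diff 𝒱 d x ∈ deg 𝒱 (n - 1) := by
  refine piece_induction 𝒱 _ (p := fun n x => diff 𝒱 d x ∈ deg 𝒱 (n - 1)) ?_ ?_ ?_ ?_ ?_ hx
  · simp
  · intro m x y hx hy; rw [map_add]; exact add_mem hx hy
  · intro m r x hx; rw [map_smul]; exact Submodule.smul_mem _ _ hx
  · rw [diff_one]; exact zero_mem _
  · intro i v hv m x hx ih
    rw [diff_ι_mul 𝒱 d hv]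
    refine add_mem ?_ (Submodule.smul_mem _ _ ?_)
    · have := ι_mul_mem 𝒱 (fun i => i) (d.degree i v hv) hx
      rwa [sub_add_eq_add_sub] at this
    · have := ι_mul_mem 𝒱 (fun i => i) hv ih
      rwa [← add_sub_assoc] at this

theorem diff_mem_wt (d : Differential 𝒱) {n : ℕ} {x : GSym 𝒱} (hx : x ∈ wt 𝒱 n) :
    diff 𝒱 d x ∈ wt 𝒱 n := by
  refine piece_induction 𝒱 _ (p := fun n x => diff 𝒱 d x ∈ wt 𝒱 n) ?_ ?_ ?_ ?_ ?_ hx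
  · simp
  · intro m x y hx hy; rw [map_add]; exact add_mem hx hy
  · intro m r x hx; rw [map_smul]; exact Submodule.smul_mem _ _ hx
  · rw [diff_one]; exact zero_mem _
  · intro i v hv m x hx ih
    rw [diff_ι_mul 𝒱 d hv]
    exact add_mem (ι_mul_mem 𝒱 (fun _ => 1) (d.degree i v hv) hx)
      (Submodule.smul_mem _ _ (ι_mul_mem 𝒱 (fun _ => 1) hv ih))

theorem diff_diff (d : Differential 𝒱) (x : GSym 𝒱) : diff 𝒱 d (diff 𝒱 d x) = 0 := by
  have : diff 𝒱 d ∘ₗ diff 𝒱 d = 0 := by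
    refine ι_mul_ext 𝒱 (by simp [diff_one]) fun i v hv x hx => ?_
    simp only [LinearMap.comp_apply, LinearMap.zero_apply] at hx ⊢
    rw [diff_ι_mul 𝒱 d hv, map_add, map_smul, diff_ι_mul 𝒱 d hv, diff_ι_mul 𝒱 d (d.degree i v hv),
      d.sq_zero, hx, map_zero, ksgn_sub, ksgn_one]
    simp
  exact LinearMap.congr_fun this x

/-- The induced operator on the tensor square satisfies the same recursion in the leading factor as
d⁰ does: (d v)· plus (-1)^|v| v· applied after d. -/
theorem isCoderivation_diff (d : Differential 𝒱) : IsCoderivation 𝒱 (diff 𝒱 d) where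
  degree n x hx := diff_mem_deg 𝒱 d hx
  comul_comp := by
    refine ι_mul_ext 𝒱 (by simp [diff_one, comul_one]) fun i v hv x hx => ?_
    have : (TensorProduct.map (diff 𝒱 d) LinearMap.id +
          TensorProduct.map (sgn (deg 𝒱) 1) (diff 𝒱 d)) ∘ₗ comulMulLeft 𝒱 i v =
        comulMulLeft 𝒱 (i - 1) (d.toLin v) + ksgn R i • (comulMulLeft 𝒱 i v ∘ₗ
          (TensorProduct.map (diff 𝒱 d) LinearMap.id +
            TensorProduct.map (sgn (deg 𝒱) 1) (diff 𝒱 d))) := by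
      refine tensor_homogeneous_ext (deg 𝒱) (deg 𝒱) fun m x hx n y hy => ?_
      simp only [LinearMap.comp_apply, LinearMap.add_apply, LinearMap.smul_apply,
        comulMulLeft_tmul, map_add, TensorProduct.map_tmul, sgn_of_mem (deg 𝒱) _ hx,
        sgn_of_mem (deg 𝒱) _ (diff_mem_deg 𝒱 d hx), LinearMap.id_apply, map_smul,
        sgn_of_mem (deg 𝒱) _ (ι_mul_mem 𝒱 (fun i => i) hv hx), diff_ι_mul 𝒱 d hv,
        ← TensorProduct.smul_tmul', TensorProduct.tmul_smul, TensorProduct.add_tmul,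
        TensorProduct.tmul_add, smul_add, smul_smul]
      match_scalars <;> simp only [mul_one, ← ksgn_add] <;> apply ksgn_congr <;>
        simp only [Int.even_add, Int.even_sub, Int.even_mul, Int.not_even_one] <;> tauto
    simp only [LinearMap.comp_apply] at hx ⊢
    rw [diff_ι_mul 𝒱 d hv, map_add, map_smul, comul_ι_mul 𝒱 hv,
      comul_ι_mul 𝒱 (d.degree i v hv), comul_ι_mul 𝒱 hv, hx]
    exact (LinearMap.congr_fun this (comul 𝒱 x)).symm

end GSym

/-! ### Convolution of maps out of S[V] -/

section Convolution

variable {R : Type*} [CommRing R] {V : Type*} [AddCommGroup V] [Module R V]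
  (𝒱 : ℤ → Submodule R V) [DirectSum.Decomposition 𝒱]
  {M N P Q M' N' : Type*} [AddCommGroup M] [Module R M] [AddCommGroup N] [Module R N]
  [AddCommGroup P] [Module R P] [AddCommGroup Q] [Module R Q] [AddCommGroup M'] [Module R M']
  [AddCommGroup N'] [Module R N']

/-- The convolution of `f` with a map `g` of degree `q`, with respect to a bilinear map `B`:
`x ↦ ∑ (-1) ^ (q |x₁|) B (f x₁) (g x₂)` where `Δ x = ∑ x₁ ⊗ x₂`. -/
def conv (q : ℤ) (B : M →ₗ[R] N →ₗ[R] P) (f : GSym 𝒱 →ₗ[R] M) (g : GSym 𝒱 →ₗ[R] N) :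
    GSym 𝒱 →ₗ[R] P :=
  TensorProduct.lift B ∘ₗ TensorProduct.map (f ∘ₗ sgn (GSym.deg 𝒱) q) g ∘ₗ GSym.comul 𝒱

theorem sgn_sgn {W : Type*} [AddCommGroup W] [Module R W] (𝒲 : ℤ → Submodule R W)
    [DirectSum.Decomposition 𝒲] (p q : ℤ) (x : W) :
    sgn 𝒲 p (sgn 𝒲 q x) = sgn 𝒲 (p + q) x := by
  have : sgn 𝒲 p ∘ₗ sgn 𝒲 q = sgn 𝒲 (p + q) := by
    refine homogeneous_ext 𝒲 fun i x hx => ?_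
    rw [LinearMap.comp_apply, sgn_of_mem 𝒲 q hx, map_smul, sgn_of_mem 𝒲 p hx,
      sgn_of_mem 𝒲 _ hx, smul_smul, add_mul, ksgn_add, mul_comm]
  exact LinearMap.congr_fun this x

/-- This is coassociativity. The four pairings are independent so that one statement serves the cup
product, the iterated pairing [t, [t, φ]] and the regrouping of [t, φ] ψ. On the right the first map
is passed by both `g` and `h`, whence the index `q + r`. -/
theorem conv_assoc (q r : ℤ) (B₁ : M' →ₗ[R] P →ₗ[R] Q) (B₂ : M →ₗ[R] N →ₗ[R] M')
    (B₃ : M →ₗ[R] N' →ₗ[R] Q) (B₄ : N →ₗ[R] P →ₗ[R] N')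
    (hB : ∀ a b c, B₁ (B₂ a b) c = B₃ a (B₄ b c))
    (f : GSym 𝒱 →ₗ[R] M) (g : GSym 𝒱 →ₗ[R] N) (h : GSym 𝒱 →ₗ[R] P) :
    conv 𝒱 r B₁ (conv 𝒱 q B₂ f g) h = conv 𝒱 (q + r) B₃ f (conv 𝒱 r B₄ g h) := by
  let K : GSym 𝒱 ⊗[R] (GSym 𝒱 ⊗[R] GSym 𝒱) →ₗ[R] Q := TensorProduct.lift B₃ ∘ₗ
    TensorProduct.map (f ∘ₗ sgn (GSym.deg 𝒱) (q + r))
      (TensorProduct.lift B₄ ∘ₗ TensorProduct.map (g ∘ₗ sgn (GSym.deg 𝒱) r) h)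
  have hr : TensorProduct.lift B₃ ∘ₗ TensorProduct.map (f ∘ₗ sgn (GSym.deg 𝒱) (q + r))
      (conv 𝒱 r B₄ g h) = K ∘ₗ (GSym.comul 𝒱).lTensor (GSym 𝒱) := by
    ext x y
    rfl
  have hl : TensorProduct.lift B₁ ∘ₗ TensorProduct.map (conv 𝒱 q B₂ f g ∘ₗ sgn (GSym.deg 𝒱) r) h =
      K ∘ₗ (TensorProduct.assoc R _ _ _).toLinearMap ∘ₗ (GSym.comul 𝒱).rTensor (GSym 𝒱) := by
    ext x y
    have hs := LinearMap.congr_fun (GSym.comul_sgn 𝒱 r) x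
    simp only [LinearMap.comp_apply] at hs
    simp only [TensorProduct.AlgebraTensorModule.curry_apply, LinearMap.restrictScalars_self,
      TensorProduct.curry_apply, LinearMap.comp_apply, TensorProduct.map_tmul,
      TensorProduct.lift.tmul, conv, hs, LinearMap.rTensor_tmul]
    generalize GSym.comul 𝒱 x = u
    induction u with
    | zero => simp
    | add u v hu hv =>
      simp only [map_add, TensorProduct.add_tmul, LinearMap.add_apply, hu, hv]
    | tmul a b =>
      simp [K, hB, sgn_sgn]
  ext x
  have hco := LinearMap.congr_fun (GSym.coassoc 𝒱) x
  exact (LinearMap.congr_fun hl (GSym.comul 𝒱 x)).trans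
    ((congrArg K hco).trans (LinearMap.congr_fun hr (GSym.comul 𝒱 x)).symm)

/-- Precomposition with a coderivation is a derivation of the convolution. The factor (-1)^q appears
because the sign operator sees γ x₁, of degree one lower than x₁; the index `q - 1` is the degree of
g ∘ γ. -/
theorem conv_comp_coderivation (q : ℤ) (B : M →ₗ[R] N →ₗ[R] P) (f : GSym 𝒱 →ₗ[R] M)
    (g : GSym 𝒱 →ₗ[R] N) {γ : GSym 𝒱 →ₗ[R] GSym 𝒱} (hγ : GSym.IsCoderivation 𝒱 γ) :
    conv 𝒱 q B f g ∘ₗ γ =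
      ksgn R q • conv 𝒱 q B (f ∘ₗ γ) g + conv 𝒱 (q - 1) B f (g ∘ₗ γ) := by
  have h : TensorProduct.lift B ∘ₗ TensorProduct.map (f ∘ₗ sgn (GSym.deg 𝒱) q) g ∘ₗ
      (TensorProduct.map γ LinearMap.id + TensorProduct.map (sgn (GSym.deg 𝒱) 1) γ) =
      ksgn R q • (TensorProduct.lift B ∘ₗ
        TensorProduct.map ((f ∘ₗ γ) ∘ₗ sgn (GSym.deg 𝒱) q) g) +
      TensorProduct.lift B ∘ₗ TensorProduct.map (f ∘ₗ sgn (GSym.deg 𝒱) (q - 1)) (g ∘ₗ γ) := by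
    refine tensor_homogeneous_ext (GSym.deg 𝒱) (GSym.deg 𝒱) fun m x hx n y hy => ?_
    simp only [LinearMap.comp_apply, LinearMap.add_apply, LinearMap.smul_apply,
      TensorProduct.map_tmul, map_add, TensorProduct.lift.tmul, LinearMap.id_apply,
      sgn_of_mem (GSym.deg 𝒱) _ hx, sgn_of_mem (GSym.deg 𝒱) _ (hγ.degree m x hx), map_smul,
      smul_smul]
    match_scalars <;> simp only [mul_one, ← ksgn_add] <;> apply ksgn_congr <;>
      simp only [Int.even_add, Int.even_sub, Int.even_mul, Int.not_even_one] <;> tauto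
  ext x
  have hc := LinearMap.congr_fun hγ.comul_comp x
  exact (congrArg (TensorProduct.lift B ∘ₗ
    TensorProduct.map (f ∘ₗ sgn (GSym.deg 𝒱) q) g) hc).trans
    (LinearMap.congr_fun h (GSym.comul 𝒱 x))

theorem conv_mem {𝓜 : ℤ → Submodule R M} {𝓝 : ℤ → Submodule R N} {𝓟 : ℤ → Submodule R P}
    {B : M →ₗ[R] N →ₗ[R] P} (hB : ∀ i j, ∀ a ∈ 𝓜 i, ∀ b ∈ 𝓝 j, B a b ∈ 𝓟 (i + j))
    {p q : ℤ} (r : ℤ) {f : GSym 𝒱 →ₗ[R] M} {g : GSym 𝒱 →ₗ[R] N}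
    (hf : ∀ i, ∀ x ∈ GSym.deg 𝒱 i, f x ∈ 𝓜 (i + p))
    (hg : ∀ i, ∀ x ∈ GSym.deg 𝒱 i, g x ∈ 𝓝 (i + q)) {n : ℤ} {x : GSym 𝒱}
    (hx : x ∈ GSym.deg 𝒱 n) : conv 𝒱 r B f g x ∈ 𝓟 (n + (p + q)) := by
  have hz := GSym.comul_mem 𝒱 _ hx
  rw [conv, LinearMap.comp_apply, LinearMap.comp_apply]
  refine Submodule.span_induction (p := fun z _ => TensorProduct.lift B
    (TensorProduct.map (f ∘ₗ sgn (GSym.deg 𝒱) r) g z) ∈ 𝓟 (n + (p + q))) ?_ ?_ ?_ ?_ hz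
  · rintro _ ⟨k, l, rfl, x, hx, y, hy, rfl⟩
    have := hB _ _ _ (hf k _ (sgn_mem (GSym.deg 𝒱) r hx)) _ (hg l y hy)
    rw [add_add_add_comm] at this
    exact this
  · simp
  · intro x y _ _ hx hy; rw [map_add, map_add]; exact add_mem hx hy
  · intro c x _ hx; rw [map_smul, map_smul]; exact Submodule.smul_mem _ _ hx

/-- Cocommutativity of Δ carries the graded symmetry of a pairing over to convolution. -/
theorem conv_swap {𝓜 : ℤ → Submodule R M} {𝓝 : ℤ → Submodule R N}
    {B : M →ₗ[R] N →ₗ[R] P} {B' : N →ₗ[R] M →ₗ[R] P}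
    (hB : ∀ i j, ∀ a ∈ 𝓜 i, ∀ b ∈ 𝓝 j, B a b = ksgn R (i * j) • B' b a)
    {p q : ℤ} {f : GSym 𝒱 →ₗ[R] M} {g : GSym 𝒱 →ₗ[R] N}
    (hf : ∀ i, ∀ x ∈ GSym.deg 𝒱 i, f x ∈ 𝓜 (i + p))
    (hg : ∀ i, ∀ x ∈ GSym.deg 𝒱 i, g x ∈ 𝓝 (i + q)) :
    conv 𝒱 q B f g = ksgn R (p * q) • conv 𝒱 p B' g f := by
  have h : TensorProduct.lift B ∘ₗ TensorProduct.map (f ∘ₗ sgn (GSym.deg 𝒱) q) g ∘ₗ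
      GSym.swap 𝒱 = ksgn R (p * q) • (TensorProduct.lift B' ∘ₗ
        TensorProduct.map (g ∘ₗ sgn (GSym.deg 𝒱) p) f) := by
    refine tensor_homogeneous_ext (GSym.deg 𝒱) (GSym.deg 𝒱) fun m x hx n y hy => ?_
    simp only [LinearMap.comp_apply, LinearMap.smul_apply, GSym.swap_tmul 𝒱 hx hy,
      TensorProduct.map_tmul, TensorProduct.lift.tmul, sgn_of_mem (GSym.deg 𝒱) _ hx,
      sgn_of_mem (GSym.deg 𝒱) _ hy, map_smul, smul_smul, hB _ _ _ (hf n y hy) _ (hg m x hx)]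
    match_scalars
    simp only [mul_one, ← ksgn_add]
    apply ksgn_congr
    simp only [Int.even_add, Int.even_sub, Int.even_mul]
    tauto
  ext x
  have hs := LinearMap.congr_fun (GSym.swap_comp_comul 𝒱) x
  exact (congrArg (TensorProduct.lift B ∘ₗ
    TensorProduct.map (f ∘ₗ sgn (GSym.deg 𝒱) q) g) hs.symm).trans
    (LinearMap.congr_fun h (GSym.comul 𝒱 x))

theorem conv_ι_mul (q : ℤ) (B : M →ₗ[R] N →ₗ[R] P) (f : GSym 𝒱 →ₗ[R] M) (g : GSym 𝒱 →ₗ[R] N)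
    {i : ℤ} {v : V} (hv : v ∈ 𝒱 i) (x : GSym 𝒱) :
    conv 𝒱 q B f g (GSym.ι 𝒱 v * x) = TensorProduct.lift B
      (TensorProduct.map (f ∘ₗ sgn (GSym.deg 𝒱) q) g
        (GSym.comulMulLeft 𝒱 i v (GSym.comul 𝒱 x))) := by
  rw [conv, LinearMap.comp_apply, LinearMap.comp_apply, GSym.comul_ι_mul 𝒱 hv]

theorem conv_add_left (q : ℤ) (B : M →ₗ[R] N →ₗ[R] P) (f f' : GSym 𝒱 →ₗ[R] M)
    (g : GSym 𝒱 →ₗ[R] N) : conv 𝒱 q B (f + f') g = conv 𝒱 q B f g + conv 𝒱 q B f' g := by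
  simp only [conv, LinearMap.add_comp, TensorProduct.map_add_left, LinearMap.comp_add]

theorem conv_add_right (q : ℤ) (B : M →ₗ[R] N →ₗ[R] P) (f : GSym 𝒱 →ₗ[R] M)
    (g g' : GSym 𝒱 →ₗ[R] N) : conv 𝒱 q B f (g + g') = conv 𝒱 q B f g + conv 𝒱 q B f g' := by
  simp only [conv, LinearMap.add_comp, TensorProduct.map_add_right, LinearMap.comp_add]

theorem conv_smul_left (q : ℤ) (B : M →ₗ[R] N →ₗ[R] P) (r : R) (f : GSym 𝒱 →ₗ[R] M)
    (g : GSym 𝒱 →ₗ[R] N) : conv 𝒱 q B (r • f) g = r • conv 𝒱 q B f g := by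
  simp only [conv, LinearMap.smul_comp, TensorProduct.map_smul_left, LinearMap.comp_smul]

theorem conv_smul_right (q : ℤ) (B : M →ₗ[R] N →ₗ[R] P) (r : R) (f : GSym 𝒱 →ₗ[R] M)
    (g : GSym 𝒱 →ₗ[R] N) : conv 𝒱 q B f (r • g) = r • conv 𝒱 q B f g := by
  simp only [conv, LinearMap.smul_comp, TensorProduct.map_smul_right, LinearMap.comp_smul]

/-- Convolution with a map that factors through the counit, on the left. -/
theorem conv_counit_left (q : ℤ) (B : M →ₗ[R] N →ₗ[R] P) (a : M) (g : GSym 𝒱 →ₗ[R] N)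
    (x : GSym 𝒱) :
    conv 𝒱 q B ((GSym.counit 𝒱).toLinearMap.smulRight a) g x = B a (g x) := by
  have h : TensorProduct.lift B ∘ₗ TensorProduct.map
      ((GSym.counit 𝒱).toLinearMap.smulRight a ∘ₗ sgn (GSym.deg 𝒱) q) g =
      B a ∘ₗ g ∘ₗ (TensorProduct.lid R _).toLinearMap ∘ₗ
        (GSym.counit 𝒱).toLinearMap.rTensor (GSym 𝒱) := by
    ext x y
    simp [GSym.counit_sgn]
  have := LinearMap.congr_fun h (GSym.comul 𝒱 x)
  simp only [LinearMap.comp_apply, LinearEquiv.coe_coe, GSym.counit_rTensor_comul] at this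
  exact this

/-- Convolution with a map that factors through the counit, on the right. -/
theorem conv_counit_right (q : ℤ) (B : M →ₗ[R] N →ₗ[R] P) (f : GSym 𝒱 →ₗ[R] M) (b : N)
    (x : GSym 𝒱) :
    conv 𝒱 q B f ((GSym.counit 𝒱).toLinearMap.smulRight b) x =
      B (f (sgn (GSym.deg 𝒱) q x)) b := by
  have h : TensorProduct.lift B ∘ₗ TensorProduct.map (f ∘ₗ sgn (GSym.deg 𝒱) q)
      ((GSym.counit 𝒱).toLinearMap.smulRight b) =
      B.flip b ∘ₗ f ∘ₗ sgn (GSym.deg 𝒱) q ∘ₗ (TensorProduct.rid R _).toLinearMap ∘ₗ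
        (GSym.counit 𝒱).toLinearMap.lTensor (GSym 𝒱) := by
    ext x y
    simp
  have := LinearMap.congr_fun h (GSym.comul 𝒱 x)
  simp only [LinearMap.comp_apply, LinearEquiv.coe_coe, GSym.counit_lTensor_comul] at this
  exact this

theorem derPairing_eq_conv {A : Type*} [Ring A] [Algebra R A] (q : ℤ)
    (t : GSym 𝒱 →ₗ[R] Module.End R A) (φ : GSym 𝒱 →ₗ[R] A) :
    derPairing 𝒱 q t φ = conv 𝒱 q LinearMap.id t φ := rfl

theorem formMul_eq_conv {A : Type*} [Ring A] [Algebra R A] (q : ℤ) (φ ψ : GSym 𝒱 →ₗ[R] A) :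
    formMul 𝒱 q φ ψ = conv 𝒱 q (LinearMap.mul R A) φ ψ := rfl

end Convolution

theorem ksgn_add_eq_zero {R : Type*} [CommRing R] {m n : ℤ} (h : ¬ Even (m - n)) :
    ksgn R m + ksgn R n = 0 := by
  have h' : ksgn R m = ksgn R (n + 1) := ksgn_congr (by
    rw [← sub_sub, Int.even_sub]; simpa using h)
  rw [h', ksgn_add, ksgn_one]; ring

/-! ### Interchanging two factors of the iterated diagonal -/

namespace GSym

variable {R : Type*} [CommRing R] {V : Type*} [AddCommGroup V] [Module R V]
  (𝒱 : ℤ → Submodule R V) [DirectSum.Decomposition 𝒱]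

theorem tensor₃_homogeneous_ext {M : Type*} [AddCommGroup M] [Module R M]
    {f g : GSym 𝒱 ⊗[R] (GSym 𝒱 ⊗[R] GSym 𝒱) →ₗ[R] M}
    (h : ∀ i, ∀ x ∈ deg 𝒱 i, ∀ j, ∀ y ∈ deg 𝒱 j, ∀ k, ∀ z ∈ deg 𝒱 k,
      f (x ⊗ₜ (y ⊗ₜ z)) = g (x ⊗ₜ (y ⊗ₜ z))) : f = g := by
  refine TensorProduct.ext (homogeneous_ext (deg 𝒱) fun i x hx => ?_)
  exact tensor_homogeneous_ext (deg 𝒱) (deg 𝒱) fun j y hy k z hz => h i x hx j y hy k z hz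

/-- The graded interchange of the first two factors of `S[V] ⊗ S[V] ⊗ S[V]`. -/
def swapLeft : GSym 𝒱 ⊗[R] (GSym 𝒱 ⊗[R] GSym 𝒱) →ₗ[R] GSym 𝒱 ⊗[R] (GSym 𝒱 ⊗[R] GSym 𝒱) :=
  (TensorProduct.assoc R _ _ _).toLinearMap ∘ₗ (swap 𝒱).rTensor (GSym 𝒱) ∘ₗ
    (TensorProduct.assoc R _ _ _).symm.toLinearMap

theorem swapLeft_tmul {i j : ℤ} {x y : GSym 𝒱} (hx : x ∈ deg 𝒱 i) (hy : y ∈ deg 𝒱 j)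
    (z : GSym 𝒱) : swapLeft 𝒱 (x ⊗ₜ (y ⊗ₜ z)) = ksgn R (i * j) • (y ⊗ₜ (x ⊗ₜ z)) := by
  simp only [swapLeft, LinearMap.comp_apply, LinearEquiv.coe_coe, TensorProduct.assoc_symm_tmul,
    LinearMap.rTensor_tmul, swap_tmul 𝒱 hx hy, ← TensorProduct.smul_tmul', map_smul,
    TensorProduct.assoc_tmul]

theorem swapLeft_comul (x : GSym 𝒱) : swapLeft 𝒱 ((comul 𝒱).lTensor (GSym 𝒱) (comul 𝒱 x)) =
    (comul 𝒱).lTensor (GSym 𝒱) (comul 𝒱 x) := by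
  have hco := LinearMap.congr_fun (coassoc 𝒱) x
  simp only [LinearMap.comp_apply, LinearEquiv.coe_coe] at hco
  rw [← hco]
  simp only [swapLeft, LinearMap.comp_apply, LinearEquiv.coe_coe, LinearEquiv.symm_apply_apply]
  rw [← LinearMap.comp_apply (LinearMap.rTensor _ _), ← LinearMap.rTensor_comp, swap_comp_comul]

end GSym

theorem conv_comp_comul {R : Type*} [CommRing R] {V : Type*} [AddCommGroup V] [Module R V]
    (𝒱 : ℤ → Submodule R V) [DirectSum.Decomposition 𝒱] {M N P : Type*} [AddCommGroup M]
    [Module R M] [AddCommGroup N] [Module R N] [AddCommGroup P] [Module R P] (q : ℤ)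
    (B : M →ₗ[R] N →ₗ[R] P) (f : GSym 𝒱 →ₗ[R] M) (g : GSym 𝒱 ⊗[R] GSym 𝒱 →ₗ[R] N) (x : GSym 𝒱) :
    conv 𝒱 q B f (g ∘ₗ GSym.comul 𝒱) x =
      (TensorProduct.lift B ∘ₗ TensorProduct.map (f ∘ₗ sgn (GSym.deg 𝒱) q) g)
        ((GSym.comul 𝒱).lTensor (GSym 𝒱) (GSym.comul 𝒱 x)) := by
  have : TensorProduct.map (f ∘ₗ sgn (GSym.deg 𝒱) q) (g ∘ₗ GSym.comul 𝒱) =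
      TensorProduct.map (f ∘ₗ sgn (GSym.deg 𝒱) q) g ∘ₗ (GSym.comul 𝒱).lTensor (GSym 𝒱) := by
    ext; rfl
  rw [conv, this]; rfl

/-! ### The algebra of multilinear forms and the operator of a pair (t, γ) -/

section Forms

variable {R : Type*} [CommRing R] {A : Type*} [Ring A] [Algebra R A]
  {V : Type*} [AddCommGroup V] [Module R V] [Module A V] [IsScalarTower R A V]
  {𝒜 : ℤ → Submodule R A} [GradedAlgebra 𝒜] (𝒱 : ℤ → Submodule R V) [DirectSum.Decomposition 𝒱]

variable {𝒱} in
theorem IsMultilinear.apply {N : Type*} [AddCommGroup N] [Module R N] [Module A N] {q : ℤ}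
    {f : GSym 𝒱 →ₗ[R] N} (hf : IsMultilinear 𝒜 𝒱 q f) {i : ℤ} {a : A} (ha : a ∈ 𝒜 i) (v : V)
    (x : GSym 𝒱) :
    f (GSym.ι 𝒱 (a • v) * x) = ksgn R (q * i) • (a • f (GSym.ι 𝒱 v * x)) := by
  rw [hf i a ha v x, negOnePow_smul R]

/-- Multilinearity has to be checked on homogeneous elements only. -/
theorem IsMultilinear.of_homogeneous {N : Type*} [AddCommGroup N] [Module R N] [Module A N]
    [IsScalarTower R A N] {q : ℤ}
    {f : GSym 𝒱 →ₗ[R] N} (h : ∀ i, ∀ a ∈ 𝒜 i, ∀ k, ∀ v ∈ 𝒱 k, ∀ x,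
      f (GSym.ι 𝒱 (a • v) * x) = ksgn R (q * i) • (a • f (GSym.ι 𝒱 v * x))) :
    IsMultilinear 𝒜 𝒱 q f := by
  intro i a ha v x
  rw [negOnePow_smul R]
  induction v using DirectSum.Decomposition.inductionOn 𝒱 with
  | zero => simp
  | homogeneous v => exact h i a ha _ v v.2 x
  | add v w hv hw => simp only [smul_add, map_add, add_mul, hv, hw]

theorem derPiece_leibniz {k : ℤ} {D : Module.End R A} (hD : D ∈ derPiece 𝒜 k) {i : ℤ} {a : A}
    (ha : a ∈ 𝒜 i) (b : A) : D (a * b) = D a * b + ksgn R (k * i) • (a * D b) := by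
  rw [hD.2 i a ha b, negOnePow_smul R]

variable (hcomm : ∀ i j, ∀ a ∈ 𝒜 i, ∀ b ∈ 𝒜 j, a * b = ksgn R (i * j) • (b * a))
  (hsm : ∀ i j, ∀ a ∈ 𝒜 i, ∀ v ∈ 𝒱 j, a • v ∈ 𝒱 (i + j))

theorem formOne_mem : formOne 𝒱 ∈ symPiece 𝒜 𝒱 (0 : ℤ) := by
  refine ⟨fun i x hx => ?_, fun i a ha v x => ?_⟩
  · by_cases hi : i = 0
    · subst hi
      simp only [formOne, LinearMap.comp_apply, AlgHom.toLinearMap_apply, Algebra.linearMap_apply]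
      exact SetLike.algebraMap_mem_graded 𝒜 _
    · simp [formOne, GSym.counit_of_mem_deg 𝒱 hx hi]
  · simp [formOne]

theorem formOne_eq : formOne 𝒱 = (GSym.counit 𝒱).toLinearMap.smulRight (1 : A) := by
  ext x
  simp [formOne, Algebra.algebraMap_eq_smul_one]

theorem formMul_one_left (q : ℤ) (φ : GSym 𝒱 →ₗ[R] A) : formMul 𝒱 q (formOne 𝒱) φ = φ := by
  ext x
  rw [formMul_eq_conv, formOne_eq, conv_counit_left]
  simp

theorem formMul_assoc (q r : ℤ) (φ ψ χ : GSym 𝒱 →ₗ[R] A) :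
    formMul 𝒱 r (formMul 𝒱 q φ ψ) χ = formMul 𝒱 (q + r) φ (formMul 𝒱 r ψ χ) := by
  simp only [formMul_eq_conv]
  exact conv_assoc 𝒱 q r _ _ _ _ (fun a b c => mul_assoc a b c) φ ψ χ

include hcomm in
theorem formMul_comm {p q : ℤ} {φ ψ : GSym 𝒱 →ₗ[R] A} (hφ : φ ∈ symPiece 𝒜 𝒱 p)
    (hψ : ψ ∈ symPiece 𝒜 𝒱 q) :
    formMul 𝒱 q φ ψ = ksgn R (p * q) • formMul 𝒱 p ψ φ :=
  conv_swap 𝒱 (𝓜 := 𝒜) (𝓝 := 𝒜) hcomm hφ.1 hψ.1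

include hcomm hsm in
theorem formMul_mem {p q : ℤ} {φ ψ : GSym 𝒱 →ₗ[R] A} (hφ : φ ∈ symPiece 𝒜 𝒱 p)
    (hψ : ψ ∈ symPiece 𝒜 𝒱 q) : formMul 𝒱 q φ ψ ∈ symPiece 𝒜 𝒱 (p + q) := by
  refine ⟨fun i x hx => conv_mem 𝒱 (𝓜 := 𝒜) (𝓝 := 𝒜)
    (fun i j a ha b hb => SetLike.mul_mem_graded ha hb) q hφ.1 hψ.1 hx,
    IsMultilinear.of_homogeneous 𝒱 fun i a ha k v hv x => ?_⟩
  rw [formMul_eq_conv, conv_ι_mul 𝒱 _ _ _ _ (hsm i k a ha v hv), conv_ι_mul 𝒱 _ _ _ _ hv]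
  have h : TensorProduct.lift (LinearMap.mul R A) ∘ₗ
      TensorProduct.map (φ ∘ₗ sgn (GSym.deg 𝒱) q) ψ ∘ₗ GSym.comulMulLeft 𝒱 (i + k) (a • v) =
      ksgn R ((p + q) * i) • (LinearMap.mulLeft R a ∘ₗ TensorProduct.lift (LinearMap.mul R A) ∘ₗ
      TensorProduct.map (φ ∘ₗ sgn (GSym.deg 𝒱) q) ψ ∘ₗ GSym.comulMulLeft 𝒱 k v) := by
    refine tensor_homogeneous_ext (GSym.deg 𝒱) (GSym.deg 𝒱) fun m x hx n y hy => ?_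
    have hc := hcomm _ _ _ (hφ.1 m x hx) a ha
    have hc' : φ x * (a * ψ (GSym.ι 𝒱 v * y)) =
        ksgn R ((m + p) * i) • (a * (φ x * ψ (GSym.ι 𝒱 v * y))) := by
      rw [← mul_assoc, hc, smul_mul_assoc, mul_assoc]
    simp only [LinearMap.comp_apply, LinearMap.smul_apply, GSym.comulMulLeft_tmul, map_add,
      TensorProduct.map_tmul, TensorProduct.lift.tmul, sgn_of_mem (GSym.deg 𝒱) _ hx,
      GSym.sgn_ι_mul 𝒱 q hv, GSym.sgn_ι_mul 𝒱 q (hsm i k a ha v hv), map_smul, hφ.2.apply ha,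
      hψ.2.apply ha, smul_eq_mul, LinearMap.mul_apply', LinearMap.mulLeft_apply,
      mul_smul_comm, mul_assoc, hc', smul_smul, mul_smul_comm, smul_add, mul_add,
      LinearMap.smul_apply]
    match_scalars <;> simp only [mul_one, ← ksgn_add] <;> apply ksgn_congr <;>
      rw [Int.even_iff] <;> ring_nf <;> omega
  exact LinearMap.congr_fun h _

variable (𝒜) in
-- Since t(x₁) is a derivation, t(x₁)(φ(x₂) ψ(x₃)) is the sum of t(x₁)(φ(x₂)) ψ(x₃) and ± φ(x₂)
-- t(x₁)(ψ(x₃)). In the second term the arguments come in the order x₂, x₁, x₃, and cocommutativity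
-- restores the standard order.
theorem derPairing_formMul {p q : ℤ} {t : GSym 𝒱 →ₗ[R] Module.End R A}
    (ht : ∀ n, ∀ x ∈ GSym.deg 𝒱 n, t x ∈ derPiece 𝒜 (n - 1)) {φ : GSym 𝒱 →ₗ[R] A}
    (hφ : ∀ i, ∀ x ∈ GSym.deg 𝒱 i, φ x ∈ 𝒜 (i + p)) (ψ : GSym 𝒱 →ₗ[R] A) :
    derPairing 𝒱 (p + q) t (formMul 𝒱 q φ ψ) = formMul 𝒱 q (derPairing 𝒱 p t φ) ψ +
      ksgn R p • formMul 𝒱 (q - 1) φ (derPairing 𝒱 q t ψ) := by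
  -- The pairing D ⊗ (a ⊗ b) ↦ D(a) b lets [t, φ] ψ be regrouped with `t` as the outer factor.
  let B : Module.End R A →ₗ[R] A ⊗[R] A →ₗ[R] A := LinearMap.mk₂ R
    (fun D z => LinearMap.mul' R A (D.rTensor A z)) (by intros; simp [LinearMap.rTensor_add])
    (by intros; simp [LinearMap.rTensor_smul]) (by intros; simp) (by intros; simp)
  have h1 : formMul 𝒱 q (derPairing 𝒱 p t φ) ψ =
      conv 𝒱 (p + q) B t (conv 𝒱 q (TensorProduct.mk R A A) φ ψ) :=
    conv_assoc 𝒱 p q _ _ _ _ (fun D a b => by simp [B]) t φ ψ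
  -- `K₁`, `K₂`, `K₃` are the three terms of the Leibniz rule as maps on the threefold tensor
  -- product, to be evaluated on the iterated diagonal.
  let K₁ := TensorProduct.lift (LinearMap.id : Module.End R A →ₗ[R] A →ₗ[R] A) ∘ₗ
    TensorProduct.map (t ∘ₗ sgn (GSym.deg 𝒱) (p + q)) (TensorProduct.lift (LinearMap.mul R A) ∘ₗ
      TensorProduct.map (φ ∘ₗ sgn (GSym.deg 𝒱) q) ψ)
  let K₂ := TensorProduct.lift B ∘ₗ
    TensorProduct.map (t ∘ₗ sgn (GSym.deg 𝒱) (p + q))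
      (TensorProduct.lift (TensorProduct.mk R A A) ∘ₗ
        TensorProduct.map (φ ∘ₗ sgn (GSym.deg 𝒱) q) ψ)
  let K₃ := TensorProduct.lift (LinearMap.mul R A) ∘ₗ
    TensorProduct.map (φ ∘ₗ sgn (GSym.deg 𝒱) (q - 1))
      (TensorProduct.lift (LinearMap.id : Module.End R A →ₗ[R] A →ₗ[R] A) ∘ₗ
        TensorProduct.map (t ∘ₗ sgn (GSym.deg 𝒱) q) ψ)
  have hK : K₁ = K₂ + ksgn R p • (K₃ ∘ₗ GSym.swapLeft 𝒱) := by
    refine GSym.tensor₃_homogeneous_ext 𝒱 fun i x hx j y hy k z hz => ?_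
    simp only [K₁, K₂, K₃, B, LinearMap.comp_apply, LinearMap.add_apply, LinearMap.smul_apply,
      GSym.swapLeft_tmul 𝒱 hx hy, map_smul, TensorProduct.map_tmul, TensorProduct.lift.tmul,
      sgn_of_mem (GSym.deg 𝒱) _ hx, sgn_of_mem (GSym.deg 𝒱) _ hy, LinearMap.id_apply,
      LinearMap.mul_apply', LinearMap.mk₂_apply, TensorProduct.mk_apply, LinearMap.rTensor_tmul,
      LinearMap.mul'_apply, smul_smul,
      derPiece_leibniz (ht i x hx) (hφ j y hy), smul_add, ← TensorProduct.smul_tmul']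
    match_scalars <;> simp only [mul_one, ← ksgn_add] <;> apply ksgn_congr <;>
      rw [Int.even_iff] <;> ring_nf <;> omega
  let z := fun x => (GSym.comul 𝒱).lTensor (GSym 𝒱) (GSym.comul 𝒱 x)
  have a1 : ∀ x, derPairing 𝒱 (p + q) t (formMul 𝒱 q φ ψ) x = K₁ (z x) :=
    conv_comp_comul 𝒱 (p + q) LinearMap.id t (TensorProduct.lift (LinearMap.mul R A) ∘ₗ
      TensorProduct.map (φ ∘ₗ sgn (GSym.deg 𝒱) q) ψ)
  have a2 : ∀ x, conv 𝒱 (p + q) B t (conv 𝒱 q (TensorProduct.mk R A A) φ ψ) x = K₂ (z x) :=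
    conv_comp_comul 𝒱 (p + q) B t (TensorProduct.lift (TensorProduct.mk R A A) ∘ₗ
      TensorProduct.map (φ ∘ₗ sgn (GSym.deg 𝒱) q) ψ)
  have a3 : ∀ x, formMul 𝒱 (q - 1) φ (derPairing 𝒱 q t ψ) x = K₃ (z x) :=
    conv_comp_comul 𝒱 (q - 1) (LinearMap.mul R A) φ
      (TensorProduct.lift (LinearMap.id : Module.End R A →ₗ[R] A →ₗ[R] A) ∘ₗ
        TensorProduct.map (t ∘ₗ sgn (GSym.deg 𝒱) q) ψ)
  rw [h1]
  ext x
  have hx : K₁ (z x) = K₂ (z x) + ksgn R p • K₃ (GSym.swapLeft 𝒱 (z x)) :=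
    LinearMap.congr_fun hK (z x)
  rw [LinearMap.add_apply, LinearMap.smul_apply, a1, a2, a3, hx]
  exact congrArg (fun w => K₂ (z x) + ksgn R p • K₃ w) (GSym.swapLeft_comul 𝒱 x)

/-- The operator `φ ↦ [t, φ] + (-1) ^ (q + 1) φ γ` on forms `φ` of degree `q`. -/
def formOp (t : GSym 𝒱 →ₗ[R] Module.End R A) (γ : GSym 𝒱 →ₗ[R] GSym 𝒱) (q : ℤ)
    (φ : GSym 𝒱 →ₗ[R] A) : GSym 𝒱 →ₗ[R] A :=
  derPairing 𝒱 q t φ + ksgn R (q + 1) • (φ ∘ₗ γ)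

theorem formOp_add (t : GSym 𝒱 →ₗ[R] Module.End R A) (γ : GSym 𝒱 →ₗ[R] GSym 𝒱) (q : ℤ)
    (φ ψ : GSym 𝒱 →ₗ[R] A) :
    formOp 𝒱 t γ q (φ + ψ) = formOp 𝒱 t γ q φ + formOp 𝒱 t γ q ψ := by
  simp only [formOp, derPairing_eq_conv, conv_add_right, LinearMap.add_comp, smul_add]
  abel

theorem formOp_smul (t : GSym 𝒱 →ₗ[R] Module.End R A) (γ : GSym 𝒱 →ₗ[R] GSym 𝒱) (q : ℤ) (r : R)
    (φ : GSym 𝒱 →ₗ[R] A) : formOp 𝒱 t γ q (r • φ) = r • formOp 𝒱 t γ q φ := by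
  simp only [formOp, derPairing_eq_conv, conv_smul_right, LinearMap.smul_comp, smul_add,
    smul_comm r]

variable {t : GSym 𝒱 →ₗ[R] Module.End R A} {γ : GSym 𝒱 →ₗ[R] GSym 𝒱}

/-- Pairing with `t` is a derivation because `t` is derivation valued, and precomposition with `γ`
because `γ` is a coderivation; no relation between `t` and `γ` is involved. -/
theorem formOp_leibniz (ht : ∀ n, ∀ x ∈ GSym.deg 𝒱 n, t x ∈ derPiece 𝒜 (n - 1))
    (hγ : GSym.IsCoderivation 𝒱 γ) {p q : ℤ} {φ : GSym 𝒱 →ₗ[R] A}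
    (hφ : ∀ i, ∀ x ∈ GSym.deg 𝒱 i, φ x ∈ 𝒜 (i + p)) (ψ : GSym 𝒱 →ₗ[R] A) :
    formOp 𝒱 t γ (p + q) (formMul 𝒱 q φ ψ) = formMul 𝒱 q (formOp 𝒱 t γ p φ) ψ +
      ksgn R p • formMul 𝒱 (q - 1) φ (formOp 𝒱 t γ q ψ) := by
  simp only [formOp, derPairing_formMul 𝒜 𝒱 ht hφ ψ]
  simp only [formMul_eq_conv, conv_comp_coderivation 𝒱 q _ φ ψ hγ, conv_add_left, conv_add_right,
    conv_smul_left, conv_smul_right, smul_add, smul_smul]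
  match_scalars <;> simp only [mul_one, ← ksgn_add] <;> apply ksgn_congr <;>
      rw [Int.even_iff] <;> ring_nf <;> omega

/-- Of the four terms of the square, [t, [t, φ]] is the pairing of t ∪ t with φ. Expanding [t, φ] ∘
γ gives [t γ, φ] and a multiple of [t, φ γ] that cancels the remaining cross term. The square is
thus governed by two obstructions, the twisting defect and γγ. -/
theorem formOp_formOp (hγ : GSym.IsCoderivation 𝒱 γ) (q : ℤ) (φ : GSym 𝒱 →ₗ[R] A) :
    formOp 𝒱 t γ (q - 1) (formOp 𝒱 t γ q φ) =
      derPairing 𝒱 q (conv 𝒱 (-1) (LinearMap.mul R (Module.End R A)) t t + t ∘ₗ γ) φ -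
        φ ∘ₗ γ ∘ₗ γ := by
  have h : derPairing 𝒱 (q - 1) t (derPairing 𝒱 q t φ) =
      conv 𝒱 q LinearMap.id (conv 𝒱 (-1) (LinearMap.mul R (Module.End R A)) t t) φ := by
    rw [sub_eq_neg_add]
    exact (conv_assoc 𝒱 (-1) q _ _ _ _ (fun D D' a => rfl) t t φ).symm
  simp only [formOp]
  simp only [derPairing_eq_conv] at h ⊢
  simp only [conv_add_left, conv_add_right, conv_smul_right, h, LinearMap.add_comp,
    LinearMap.smul_comp, conv_comp_coderivation 𝒱 q _ t φ hγ, smul_add, smul_smul,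
    LinearMap.comp_assoc, ← ksgn_add]
  have e1 : ksgn R (q - 1 + 1 + q) = 1 := by
    rw [← ksgn_zero R]; exact ksgn_congr ⟨q, by ring⟩
  have e2 : ksgn R (q - 1 + 1 + (q + 1)) = -1 := by
    rw [← ksgn_one R]; exact ksgn_congr ⟨q, by ring⟩
  have e3 : ksgn R (q - 1 + 1) = - ksgn R (q + 1) := by
    rw [ksgn_add R q, sub_add_cancel, ksgn_one]; simp
  rw [e1, e2, e3]
  module

theorem formOp_mem_degree (ht : ∀ n, ∀ x ∈ GSym.deg 𝒱 n, t x ∈ derPiece 𝒜 (n - 1))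
    (hγ : GSym.IsCoderivation 𝒱 γ) {q : ℤ} {φ : GSym 𝒱 →ₗ[R] A}
    (hφ : ∀ i, ∀ x ∈ GSym.deg 𝒱 i, φ x ∈ 𝒜 (i + q)) {i : ℤ} {x : GSym 𝒱}
    (hx : x ∈ GSym.deg 𝒱 i) : formOp 𝒱 t γ q φ x ∈ 𝒜 (i + (q - 1)) := by
  rw [formOp, LinearMap.add_apply]
  refine add_mem ?_ (Submodule.smul_mem _ _ ?_)
  · have := conv_mem 𝒱 (𝓜 := derPiece 𝒜) (𝓝 := 𝒜) (𝓟 := 𝒜) (B := LinearMap.id) (p := -1) (q := q)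
      (fun i j D hD b hb => by rw [add_comm]; exact hD.1 j b hb) q (f := t)
      (fun i x hx => ht i x hx) hφ hx
    rwa [neg_add_eq_sub] at this
  · have := hφ _ _ (hγ.degree i x hx)
    rwa [show i - 1 + q = i + (q - 1) by ring] at this

include hsm in
-- With γ x = ∑ g(x₁) x₂ the operator involves only t(x)(φ(y)) and φ(g(x) y). When a v enters the y
-- of the first, the Leibniz rule leaves the unwanted term t(x)(a) φ(v y); when it enters the x of
-- the second, the anchor rule leaves φ(t(x)(a) v y), and these two cancel. The other terms are
-- multilinear one by one.
theorem formOp_multilinear [Algebra ℚ R]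
    (ht : ∀ n, ∀ x ∈ GSym.deg 𝒱 n, t x ∈ derPiece 𝒜 (n - 1))
    (hγ : GSym.IsCoderivation 𝒱 γ) (hmul : IsMultilinear 𝒜 𝒱 (-1) t)
    (hanchor : ∀ i, ∀ a ∈ 𝒜 i, ∀ k, ∀ v ∈ 𝒱 k, ∀ n, ∀ x ∈ GSym.deg 𝒱 n,
      GSym.projV 𝒱 (γ (GSym.ι 𝒱 (a • v) * x)) = ksgn R (n * (i + k)) • (t x a • v) +
        ksgn R i • (a • GSym.projV 𝒱 (γ (GSym.ι 𝒱 v * x))))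
    {q : ℤ} {φ : GSym 𝒱 →ₗ[R] A} (hφ : IsMultilinear 𝒜 𝒱 q φ) :
    IsMultilinear 𝒜 𝒱 (q - 1) (formOp 𝒱 t γ q φ) := by
  refine IsMultilinear.of_homogeneous 𝒱 fun i a ha k v hv x => ?_
  set g := GSym.projV 𝒱 ∘ₗ γ with hg
  have hgdeg : ∀ n, ∀ x ∈ GSym.deg 𝒱 n, g x ∈ 𝒱 (n - 1) := fun n x hx =>
    GSym.projV_mem 𝒱 (hγ.degree n x hx)
  have hganchor : ∀ n, ∀ x ∈ GSym.deg 𝒱 n, g (GSym.ι 𝒱 (a • v) * x) =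
      ksgn R (n * (i + k)) • (t x a • v) + ksgn R i • (a • g (GSym.ι 𝒱 v * x)) :=
    fun n x hx => hanchor i a ha k v hv n x hx
  have hav := hsm i k a ha v hv
  have hγ' : γ = LinearMap.mul' R _ ∘ₗ TensorProduct.map (GSym.ι 𝒱 ∘ₗ g) LinearMap.id ∘ₗ
    GSym.comul 𝒱 := hγ.eq_cofreeCoderivation
  let H := TensorProduct.lift (LinearMap.id : Module.End R A →ₗ[R] A →ₗ[R] A) ∘ₗ
      TensorProduct.map (t ∘ₗ sgn (GSym.deg 𝒱) q) φ + ksgn R (q + 1) •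
      (φ ∘ₗ LinearMap.mul' R _ ∘ₗ TensorProduct.map (GSym.ι 𝒱 ∘ₗ g) LinearMap.id)
  have hop : ∀ y, formOp 𝒱 t γ q φ y = H (GSym.comul 𝒱 y) := by
    intro y
    rw [formOp, LinearMap.add_apply, LinearMap.smul_apply, LinearMap.comp_apply, hγ']
    rfl
  rw [hop, hop, GSym.comul_ι_mul 𝒱 hav, GSym.comul_ι_mul 𝒱 hv]
  have key : H ∘ₗ GSym.comulMulLeft 𝒱 (i + k) (a • v) =
      ksgn R ((q - 1) * i) • (LinearMap.mulLeft R a ∘ₗ H ∘ₗ GSym.comulMulLeft 𝒱 k v) := by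
    refine tensor_homogeneous_ext (GSym.deg 𝒱) (GSym.deg 𝒱) fun m x hx n y hy => ?_
    have hta : t x a ∈ 𝒜 (i + (m - 1)) := (ht m x hx).1 i a ha
    have e1 : ∀ (j : ℤ) (w : V), w ∈ 𝒱 j → φ (GSym.ι 𝒱 (g x) * (GSym.ι 𝒱 w * y)) =
        ksgn R ((m - 1) * j) • φ (GSym.ι 𝒱 w * (GSym.ι 𝒱 (g x) * y)) := by
      intro j w hw
      rw [← mul_assoc, GSym.ι_mul_ι_ksgn 𝒱 (hgdeg m x hx) hw, smul_mul_assoc, map_smul, mul_assoc]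
    simp only [H, LinearMap.comp_apply, LinearMap.add_apply, LinearMap.smul_apply,
      GSym.comulMulLeft_tmul, map_add, TensorProduct.map_tmul, TensorProduct.lift.tmul,
      LinearMap.id_apply, GSym.sgn_ι_mul 𝒱 _ hv, GSym.sgn_ι_mul 𝒱 _ hav,
      sgn_of_mem (GSym.deg 𝒱) _ hx, map_smul, hmul.apply ha, hφ.apply ha, smul_eq_mul,
      derPiece_leibniz (ht m x hx) ha, LinearMap.mul'_apply, hganchor m x hx, smul_mul_assoc,
      add_mul, e1 _ _ hav, e1 _ _ hv, hφ.apply hta, LinearMap.mulLeft_apply, mul_add,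
      mul_smul_comm, smul_add, smul_smul]
    -- One coefficient is that of t(x)(a) φ(v y), where two opposite signs must cancel; the others
    -- compare equal signs.
    match_scalars <;> simp only [mul_one, ← ksgn_add] <;>
      first
      | apply ksgn_congr
        rw [Int.even_iff]
        ring_nf
        omega
      | apply ksgn_add_eq_zero
        rw [Int.not_even_iff]
        ring_nf
        omega
  exact LinearMap.congr_fun key _

end Forms

/-! ### Sums of constituents and squares of coderivations -/

namespace GSym

variable {R : Type*} [CommRing R] {V : Type*} [AddCommGroup V] [Module R V]
  (𝒱 : ℤ → Submodule R V) [DirectSum.Decomposition 𝒱]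

theorem eq_zero_on_coaugFiltration {M : Type*} [AddCommGroup M] [Module R M]
    {f : GSym 𝒱 →ₗ[R] M} {n : ℕ} (h : ∀ m ≤ n, ∀ x ∈ wt 𝒱 m, f x = 0) {x : GSym 𝒱}
    (hx : x ∈ coaugFiltration 𝒱 n) : f x = 0 := by
  have : coaugFiltration 𝒱 n ≤ LinearMap.ker f := iSup₂_le fun m hm y hy => h m hm y hy
  exact this hx

theorem sum_lowerPart {γ : GSym 𝒱 →ₗ[R] GSym 𝒱}
    (hfil : ∀ n, ∀ x ∈ coaugFiltration 𝒱 n, γ x ∈ coaugFiltration 𝒱 n) {m N : ℕ} (hN : m < N)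
    {x : GSym 𝒱} (hx : x ∈ wt 𝒱 m) : ∑ j ∈ Finset.range N, lowerPart 𝒱 j γ x = γ x := by
  -- Constituents with j > m vanish on Sᵐ. The shape `m + 1 - 1 - j` is the one
  -- `Finset.sum_range_reflect` works with.
  have h1 : ∑ j ∈ Finset.range N, lowerPart 𝒱 j γ x =
      ∑ j ∈ Finset.range (m + 1), projWt 𝒱 (m + 1 - 1 - j) (γ x) := by
    symm
    refine Finset.sum_subset_zero_on_sdiff (fun j hj => ?_) (fun j hj => ?_) (fun j hj => ?_)
    · simp only [Finset.mem_range] at hj ⊢; omega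
    · simp only [Finset.mem_sdiff, Finset.mem_range] at hj
      rw [lowerPart_of_mem 𝒱 j γ hx, if_neg (by omega)]
    · simp only [Finset.mem_range] at hj
      rw [lowerPart_of_mem 𝒱 j γ hx, if_pos (by omega), Nat.add_sub_cancel]
  rw [h1, Finset.sum_range_reflect (fun i => projWt 𝒱 i (γ x))]
  exact sum_projWt 𝒱 (hfil m x (wt_le_coaugFiltration 𝒱 le_rfl hx)) m.lt_succ_self

/-- The mixed terms in the square of γ ⊗ 1 + 1 ⊗ γ cancel because γ is odd, so γγ is again a
coderivation, now of even degree. -/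
theorem comul_comp_sq {γ : GSym 𝒱 →ₗ[R] GSym 𝒱} (hγ : IsCoderivation 𝒱 γ) :
    comul 𝒱 ∘ₗ (γ ∘ₗ γ) = (TensorProduct.map (γ ∘ₗ γ) LinearMap.id +
      TensorProduct.map (sgn (deg 𝒱) 2) (γ ∘ₗ γ)) ∘ₗ comul 𝒱 := by
  have h : (TensorProduct.map γ LinearMap.id + TensorProduct.map (sgn (deg 𝒱) 1) γ) ∘ₗ
      (TensorProduct.map γ LinearMap.id + TensorProduct.map (sgn (deg 𝒱) 1) γ) =
      TensorProduct.map (γ ∘ₗ γ) LinearMap.id +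
        TensorProduct.map (sgn (deg 𝒱) 2) (γ ∘ₗ γ) := by
    refine tensor_homogeneous_ext (deg 𝒱) (deg 𝒱) fun m x hx n y hy => ?_
    simp only [LinearMap.comp_apply, LinearMap.add_apply, TensorProduct.map_tmul, map_add,
      LinearMap.id_apply, sgn_of_mem (deg 𝒱) _ hx, sgn_of_mem (deg 𝒱) _ (hγ.degree m x hx),
      ← TensorProduct.smul_tmul', map_smul]
    match_scalars <;> simp only [mul_one, ← ksgn_add]
    · apply ksgn_add_eq_zero
      rw [Int.not_even_iff]
      ring_nf
      omega
    · apply ksgn_congr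
      rw [Int.even_iff]
      ring_nf
      rfl
  ext x
  have h1 := LinearMap.congr_fun hγ.comul_comp (γ x)
  have h2 := LinearMap.congr_fun hγ.comul_comp x
  have h3 := LinearMap.congr_fun h (comul 𝒱 x)
  rw [LinearMap.comp_apply, LinearMap.comp_apply] at h1 h2
  rw [LinearMap.comp_apply, LinearMap.comp_apply, h1, h2]
  exact h3

theorem sgn_involutive (q : ℤ) (x : GSym 𝒱) : sgn (deg 𝒱) q (sgn (deg 𝒱) q x) = x := by
  have : sgn (deg 𝒱) q ∘ₗ sgn (deg 𝒱) q = LinearMap.id := by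
    refine homogeneous_ext (deg 𝒱) fun i x hx => ?_
    rw [LinearMap.comp_apply, sgn_of_mem (deg 𝒱) q hx, map_smul, sgn_of_mem (deg 𝒱) q hx, smul_smul,
      ksgn_sq, one_smul, LinearMap.id_apply]
  exact LinearMap.congr_fun this x

end GSym

/-! ### Filtration, convergence and the multi derivation chain algebra -/

section Forms

variable {R : Type*} [CommRing R] {A : Type*} [Ring A] [Algebra R A]
  {V : Type*} [AddCommGroup V] [Module R V] [Module A V] [IsScalarTower R A V]
  {𝒜 : ℤ → Submodule R A} [GradedAlgebra 𝒜] (𝒱 : ℤ → Submodule R V) [DirectSum.Decomposition 𝒱]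

/-- The constituent of the operator `formOp 𝒱 t γ` which raises the filtration by `j`. -/
def formOpPart (t : GSym 𝒱 →ₗ[R] Module.End R A) (γ : GSym 𝒱 →ₗ[R] GSym 𝒱) (j : ℕ) (q : ℤ)
    (φ : GSym 𝒱 →ₗ[R] A) : GSym 𝒱 →ₗ[R] A :=
  formOp 𝒱 (t ∘ₗ GSym.projWt 𝒱 j) (GSym.lowerPart 𝒱 j γ) q φ

variable {t : GSym 𝒱 →ₗ[R] Module.End R A} {γ : GSym 𝒱 →ₗ[R] GSym 𝒱}

theorem formOp_zero (q : ℤ) : formOp 𝒱 t γ q (0 : GSym 𝒱 →ₗ[R] A) = 0 := by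
  simpa only [zero_smul] using formOp_smul 𝒱 t γ q (0 : R) (0 : GSym 𝒱 →ₗ[R] A)

/-- tⱼ consumes j factors and ∂ʲ lowers the weight by j, so on Sᵐ the j-th constituent sees only the
restriction of φ to Sᵐ⁻ʲ. The filtration shift and its sharpness both rest on this. -/
theorem formOpPart_apply_wt (j : ℕ) (q : ℤ) (φ : GSym 𝒱 →ₗ[R] A) {m : ℕ} {x : GSym 𝒱}
    (hx : x ∈ GSym.wt 𝒱 m) : formOpPart 𝒱 t γ j q φ x =
      if j ≤ m then formOpPart 𝒱 t γ j q (φ ∘ₗ GSym.projWt 𝒱 (m - j)) x else 0 := by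
  have hz := GSym.comul_mem 𝒱 (fun _ => (1 : ℕ)) hx
  simp only [formOpPart, formOp, LinearMap.add_apply, LinearMap.smul_apply, LinearMap.comp_apply,
    derPairing_eq_conv, conv]
  split_ifs with hj
  · congr 2
    · refine GSym.eq_on_tensorPiece 𝒱 (fun _ => 1) (f := TensorProduct.map _ _)
        (g := TensorProduct.map _ _) (fun k l hkl x hx y hy => ?_) hz
      simp only [LinearMap.comp_apply, TensorProduct.map_tmul]
      by_cases hk : k = j
      · rw [GSym.projWt_of_mem 𝒱 (n := m - j) (x := y)]
        rwa [← hkl, hk, Nat.add_sub_cancel_left]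
      · rw [GSym.projWt_of_mem_ne 𝒱 (GSym.sgn_mem_piece 𝒱 _ q hx) hk]
        simp
    · rw [GSym.lowerPart_of_mem 𝒱 j γ hx, if_pos hj,
        GSym.projWt_of_mem 𝒱 (GSym.projWt_mem 𝒱 _ _)]
  · rw [GSym.lowerPart_of_mem 𝒱 j γ hx, if_neg hj, map_zero, smul_zero, add_zero,
      ← LinearMap.comp_apply]
    refine GSym.eq_on_tensorPiece 𝒱 _ (g := 0) (fun k l hkl x hx y hy => ?_) hz
    simp only [LinearMap.comp_apply, TensorProduct.map_tmul, TensorProduct.lift.tmul]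
    rw [GSym.projWt_of_mem_ne 𝒱 (GSym.sgn_mem_piece 𝒱 _ q hx) (by omega)]
    simp

theorem formOpPart_eq_zero {j l : ℕ} {q : ℤ} {φ : GSym 𝒱 →ₗ[R] A}
    (hφ : ∀ m < l, ∀ x ∈ GSym.coaugFiltration 𝒱 m, φ x = 0) {m : ℕ} (hm : m < l + j)
    {x : GSym 𝒱} (hx : x ∈ GSym.coaugFiltration 𝒱 m) : formOpPart 𝒱 t γ j q φ x = 0 := by
  refine GSym.eq_zero_on_coaugFiltration 𝒱 (fun k hk x hx => ?_) hx
  rw [formOpPart_apply_wt 𝒱 j q φ hx]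
  split_ifs with hj
  · have h0 : φ ∘ₗ GSym.projWt 𝒱 (k - j) = 0 := by
      ext y
      exact hφ (k - j) (by omega) _
        (GSym.wt_le_coaugFiltration 𝒱 le_rfl (GSym.projWt_mem 𝒱 _ y))
    rw [h0, formOpPart, formOp_zero, LinearMap.zero_apply]
  · rfl

/-- On Cₙ the constituents with j > n vanish, so the series is pointwise a finite sum with a bound
independent of φ. -/
theorem formOp_apply_eq_sum
    (hfil : ∀ n, ∀ x ∈ GSym.coaugFiltration 𝒱 n, γ x ∈ GSym.coaugFiltration 𝒱 n) (q : ℤ)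
    (φ : GSym 𝒱 →ₗ[R] A) {n N : ℕ} (hN : n < N) {x : GSym 𝒱}
    (hx : x ∈ GSym.coaugFiltration 𝒱 n) :
    formOp 𝒱 t γ q φ x = ∑ j ∈ Finset.range N, formOpPart 𝒱 t γ j q φ x := by
  rw [← sub_eq_zero, ← LinearMap.sum_apply, ← LinearMap.sub_apply]
  refine GSym.eq_zero_on_coaugFiltration 𝒱 (fun m hm x hx => ?_) hx
  have hz := GSym.comul_mem 𝒱 (fun _ => (1 : ℕ)) hx
  rw [LinearMap.sub_apply, sub_eq_zero, LinearMap.sum_apply]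
  simp only [formOpPart, formOp, LinearMap.add_apply, LinearMap.smul_apply, LinearMap.comp_apply,
    derPairing_eq_conv, conv, Finset.sum_add_distrib, ← Finset.smul_sum, ← map_sum]
  rw [GSym.sum_lowerPart 𝒱 hfil (by omega : m < N) hx]
  congr 1
  have : ∑ j ∈ Finset.range N, TensorProduct.lift (LinearMap.id : Module.End R A →ₗ[R] A →ₗ[R] A)
      (TensorProduct.map ((t ∘ₗ GSym.projWt 𝒱 j) ∘ₗ sgn (GSym.deg 𝒱) q) φ (GSym.comul 𝒱 x)) =
      (∑ j ∈ Finset.range N, TensorProduct.lift (LinearMap.id : Module.End R A →ₗ[R] A →ₗ[R] A) ∘ₗ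
      TensorProduct.map ((t ∘ₗ GSym.projWt 𝒱 j) ∘ₗ sgn (GSym.deg 𝒱) q) φ) (GSym.comul 𝒱 x) := by
    rw [LinearMap.sum_apply]; rfl
  rw [map_sum, this, ← LinearMap.comp_apply]
  refine GSym.eq_on_tensorPiece 𝒱 _ (fun k l hkl x hx y hy => ?_) hz
  have hsx := GSym.sgn_mem_piece 𝒱 (fun _ => (1 : ℕ)) q hx
  have hs := GSym.sum_projWt 𝒱 (GSym.wt_le_coaugFiltration 𝒱 le_rfl hsx) (by omega : k < N)
  simp only [LinearMap.comp_apply, TensorProduct.map_tmul, TensorProduct.lift.tmul,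
    LinearMap.sum_apply, LinearMap.id_apply]
  conv_lhs => rw [← hs]
  rw [map_sum, LinearMap.sum_apply]

/-- Restricting a form to one symmetric power keeps it multilinear, since multiplication by v merely
shifts the projections. These forms show that the filtration shift by j is sharp. -/
theorem comp_projWt_mem_symFiltration {q : ℤ} {φ : GSym 𝒱 →ₗ[R] A} (hφ : φ ∈ symPiece 𝒜 𝒱 q)
    (m : ℕ) : φ ∘ₗ GSym.projWt 𝒱 m ∈ symFiltration 𝒜 𝒱 m q := by
  refine ⟨⟨fun i x hx => hφ.1 i _ (GSym.projWt_mem_deg 𝒱 m hx),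
    fun i a ha v x => ?_⟩, fun k hk x hx => ?_⟩
  · simp only [LinearMap.comp_apply]
    rcases m with _ | m
    · simp [GSym.projWt_zero_ι_mul]
    · rw [GSym.projWt_succ_ι_mul, GSym.projWt_succ_ι_mul, hφ.2 i a ha]
  · rw [LinearMap.comp_apply, (GSym.mem_coaugFiltration 𝒱).1 hx m hk, map_zero]

/-- Every element lies in some Cₙ, and a compatible sequence is eventually constant there; the limit
is taken pointwise. -/
theorem isCompleteFiltration_symFiltration :
    IsCompleteFiltration (symPiece 𝒜 𝒱) (symFiltration 𝒜 𝒱) := by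
  intro q u hu hsucc
  have hstep : ∀ m, ∀ x ∈ GSym.coaugFiltration 𝒱 m, ∀ k, u (m + 1 + k) x = u (m + 1) x := by
    intro m x hx k
    induction k with
    | zero => rfl
    | succ k ih =>
      have := (hsucc (m + 1 + k)).2 m (by omega) x hx
      rw [LinearMap.sub_apply, sub_eq_zero] at this
      rw [← add_assoc, this, ih]
  -- By `hstep` the sequence is constant on C_m from index m + 1 on, because the l-th filtration
  -- constituent vanishes only on C_{l-1}; hence the value `u (m + 1)` on Sᵐ.
  let φ : GSym 𝒱 →ₗ[R] A := DirectSum.toModule R ℕ A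
    (fun m => u (m + 1) ∘ₗ (GSym.wt 𝒱 m).subtype) ∘ₗ
      (DirectSum.decomposeLinearEquiv (GSym.wt 𝒱)).toLinearMap
  have hwt : ∀ m, ∀ x ∈ GSym.wt 𝒱 m, φ x = u (m + 1) x := by
    intro m x hx
    simp only [φ, LinearMap.comp_apply, LinearEquiv.coe_coe,
      DirectSum.decomposeLinearEquiv_apply]
    rw [DirectSum.decompose_of_mem (GSym.wt 𝒱) hx, ← DirectSum.lof_eq_of R,
      DirectSum.toModule_lof]
    rfl
  have hco : ∀ n, ∀ x ∈ GSym.coaugFiltration 𝒱 n, ∀ N, n < N → φ x = u N x := by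
    intro n x hx N hN
    rw [← sub_eq_zero, ← LinearMap.sub_apply]
    refine GSym.eq_zero_on_coaugFiltration 𝒱 (fun m hm y hy => ?_) hx
    obtain ⟨k, rfl⟩ := Nat.exists_eq_add_of_lt (by omega : m < N)
    rw [LinearMap.sub_apply, hwt m y hy, add_right_comm,
      hstep m y (GSym.wt_le_coaugFiltration 𝒱 le_rfl hy) k, sub_self]
  have hmem : φ ∈ symPiece 𝒜 𝒱 q := by
    refine ⟨fun i x hx => ?_, fun i a ha v x => ?_⟩
    · obtain ⟨n, hn⟩ := GSym.exists_mem_coaugFiltration 𝒱 x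
      rw [hco n x hn _ n.lt_succ_self]
      exact (hu _).1 i x hx
    · obtain ⟨n, hn⟩ := GSym.exists_mem_coaugFiltration 𝒱 (GSym.ι 𝒱 (a • v) * x)
      obtain ⟨m, hm⟩ := GSym.exists_mem_coaugFiltration 𝒱 (GSym.ι 𝒱 v * x)
      rw [hco n _ hn (n + m + 1) (by omega), hco m _ hm (n + m + 1) (by omega),
        (hu _).2 i a ha]
  refine ⟨φ, ⟨hmem, fun l => ⟨sub_mem hmem (hu l), fun m hm x hx => ?_⟩⟩, ?_⟩
  · rw [LinearMap.sub_apply, hco m x hx l hm, sub_self]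
  · rintro ψ ⟨-, hψ⟩
    ext x
    obtain ⟨n, hn⟩ := GSym.exists_mem_coaugFiltration 𝒱 x
    have := (hψ (n + 1)).2 n n.lt_succ_self x hn
    rw [LinearMap.sub_apply, sub_eq_zero] at this
    rw [this, hco n x hn _ n.lt_succ_self]

/-- The sum of the constituents of `formOp 𝒱 t γ`, in either sense, is `formOp 𝒱 t γ`. -/
theorem eq_formOp_of_isSumOf
    (hfil : ∀ n, ∀ x ∈ GSym.coaugFiltration 𝒱 n, γ x ∈ GSym.coaugFiltration 𝒱 n)
    {T : ℤ → (GSym 𝒱 →ₗ[R] A) → (GSym 𝒱 →ₗ[R] A)}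
    (hT : IsSumOf (symPiece 𝒜 𝒱) (symFiltration 𝒜 𝒱) (formOpPart 𝒱 t γ) T) {q : ℤ}
    {φ : GSym 𝒱 →ₗ[R] A} (hφ : φ ∈ symPiece 𝒜 𝒱 q) : T q φ = formOp 𝒱 t γ q φ := by
  ext x
  obtain ⟨n, hn⟩ := GSym.exists_mem_coaugFiltration 𝒱 x
  rcases hT with hT | ⟨-, hT⟩
  · obtain ⟨hfin, hsum⟩ := hT q φ hφ
    obtain ⟨N, hN⟩ := hfin.bddAbove
    -- The cutoff N + n + 1 exceeds both the last non-zero term and the filtration level of `x`.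
    have hsub : Function.support (fun j => formOpPart 𝒱 t γ j q φ) ⊆
        (Finset.range (N + n + 1) : Set ℕ) := by
      intro j hj
      have : j ≤ N := hN hj
      simp only [Finset.coe_range, Set.mem_Iio]
      omega
    rw [hsum, finsum_eq_sum_of_support_subset _ hsub, LinearMap.sum_apply,
      formOp_apply_eq_sum 𝒱 hfil q φ (by omega : n < N + n + 1) hn]
  · obtain ⟨N, hN⟩ := hT q φ hφ (n + 1)
    have h := (hN (N + n + 1) (by omega)).2 n n.lt_succ_self x hn
    rw [LinearMap.sub_apply, sub_eq_zero, LinearMap.sum_apply,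
      ← formOp_apply_eq_sum 𝒱 hfil q φ (by omega : n < N + n + 1) hn] at h
    exact h

variable (hcomm : ∀ i j, ∀ a ∈ 𝒜 i, ∀ b ∈ 𝒜 j, a * b = ksgn R (i * j) • (b * a))
  (hsm : ∀ i j, ∀ a ∈ 𝒜 i, ∀ v ∈ 𝒱 j, a • v ∈ 𝒱 (i + j))

include hcomm hsm in
theorem isGradedCommAlgebra_symPiece :
    IsGradedCommAlgebra (symPiece 𝒜 𝒱) (fun _ q => formMul 𝒱 q) (formOne 𝒱) where
  one_mem := formOne_mem 𝒱
  mul_mem p q x hx y hy := formMul_mem 𝒱 hcomm hsm hx hy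
  add_mul p q x _ x' _ y _ := conv_add_left 𝒱 q _ x x' y
  smul_mul r p q x _ y _ := conv_smul_left 𝒱 q _ r x y
  one_mul q x _ := formMul_one_left 𝒱 q x
  mul_assoc p q r x _ y _ z _ := formMul_assoc 𝒱 q r x y z
  mul_comm p q x hx y hy := by rw [negOnePow_smul R]; exact formMul_comm 𝒱 hcomm hx hy

theorem isGradedDerivation_formOp (ht : ∀ n, ∀ x ∈ GSym.deg 𝒱 n, t x ∈ derPiece 𝒜 (n - 1))
    (hγ : GSym.IsCoderivation 𝒱 γ)
    (hdeg : ∀ q, ∀ φ ∈ symPiece 𝒜 𝒱 q, formOp 𝒱 t γ q φ ∈ symPiece 𝒜 𝒱 (q - 1)) :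
    IsGradedDerivation (symPiece 𝒜 𝒱) (fun _ q => formMul 𝒱 q) (formOp 𝒱 t γ) where
  degree := hdeg
  map_add q φ _ ψ _ := formOp_add 𝒱 t γ q φ ψ
  map_smul r q φ _ := formOp_smul 𝒱 t γ q r φ
  leibniz p q φ hφ ψ _ := by
    rw [negOnePow_smul R]; exact formOp_leibniz 𝒱 ht hγ hφ.1 ψ

include hcomm hsm in
-- Each constituent is itself the operator of a pair, namely of the j-th parts of `t` and `γ`, and
-- such a pair inherits the coderivation property, multilinearity and the anchor rule. The same
-- lemmas thus apply to every constituent and to the sum.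
theorem isMultiDerivationChainAlgebra_formOpPart [Algebra ℚ R]
    (ht : ∀ n, ∀ x ∈ GSym.deg 𝒱 n, t x ∈ derPiece 𝒜 (n - 1))
    (hγ : GSym.IsCoderivation 𝒱 γ)
    (hfil : ∀ n, ∀ x ∈ GSym.coaugFiltration 𝒱 n, γ x ∈ GSym.coaugFiltration 𝒱 n)
    (hmul : IsMultilinear 𝒜 𝒱 (-1) t)
    (hanchor : ∀ i, ∀ a ∈ 𝒜 i, ∀ k, ∀ v ∈ 𝒱 k, ∀ n, ∀ x ∈ GSym.deg 𝒱 n,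
      GSym.projV 𝒱 (γ (GSym.ι 𝒱 (a • v) * x)) = ksgn R (n * (i + k)) • (t x a • v) +
        ksgn R i • (a • GSym.projV 𝒱 (γ (GSym.ι 𝒱 v * x))))
    (hsq : ∀ q φ, formOpPart 𝒱 t γ 0 (q - 1) (formOpPart 𝒱 t γ 0 q φ) = 0)
    (htwist : conv 𝒱 (-1) (LinearMap.mul R (Module.End R A)) t t + t ∘ₗ γ = 0)
    (hγγ : γ ∘ₗ γ = 0) :
    IsMultiDerivationChainAlgebra (symPiece 𝒜 𝒱) (fun _ q => formMul 𝒱 q) (formOne 𝒱)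
      (symFiltration 𝒜 𝒱) (formOpPart 𝒱 t γ) := by
  have htj : ∀ j n, ∀ x ∈ GSym.deg 𝒱 n, (t ∘ₗ GSym.projWt 𝒱 j) x ∈ derPiece 𝒜 (n - 1) :=
    fun j n x hx => ht n _ (GSym.projWt_mem_deg 𝒱 j hx)
  have hγj : ∀ j, GSym.IsCoderivation 𝒱 (GSym.lowerPart 𝒱 j γ) :=
    fun j => GSym.isCoderivation_lowerPart 𝒱 j hγ
  have hmulj : ∀ j, IsMultilinear 𝒜 𝒱 (-1) (t ∘ₗ GSym.projWt 𝒱 j) := by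
    intro j i a ha v x
    simp only [LinearMap.comp_apply]
    rcases j with _ | j
    · simp [GSym.projWt_zero_ι_mul]
    · rw [GSym.projWt_succ_ι_mul, GSym.projWt_succ_ι_mul, hmul i a ha]
  -- The V-component of the j-th part lives on Sʲ⁺¹; so its anchor rule at `x` is the rule for γ at
  -- the component of `x` in Sʲ.
  have hpj : ∀ j w x, GSym.projV 𝒱 (GSym.lowerPart 𝒱 j γ (GSym.ι 𝒱 w * x)) =
      GSym.projV 𝒱 (γ (GSym.ι 𝒱 w * GSym.projWt 𝒱 j x)) := by
    intro j w x
    rw [← GSym.projV_projWt_one, GSym.projWt_lowerPart, GSym.projV_projWt_one, add_comm,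
      GSym.projWt_succ_ι_mul]
  have hop : ∀ j q, ∀ φ ∈ symPiece 𝒜 𝒱 q, formOpPart 𝒱 t γ j q φ ∈ symPiece 𝒜 𝒱 (q - 1) := by
    intro j q φ hφ
    refine ⟨fun i x hx => formOp_mem_degree 𝒱 (htj j) (hγj j) hφ.1 hx,
      formOp_multilinear 𝒱 hsm (htj j) (hγj j) (hmulj j) ?_ hφ.2⟩
    intro i a ha k v hv n x hx
    rw [hpj, hpj, hanchor i a ha k v hv n _ (GSym.projWt_mem_deg 𝒱 j hx)]
    rfl
  have hopT : ∀ q, ∀ φ ∈ symPiece 𝒜 𝒱 q, formOp 𝒱 t γ q φ ∈ symPiece 𝒜 𝒱 (q - 1) :=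
    fun q φ hφ => ⟨fun i x hx => formOp_mem_degree 𝒱 ht hγ hφ.1 hx,
      formOp_multilinear 𝒱 hsm ht hγ hmul hanchor hφ.2⟩
  refine ⟨isGradedCommAlgebra_symPiece 𝒱 hcomm hsm, ?_, ?_,
    fun j => isGradedDerivation_formOp 𝒱 (htj j) (hγj j) (hop j), fun q φ _ => hsq q φ, ?_, ?_,
    formOp 𝒱 t γ, Or.inr ⟨isCompleteFiltration_symFiltration 𝒱, ?_⟩,
    isGradedDerivation_formOp 𝒱 ht hγ hopT, ?_⟩
  · intro q
    ext φ
    exact ⟨fun h => h.1, fun h => ⟨h, fun m hm => absurd hm (by omega)⟩⟩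
  · exact fun l q φ h => ⟨h.1, fun m hm => h.2 m (by omega)⟩
  · exact fun j l q φ h => ⟨hop j q φ h.1, fun m hm x hx => formOpPart_eq_zero 𝒱 h.2 hm hx⟩
  -- On Sᵐ the value on φ equals the value on the part of φ on Sᵐ⁻ʲ, which has filtration m − j. A
  -- shift by j + 1 would make it vanish on C_m, for every m.
  · rintro j - ⟨q, φ, hφ, hne⟩ hlow
    refine hne (GSym.wt_ext 𝒱 fun m x hx => ?_)
    rw [formOpPart_apply_wt 𝒱 j q φ hx, LinearMap.zero_apply]
    split_ifs with hj
    · exact (hlow (m - j) q _ (comp_projWt_mem_symFiltration 𝒱 hφ (m - j))).2 m (by omega) x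
        (GSym.wt_le_coaugFiltration 𝒱 le_rfl hx)
    · rfl
  -- Once N ≥ l, the partial sum agrees with the full operator on each C_m with m < l.
  · refine fun q φ hφ l => ⟨l, fun N hN => ⟨sub_mem (hopT q φ hφ)
      (sum_mem fun j _ => hop j q φ hφ), fun m hm x hx => ?_⟩⟩
    rw [LinearMap.sub_apply, LinearMap.sum_apply,
      formOp_apply_eq_sum 𝒱 hfil q φ (by omega : m < N) hx, sub_self]
  · intro q φ _
    rw [formOp_formOp 𝒱 hγ, htwist, hγγ, LinearMap.comp_zero, sub_zero]
    ext x
    simp [derPairing]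

end Forms

/-! ### Recovering the structure by evaluating the operator on test forms -/

section Forms

variable {R : Type*} [CommRing R] {V : Type*} [AddCommGroup V] [Module R V]
  (𝒱 : ℤ → Submodule R V) [DirectSum.Decomposition 𝒱]

theorem conv_ι_mul_eq_add {M N P : Type*} [AddCommGroup M] [Module R M] [AddCommGroup N]
    [Module R N] [AddCommGroup P] [Module R P] (q : ℤ) (B : M →ₗ[R] N →ₗ[R] P)
    (f : GSym 𝒱 →ₗ[R] M) (g : GSym 𝒱 →ₗ[R] N) {k : ℤ} {v : V} (hv : v ∈ 𝒱 k) (x : GSym 𝒱) :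
    conv 𝒱 q B f g (GSym.ι 𝒱 v * x) =
      ksgn R (q * k) • conv 𝒱 q B (f ∘ₗ LinearMap.mulLeft R (GSym.ι 𝒱 v)) g x +
        conv 𝒱 (q + k) B f (g ∘ₗ LinearMap.mulLeft R (GSym.ι 𝒱 v)) x := by
  rw [conv_ι_mul 𝒱 q B f g hv]
  have h : TensorProduct.lift B ∘ₗ TensorProduct.map (f ∘ₗ sgn (GSym.deg 𝒱) q) g ∘ₗ
      GSym.comulMulLeft 𝒱 k v =
      ksgn R (q * k) • (TensorProduct.lift B ∘ₗ TensorProduct.map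
        ((f ∘ₗ LinearMap.mulLeft R (GSym.ι 𝒱 v)) ∘ₗ sgn (GSym.deg 𝒱) q) g) +
      TensorProduct.lift B ∘ₗ TensorProduct.map (f ∘ₗ sgn (GSym.deg 𝒱) (q + k))
        (g ∘ₗ LinearMap.mulLeft R (GSym.ι 𝒱 v)) := by
    refine tensor_homogeneous_ext (GSym.deg 𝒱) (GSym.deg 𝒱) fun m x hx n y hy => ?_
    simp only [LinearMap.comp_apply, LinearMap.add_apply, LinearMap.smul_apply,
      GSym.comulMulLeft_tmul, map_add, TensorProduct.map_tmul, TensorProduct.lift.tmul,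
      GSym.sgn_ι_mul 𝒱 _ hv, sgn_of_mem (GSym.deg 𝒱) _ hx, map_smul, LinearMap.mulLeft_apply,
      smul_smul, mul_smul_comm]
    match_scalars
    · simp only [mul_one]
    · simp only [mul_one, ← ksgn_add]
      ring_nf
  exact LinearMap.congr_fun h (GSym.comul 𝒱 x)

variable {A : Type*} [Ring A] [Algebra R A] [Module A V] [IsScalarTower R A V]
  {𝒜 : ℤ → Submodule R A} [GradedAlgebra 𝒜]

theorem counit_smulRight_mem_symPiece {q : ℤ} {b : A} (hb : b ∈ 𝒜 q) :
    (GSym.counit 𝒱).toLinearMap.smulRight b ∈ symPiece 𝒜 𝒱 q := by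
  refine ⟨fun i x hx => ?_, fun i a ha v x => by simp⟩
  by_cases hi : i = 0
  · subst hi
    rw [zero_add]
    exact Submodule.smul_mem _ _ hb
  · simp [GSym.counit_of_mem_deg 𝒱 hx hi]

theorem comp_projV_mem_symPiece {q : ℤ} {f : V →ₗ[R] A} (hf : f ∈ dualPiece 𝒜 𝒱 q) :
    f ∘ₗ GSym.projV 𝒱 ∈ symPiece 𝒜 𝒱 q := by
  refine ⟨fun i x hx => hf.1 i _ (GSym.projV_mem 𝒱 hx), fun i a ha v x => ?_⟩
  simp only [LinearMap.comp_apply, GSym.projV_ι_mul, map_smul, hf.2 i a ha, smul_eq_mul,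
    negOnePow_smul R, mul_smul_comm]
  rw [smul_comm]

variable {t : GSym 𝒱 →ₗ[R] Module.End R A} {γ : GSym 𝒱 →ₗ[R] GSym 𝒱}

/-- The term φ ∘ γ drops out since ε ∘ γ = 0, so constant forms read off `t` directly. -/
theorem formOp_counit_smulRight (hγ : GSym.IsCoderivation 𝒱 γ) (q : ℤ) (b : A) (x : GSym 𝒱) :
    formOp 𝒱 t γ q ((GSym.counit 𝒱).toLinearMap.smulRight b) x =
      t (sgn (GSym.deg 𝒱) q x) b := by
  have h := GSym.counit_coderivation hγ.comul_comp x
  rw [formOp, LinearMap.add_apply, derPairing_eq_conv, conv_counit_right]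
  simp [h]

variable (hγ : GSym.IsCoderivation 𝒱 γ)
  (hop : ∀ q, ∀ φ ∈ symPiece 𝒜 𝒱 q, formOp 𝒱 t γ q φ ∈ symPiece 𝒜 𝒱 (q - 1))
  (hsq : ∀ q, ∀ φ ∈ symPiece 𝒜 𝒱 q, formOp 𝒱 t γ (q - 1) (formOp 𝒱 t γ q φ) = 0)

include hγ hop in
-- Constant forms are multilinear, so the operator sends them to multilinear forms, and these are x
-- ↦ ± t(x)(b).
theorem isMultilinear_of_formOp_mem
    (hsm : ∀ i j, ∀ a ∈ 𝒜 i, ∀ v ∈ 𝒱 j, a • v ∈ 𝒱 (i + j)) : IsMultilinear 𝒜 𝒱 (-1) t := by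
  refine IsMultilinear.of_homogeneous 𝒱 fun i a ha k v hv x => ?_
  refine homogeneous_ext 𝒜 fun q b hb => ?_
  -- Evaluation at the sign-twisted element undoes the twist in `formOp_counit_smulRight`.
  have h := (hop q _ (counit_smulRight_mem_symPiece 𝒱 hb)).2.apply ha v (sgn (GSym.deg 𝒱) q x)
  rw [formOp_counit_smulRight 𝒱 hγ, formOp_counit_smulRight 𝒱 hγ, GSym.sgn_ι_mul 𝒱 q hv,
    GSym.sgn_ι_mul 𝒱 q (hsm i k a ha v hv), GSym.sgn_involutive] at h
  simp only [map_smul, LinearMap.smul_apply, smul_eq_mul, mul_smul_comm, smul_smul] at h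
  have h1 := congrArg (ksgn R (q * (i + k)) • ·) h
  simp only [smul_smul, ksgn_sq, one_smul] at h1
  rw [h1]
  change _ = ksgn R (-1 * i) • (a * t (GSym.ι 𝒱 v * x) b)
  congr 1
  simp only [← ksgn_add]
  apply ksgn_congr
  rw [Int.even_iff]
  ring_nf
  omega

include hγ hsq in
theorem conv_add_comp_eq_zero_of_formOp_formOp :
    conv 𝒱 (-1) (LinearMap.mul R (Module.End R A)) t t + t ∘ₗ γ = 0 := by
  ext x b
  revert b
  rw [← LinearMap.ext_iff]
  refine homogeneous_ext 𝒜 fun q b hb => ?_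
  have h := hsq q _ (counit_smulRight_mem_symPiece 𝒱 hb)
  rw [formOp_formOp 𝒱 hγ] at h
  have h1 := LinearMap.congr_fun h (sgn (GSym.deg 𝒱) q x)
  rw [LinearMap.sub_apply, derPairing_eq_conv, conv_counit_right, GSym.sgn_involutive] at h1
  have h2 := GSym.counit_coderivation hγ.comul_comp (γ (sgn (GSym.deg 𝒱) q x))
  simpa [h2] using h1

include hγ hsq in
-- As γγ is a coderivation, its V-component decides. With the twisting defect already zero, D²
-- applied to f ∘ pr_V is − f ∘ pr_V ∘ γγ, and the functionals f separate points.
theorem comp_self_eq_zero_of_formOp_formOp [Algebra ℚ R]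
    (hsep : ∀ i, ∀ v ∈ 𝒱 i, (∀ q, ∀ f ∈ dualPiece 𝒜 𝒱 q, f v = 0) → v = 0) : γ ∘ₗ γ = 0 := by
  refine GSym.coderivation_eq_zero (GSym.comul_comp_sq 𝒱 hγ) fun x => ?_
  have : GSym.projV 𝒱 ∘ₗ γ ∘ₗ γ = 0 := by
    refine homogeneous_ext (GSym.deg 𝒱) fun n x hx => ?_
    refine hsep _ _ (GSym.projV_mem 𝒱 (hγ.degree _ _ (hγ.degree n x hx))) fun q f hf => ?_
    have h := hsq q _ (comp_projV_mem_symPiece 𝒱 hf)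
    rw [formOp_formOp 𝒱 hγ, conv_add_comp_eq_zero_of_formOp_formOp 𝒱 hγ hsq] at h
    have h1 := LinearMap.congr_fun h x
    simpa [derPairing] using h1
  exact LinearMap.congr_fun this x

include hγ hop in
-- The form D(f ∘ pr_V) is multilinear. At v x it consists of a part multilinear in v, of ± t(x)(f
-- v) and of ± f(pr_V γ(v x)). Replacing v by a v and applying the Leibniz rule to t(x)(a f(v))
-- leaves f of the defect of the anchor rule, which therefore vanishes for all f.
theorem anchor_of_formOp_mem
    (ht : ∀ n, ∀ x ∈ GSym.deg 𝒱 n, t x ∈ derPiece 𝒜 (n - 1))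
    (hsm : ∀ i j, ∀ a ∈ 𝒜 i, ∀ v ∈ 𝒱 j, a • v ∈ 𝒱 (i + j))
    (hsep : ∀ i, ∀ v ∈ 𝒱 i, (∀ q, ∀ f ∈ dualPiece 𝒜 𝒱 q, f v = 0) → v = 0)
    {i : ℤ} {a : A} (ha : a ∈ 𝒜 i) {k : ℤ} {v : V} (hv : v ∈ 𝒱 k) {n : ℤ} {x : GSym 𝒱}
    (hx : x ∈ GSym.deg 𝒱 n) :
    GSym.projV 𝒱 (γ (GSym.ι 𝒱 (a • v) * x)) = ksgn R (n * (i + k)) • (t x a • v) +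
      ksgn R i • (a • GSym.projV 𝒱 (γ (GSym.ι 𝒱 v * x))) := by
  have hmul := isMultilinear_of_formOp_mem 𝒱 hγ hop hsm
  have hta : t x a ∈ 𝒜 (i + (n - 1)) := (ht n x hx).1 i a ha
  have hav := hsm i k a ha v hv
  have hg : ∀ {j w}, w ∈ 𝒱 j → GSym.projV 𝒱 (γ (GSym.ι 𝒱 w * x)) ∈ 𝒱 (j + n - 1) :=
    fun hw => GSym.projV_mem 𝒱 (hγ.degree _ _ (GSym.ι_mul_mem 𝒱 _ hw hx))
  rw [← sub_eq_zero]
  refine hsep (i + k + n - 1) _ (sub_mem (hg hav) (add_mem (Submodule.smul_mem _ _ ?_)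
    (Submodule.smul_mem _ _ ?_))) fun q f hf => ?_
  · have := hsm _ _ _ hta v hv
    rwa [show i + (n - 1) + k = i + k + n - 1 by ring] at this
  · have := hsm _ _ _ ha _ (hg hv)
    rwa [show i + (k + n - 1) = i + k + n - 1 by ring] at this
  have hf' : ∀ {j b}, b ∈ 𝒜 j → ∀ w, f (b • w) = ksgn R (q * j) • (b * f w) :=
    fun {j b} hb w => by rw [hf.2 j b hb w, negOnePow_smul R]
  have hformOp : ∀ {j w}, w ∈ 𝒱 j → formOp 𝒱 t γ q (f ∘ₗ GSym.projV 𝒱) (GSym.ι 𝒱 w * x) =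
      ksgn R (q * j) • conv 𝒱 q LinearMap.id (t ∘ₗ LinearMap.mulLeft R (GSym.ι 𝒱 w))
        (f ∘ₗ GSym.projV 𝒱) x + ksgn R ((q + j) * n) • t x (f w) +
        ksgn R (q + 1) • f (GSym.projV 𝒱 (γ (GSym.ι 𝒱 w * x))) := by
    intro j w hw
    -- After multiplication by `w`, the form f ∘ pr_V becomes the constant f(w), so this half of the
    -- convolution collapses.
    have h0 : (f ∘ₗ GSym.projV 𝒱) ∘ₗ LinearMap.mulLeft R (GSym.ι 𝒱 w) =
        (GSym.counit 𝒱).toLinearMap.smulRight (f w) := by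
      ext y
      simp [GSym.projV_ι_mul]
    rw [formOp, LinearMap.add_apply, derPairing_eq_conv, conv_ι_mul_eq_add 𝒱 q _ _ _ hw, h0,
      conv_counit_right, sgn_of_mem (GSym.deg 𝒱) _ hx, map_smul]
    rfl
  have h1 : conv 𝒱 q LinearMap.id (t ∘ₗ LinearMap.mulLeft R (GSym.ι 𝒱 (a • v)))
        (f ∘ₗ GSym.projV 𝒱) x = ksgn R i • (a * conv 𝒱 q LinearMap.id
          (t ∘ₗ LinearMap.mulLeft R (GSym.ι 𝒱 v)) (f ∘ₗ GSym.projV 𝒱) x) := by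
    have : t ∘ₗ LinearMap.mulLeft R (GSym.ι 𝒱 (a • v)) = ksgn R i •
        (LinearMap.mulLeft R (LinearMap.mulLeft R a : Module.End R A) ∘ₗ t ∘ₗ
          LinearMap.mulLeft R (GSym.ι 𝒱 v)) := by
      ext y
      simp only [LinearMap.comp_apply, LinearMap.mulLeft_apply, hmul.apply ha, LinearMap.smul_apply,
        neg_mul, one_mul, ksgn_neg]
      rfl
    rw [this, conv_smul_left, LinearMap.smul_apply]
    congr 1
    have h2 : TensorProduct.lift (LinearMap.id : Module.End R A →ₗ[R] A →ₗ[R] A) ∘ₗ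
        TensorProduct.map ((LinearMap.mulLeft R (LinearMap.mulLeft R a : Module.End R A) ∘ₗ t ∘ₗ
          LinearMap.mulLeft R (GSym.ι 𝒱 v)) ∘ₗ sgn (GSym.deg 𝒱) q) (f ∘ₗ GSym.projV 𝒱) =
        LinearMap.mulLeft R a ∘ₗ TensorProduct.lift
          (LinearMap.id : Module.End R A →ₗ[R] A →ₗ[R] A) ∘ₗ TensorProduct.map ((t ∘ₗ
            LinearMap.mulLeft R (GSym.ι 𝒱 v)) ∘ₗ sgn (GSym.deg 𝒱) q) (f ∘ₗ GSym.projV 𝒱) := by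
      refine TensorProduct.ext' fun y z => ?_
      simp
    exact LinearMap.congr_fun h2 (GSym.comul 𝒱 x)
  have h := (hop q _ (comp_projV_mem_symPiece 𝒱 hf)).2.apply ha v x
  rw [hformOp hav, hformOp hv, h1, hf' ha, map_smul, derPiece_leibniz (ht n x hx) ha] at h
  simp only [smul_add, smul_smul, smul_eq_mul, mul_add, mul_smul_comm] at h
  rw [map_sub, map_add, f.map_smul, f.map_smul, hf' hta, hf' ha]
  set X := f (GSym.projV 𝒱 (γ (GSym.ι 𝒱 (a • v) * x)))
  -- The right side 0 becomes (-1)^(q+1) times the multilinearity defect `h`; this sign normalises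
  -- the coefficient of `X` to 1.
  rw [← sub_eq_zero] at h
  rw [← smul_zero (ksgn R (q + 1)), ← h]
  simp only [smul_add, smul_smul, smul_sub]
  match_scalars <;> simp only [mul_one, ← ksgn_add]
  · rw [ksgn_add, ksgn_sq]
  · rw [neg_eq_iff_add_eq_zero]
    apply ksgn_add_eq_zero
    rw [Int.not_even_iff]
    ring_nf
    omega
  · rw [neg_inj]
    apply ksgn_congr
    rw [Int.even_iff]
    ring_nf
    omega
  · rw [eq_comm, sub_eq_zero]
    apply ksgn_congr
    rw [Int.even_iff]
    ring_nf
    omega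
  · rw [eq_comm, sub_eq_zero]
    apply ksgn_congr
    rw [Int.even_iff]
    ring_nf
    omega

/-- Of the chain algebra axioms only the one on the sum is used: under either notion of convergence
that sum must be the total operator. -/
theorem formOp_properties_of_isMultiDerivationChainAlgebra
    (hfil : ∀ n, ∀ x ∈ GSym.coaugFiltration 𝒱 n, γ x ∈ GSym.coaugFiltration 𝒱 n)
    (h : IsMultiDerivationChainAlgebra (symPiece 𝒜 𝒱) (fun _ q => formMul 𝒱 q) (formOne 𝒱)
      (symFiltration 𝒜 𝒱) (formOpPart 𝒱 t γ)) :
    (∀ q, ∀ φ ∈ symPiece 𝒜 𝒱 q, formOp 𝒱 t γ q φ ∈ symPiece 𝒜 𝒱 (q - 1)) ∧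
      ∀ q, ∀ φ ∈ symPiece 𝒜 𝒱 q, formOp 𝒱 t γ (q - 1) (formOp 𝒱 t γ q φ) = 0 := by
  obtain ⟨T, hT, hder, hsq⟩ := h.perturbation
  have hop : ∀ q, ∀ φ ∈ symPiece 𝒜 𝒱 q, formOp 𝒱 t γ q φ ∈ symPiece 𝒜 𝒱 (q - 1) := by
    intro q φ hφ
    rw [← eq_formOp_of_isSumOf 𝒱 hfil hT hφ]
    exact hder.degree q φ hφ
  refine ⟨hop, fun q φ hφ => ?_⟩
  rw [← eq_formOp_of_isSumOf 𝒱 hfil hT (hop q φ hφ), ← eq_formOp_of_isSumOf 𝒱 hfil hT hφ]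
  exact hsq q φ hφ

end Forms

/-! ### Absorbing d and d⁰: the total cochain and the total coderivation -/

section Perturbed

variable {R : Type*} [CommRing R] {A : Type*} [Ring A] [Algebra R A]
  {V : Type*} [AddCommGroup V] [Module R V]
  {𝒜 : ℤ → Submodule R A} {𝒱 : ℤ → Submodule R V} [DirectSum.Decomposition 𝒱]

variable (𝒱) in
/-- The cochain `t + d`, where the differential `d` is extended by zero to the positive symmetric
powers. -/
def totalCochain (dA : Differential 𝒜) (t : GSym 𝒱 →ₗ[R] Module.End R A) :
    GSym 𝒱 →ₗ[R] Module.End R A :=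
  t + (GSym.counit 𝒱).toLinearMap.smulRight dA.toLin

variable {dA : Differential 𝒜} {dV : Differential 𝒱} {δ : GSym 𝒱 →ₗ[R] GSym 𝒱}
  {t : GSym 𝒱 →ₗ[R] Module.End R A}

theorem totalCochain_apply (x : GSym 𝒱) :
    totalCochain 𝒱 dA t x = t x + GSym.counit 𝒱 x • dA.toLin := rfl

theorem totalCochain_ι_mul (v : V) (x : GSym 𝒱) :
    totalCochain 𝒱 dA t (GSym.ι 𝒱 v * x) = t (GSym.ι 𝒱 v * x) := by
  rw [totalCochain_apply, GSym.counit_ι_mul, zero_smul, add_zero]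

/-- Multilinearity only concerns products with a leading factor from V, which the counit kills; the
summand d, not A-linear itself, does no harm. -/
theorem isMultilinear_totalCochain [Module A V] :
    IsMultilinear 𝒜 𝒱 (-1) (totalCochain 𝒱 dA t) ↔ IsMultilinear 𝒜 𝒱 (-1) t := by
  simp only [IsMultilinear, totalCochain_ι_mul]

theorem totalCochain_mem [GradedAlgebra 𝒜] (hA : IsDGCommAlgebra 𝒜 dA)
    (ht : ∀ n, ∀ x ∈ GSym.deg 𝒱 n, t x ∈ derPiece 𝒜 (n - 1)) (n : ℤ) (x : GSym 𝒱)
    (hx : x ∈ GSym.deg 𝒱 n) : totalCochain 𝒱 dA t x ∈ derPiece 𝒜 (n - 1) := by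
  refine add_mem (ht n x hx) ?_
  by_cases hn : n = 0
  · subst hn
    refine Submodule.smul_mem _ _ ⟨fun i a ha => dA.degree i a ha, fun i a ha b => ?_⟩
    rw [hA.leibniz i a ha, zero_sub, neg_one_mul, Int.negOnePow_neg]
  · have : GSym.counit 𝒱 x = 0 := GSym.counit_of_mem_deg 𝒱 hx hn
    simp [this]

theorem totalCochain_projWt (ht : ∀ x ∈ GSym.coaugFiltration 𝒱 0, t x = 0) (j : ℕ) :
    totalCochain 𝒱 dA t ∘ₗ GSym.projWt 𝒱 j =
      if j = 0 then (GSym.counit 𝒱).toLinearMap.smulRight dA.toLin else t ∘ₗ GSym.projWt 𝒱 j := by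
  ext1 x
  rw [LinearMap.comp_apply, totalCochain_apply]
  split_ifs with hj
  · subst hj
    rw [ht _ (GSym.wt_le_coaugFiltration 𝒱 le_rfl (GSym.projWt_mem 𝒱 0 x)), GSym.projWt_zero,
      zero_add, AlgHom.commutes]
    rfl
  · rw [GSym.counit_of_mem_wt 𝒱 (GSym.projWt_mem 𝒱 j x) hj, zero_smul, add_zero,
      LinearMap.comp_apply]

namespace GSym

theorem diff_mem_coaugFiltration (dV : Differential 𝒱) {n : ℕ} {x : GSym 𝒱}
    (hx : x ∈ coaugFiltration 𝒱 n) : diff 𝒱 dV x ∈ coaugFiltration 𝒱 n := by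
  have : coaugFiltration 𝒱 n ≤ (coaugFiltration 𝒱 n).comap (diff 𝒱 dV) :=
    iSup₂_le fun m hm x hx => wt_le_coaugFiltration 𝒱 hm (diff_mem_wt 𝒱 dV hx)
  exact this hx

theorem lowerPart_diff (dV : Differential 𝒱) (j : ℕ) :
    lowerPart 𝒱 j (diff 𝒱 dV) = if j = 0 then diff 𝒱 dV else 0 := by
  refine wt_ext 𝒱 fun n x hx => ?_
  have hd := diff_mem_wt 𝒱 dV hx
  rw [lowerPart_of_mem 𝒱 j _ hx]
  split_ifs with h1 h2 h2
  · subst h2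
    exact projWt_of_mem 𝒱 hd
  · exact projWt_of_mem_ne 𝒱 hd (by omega)
  · omega
  · rfl

theorem IsCoderivation.add {γ γ' : GSym 𝒱 →ₗ[R] GSym 𝒱} (h : IsCoderivation 𝒱 γ)
    (h' : IsCoderivation 𝒱 γ') : IsCoderivation 𝒱 (γ + γ') where
  degree n x hx := add_mem (h.degree n x hx) (h'.degree n x hx)
  comul_comp := by
    rw [LinearMap.comp_add, h.comul_comp, h'.comul_comp, TensorProduct.map_add_left,
      TensorProduct.map_add_right, ← LinearMap.add_comp]
    congr 1
    abel

variable (hδ : IsFilteredCoderivation 𝒱 δ)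
include hδ

theorem IsFilteredCoderivation.mem_of_mem {n : ℕ} {x : GSym 𝒱}
    (hx : x ∈ coaugFiltration 𝒱 n) : δ x ∈ coaugFiltration 𝒱 n := by
  rcases n with _ | n
  · rw [hδ.map_zero x hx]
    exact zero_mem _
  · exact coaugFiltration_mono 𝒱 n.le_succ (hδ.map_succ n x hx)

theorem IsFilteredCoderivation.lowerPart_zero : lowerPart 𝒱 0 δ = 0 := by
  refine wt_ext 𝒱 fun n x hx => ?_
  rw [lowerPart_of_mem 𝒱 0 _ hx, if_pos n.zero_le, Nat.sub_zero, LinearMap.zero_apply]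
  have hx' := wt_le_coaugFiltration 𝒱 le_rfl hx
  rcases n with _ | n
  · rw [hδ.map_zero x hx', _root_.map_zero]
  · exact (mem_coaugFiltration 𝒱).1 (hδ.map_succ n x hx') _ n.lt_succ_self

theorem IsFilteredCoderivation.projV_ι (v : V) : projV 𝒱 (δ (ι 𝒱 v)) = 0 := by
  have h : ι 𝒱 v ∈ coaugFiltration 𝒱 1 := by
    have := ι_mul_mem_wt' 𝒱 v (one_mem_wt 𝒱)
    rw [mul_one] at this
    exact wt_le_coaugFiltration 𝒱 le_rfl this
  rw [← projV_projWt_one, (mem_coaugFiltration 𝒱).1 (hδ.map_succ 0 _ h) 1 one_pos, _root_.map_zero]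

theorem IsFilteredCoderivation.diff_add (dV : Differential 𝒱) :
    IsCoderivation 𝒱 (diff 𝒱 dV + δ) :=
  (isCoderivation_diff 𝒱 dV).add hδ.toIsCoderivation

end GSym

/-- For j = 0 the constituents are d·ε and d⁰, since t vanishes on C₀ and ∂ strictly lowers the
filtration; for j ≥ 1 they are tⱼ and ∂ʲ, since d·ε lives on S⁰ and d⁰ preserves symmetric powers.
-/
theorem multiDiff_eq_formOpPart (hδ : GSym.IsFilteredCoderivation 𝒱 δ)
    (ht : ∀ x ∈ GSym.coaugFiltration 𝒱 0, t x = 0) :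
    multiDiff dA dV δ t =
      formOpPart 𝒱 (totalCochain 𝒱 dA t) (GSym.diff 𝒱 dV + δ) := by
  funext j q φ
  rw [multiDiff, formOpPart, totalCochain_projWt ht, GSym.lowerPart_add, GSym.lowerPart_diff,
    formOp]
  split_ifs with hj
  · subst hj
    rw [hδ.lowerPart_zero, add_zero, homDiff, negOnePow_smul R]
    congr 1
    ext x
    rw [derPairing_eq_conv, conv_counit_left]
    rfl
  · rw [zero_add, negOnePow_smul R]

theorem homDiff_homDiff (q : ℤ) (φ : GSym 𝒱 →ₗ[R] A) :
    homDiff dA dV (q - 1) (homDiff dA dV q φ) = 0 := by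
  ext x
  have h : ksgn R (q + 1) + ksgn R (q - 1 + 1) = 0 := by
    apply ksgn_add_eq_zero
    rw [Int.not_even_iff]
    ring_nf
    omega
  simp only [homDiff, negOnePow_smul R, LinearMap.add_apply, LinearMap.smul_apply,
    LinearMap.comp_apply, map_add, map_smul, dA.sq_zero, GSym.diff_diff, map_zero, smul_zero,
    add_zero, zero_add, LinearMap.zero_apply]
  rw [← add_smul, h, zero_smul]

/-- For odd `t`, cocommutativity makes the two halves of the bracket coincide, so ½[t, t] is t ∪ t.
-/
theorem cupBracket_self (x : GSym 𝒱) : cupBracket 𝒱 (-1) (-1) t t x =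
    (2 : R) • conv 𝒱 (-1) (LinearMap.mul R (Module.End R A)) t t x := by
  rw [cupBracket, GSym.swap_comp_comul, negOnePow_smul R, neg_mul_neg, one_mul, ksgn_one,
    neg_smul, one_smul, sub_neg_eq_add, two_smul]
  rfl

/-- Squaring t + d·ε gives t ∪ t, the two mixed terms and d² = 0; the mixed terms are t(x) d and d
t(x), forming the graded commutator [d, t(x)]. -/
theorem conv_totalCochain (hδ : GSym.IsFilteredCoderivation 𝒱 δ) [Algebra ℚ R] {n : ℤ}
    {x : GSym 𝒱} (hx : x ∈ GSym.deg 𝒱 n) :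
    (conv 𝒱 (-1) (LinearMap.mul R (Module.End R A)) (totalCochain 𝒱 dA t)
        (totalCochain 𝒱 dA t) + totalCochain 𝒱 dA t ∘ₗ (GSym.diff 𝒱 dV + δ)) x =
      (dA.toLin ∘ₗ t x - (n - 1).negOnePow • (t x ∘ₗ dA.toLin)) +
        t ((GSym.diff 𝒱 dV + δ) x) +
        algebraMap ℚ R (1 / 2) • cupBracket 𝒱 (-1) (-1) t t x := by
  have h0 := GSym.counit_coderivation (hδ.diff_add dV).comul_comp x
  have h2 : algebraMap ℚ R (1 / 2) * 2 = 1 := by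
    rw [← map_ofNat (algebraMap ℚ R) 2, ← map_mul]
    norm_num
  have h3 : dA.toLin * dA.toLin = 0 := LinearMap.ext dA.sq_zero
  have h4 : ksgn R (-1 * n) = - ksgn R (n - 1) := by
    rw [eq_neg_iff_add_eq_zero]
    apply ksgn_add_eq_zero
    rw [Int.not_even_iff]
    ring_nf
    omega
  rw [LinearMap.add_apply, LinearMap.comp_apply, totalCochain_apply, h0, zero_smul, add_zero,
    cupBracket_self, smul_smul, h2, one_smul, negOnePow_smul R, totalCochain, conv_add_left,
    conv_add_right, LinearMap.add_apply, LinearMap.add_apply, conv_counit_right, conv_counit_left,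
    sgn_of_mem (GSym.deg 𝒱) _ hx, map_smul, h4]
  simp only [LinearMap.mul_apply', LinearMap.add_apply, mul_add,
    LinearMap.smulRight_apply, mul_smul_comm, h3, smul_zero, add_zero]
  change _ + (-ksgn R (n - 1) • t x) * dA.toLin + dA.toLin * t x + _ = dA.toLin * t x -
    ksgn R (n - 1) • (t x * dA.toLin) + _ + _
  have h5 : (-ksgn R (n - 1) • t x) * dA.toLin = -(ksgn R (n - 1) • (t x * dA.toLin)) := by
    ext b
    exact neg_smul (ksgn R (n - 1)) (t x (dA.toLin b))
  rw [h5]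
  abel

end Perturbed

/-! ### The anchor rule for the total coderivation -/

section Anchor

variable {R : Type*} [CommRing R] {A : Type*} [Ring A] [Algebra R A]
  {V : Type*} [AddCommGroup V] [Module R V] [Module A V] [IsScalarTower R A V]
  {𝒜 : ℤ → Submodule R A} {𝒱 : ℤ → Submodule R V} [DirectSum.Decomposition 𝒱]
  {dA : Differential 𝒜} {dV : Differential 𝒱} {δ : GSym 𝒱 →ₗ[R] GSym 𝒱}
  {t : GSym 𝒱 →ₗ[R] Module.End R A}

theorem prod_ofFn_ι_mem {M : Type*} [AddCommMonoid M] (w : ℤ → M) {j : ℕ} {n : Fin j → ℤ}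
    {α : Fin j → V} (h : ∀ l, α l ∈ 𝒱 (n l)) :
    (List.ofFn fun l => GSym.ι 𝒱 (α l)).prod ∈ GSym.piece 𝒱 w (∑ l, w (n l)) := by
  rw [← List.sum_ofFn]
  exact SetLike.list_prod_ofFn_mem_graded _ _ fun l => GSym.ι_mem 𝒱 w (h l)

/-- The two forms of the rule for the interplay of the coderivation and the anchor, with the
distinguished argument in the last or in the first position. -/
theorem anchor_iff (hsm : ∀ i j, ∀ a ∈ 𝒜 i, ∀ v ∈ 𝒱 j, a • v ∈ 𝒱 (i + j)) {i k n : ℤ}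
    {j : ℕ} (hj : 1 ≤ j) {a : A} (ha : a ∈ 𝒜 i) {v : V} (hv : v ∈ 𝒱 k) {x : GSym 𝒱}
    (hx : x ∈ GSym.deg 𝒱 n) (hxj : x ∈ GSym.wt 𝒱 j) :
    (GSym.projV 𝒱 ((GSym.diff 𝒱 dV + δ) (GSym.ι 𝒱 (a • v) * x)) =
      ksgn R (n * (i + k)) • (totalCochain 𝒱 dA t x a • v) + ksgn R i • (a •
        GSym.projV 𝒱 ((GSym.diff 𝒱 dV + δ) (GSym.ι 𝒱 v * x)))) ↔
    GSym.projV 𝒱 (GSym.lowerPart 𝒱 j δ (x * GSym.ι 𝒱 (a • v))) =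
      t (GSym.projWt 𝒱 j x) a • v + ((n + 1) * i).negOnePow •
        (a • GSym.projV 𝒱 (GSym.lowerPart 𝒱 j δ (x * GSym.ι 𝒱 v))) := by
  -- d⁰ keeps the weight j + 1 ≥ 2 and so contributes nothing to the V-component.
  have h1 : ∀ w, GSym.projV 𝒱 ((GSym.diff 𝒱 dV + δ) (GSym.ι 𝒱 w * x)) =
      GSym.projV 𝒱 (δ (GSym.ι 𝒱 w * x)) := by
    intro w
    rw [LinearMap.add_apply, map_add, GSym.projV_of_mem_wt 𝒱
      (GSym.diff_mem_wt 𝒱 dV (GSym.ι_mul_mem_wt' 𝒱 w hxj)) (by omega), zero_add]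
  have h2 : ∀ {l w}, w ∈ 𝒱 l → GSym.projV 𝒱 (GSym.lowerPart 𝒱 j δ (x * GSym.ι 𝒱 w)) =
      ksgn R (n * l) • GSym.projV 𝒱 (δ (GSym.ι 𝒱 w * x)) := by
    intro l w hw
    rw [GSym.mul_comm_ksgn 𝒱 hx (GSym.ι_mem 𝒱 (fun i => i) hw), map_smul, map_smul,
      ← GSym.projV_projWt_one, GSym.projWt_lowerPart, GSym.projV_projWt_one, add_comm 1 j,
      GSym.projWt_of_mem 𝒱 (GSym.ι_mul_mem_wt' 𝒱 w hxj)]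
  rw [h1, h1, h2 hv, h2 (hsm i k a ha v hv), GSym.projWt_of_mem 𝒱 hxj, totalCochain_apply,
    GSym.counit_of_mem_wt 𝒱 hxj (by omega), zero_smul, add_zero, negOnePow_smul R,
    smul_comm a (ksgn R (n * k)), smul_smul (ksgn R ((n + 1) * i))]
  have h3 : ksgn R (n * (i + k)) * ksgn R i = ksgn R ((n + 1) * i) * ksgn R (n * k) := by
    simp only [← ksgn_add]
    ring_nf
  rw [← h3]
  constructor
  · intro h
    rw [h]
    simp only [smul_add, smul_smul, ksgn_sq, one_smul]
  · intro h
    have h4 := congrArg (ksgn R (n * (i + k)) • ·) h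
    simpa only [smul_add, smul_smul, ← mul_assoc, ksgn_sq, one_smul, one_mul] using h4

/-- The case of no further arguments is the Leibniz rule of the dg module: ∂ has no component V → V,
and the total cochain takes the value d at 1. -/
theorem anchor_one [GradedAlgebra 𝒜] (hδ : GSym.IsFilteredCoderivation 𝒱 δ)
    (ht : ∀ x ∈ GSym.coaugFiltration 𝒱 0, t x = 0)
    (hsm : ∀ i j, ∀ a ∈ 𝒜 i, ∀ v ∈ 𝒱 j, a • v ∈ 𝒱 (i + j))
    (hleib : ∀ i, ∀ a ∈ 𝒜 i, ∀ v, dV.toLin (a • v) = dA.toLin a • v +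
      ksgn R i • (a • dV.toLin v)) {i k : ℤ} {a : A} (ha : a ∈ 𝒜 i) {v : V} (hv : v ∈ 𝒱 k) :
    GSym.projV 𝒱 ((GSym.diff 𝒱 dV + δ) (GSym.ι 𝒱 (a • v) * 1)) =
      totalCochain 𝒱 dA t 1 a • v + ksgn R i • (a •
        GSym.projV 𝒱 ((GSym.diff 𝒱 dV + δ) (GSym.ι 𝒱 v * 1))) := by
  have h1 : ∀ {l w}, w ∈ 𝒱 l → GSym.projV 𝒱 ((GSym.diff 𝒱 dV + δ) (GSym.ι 𝒱 w * 1)) =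
      dV.toLin w := by
    intro l w hw
    rw [LinearMap.add_apply, map_add, GSym.diff_ι_mul 𝒱 dV hw, GSym.diff_one, mul_zero, smul_zero,
      add_zero, mul_one, mul_one, GSym.projV_ι, hδ.projV_ι, add_zero]
  rw [h1 hv, h1 (hsm i k a ha v hv), hleib i a ha, totalCochain_apply,
    _root_.map_one (GSym.counit 𝒱), one_smul,
    ht 1 (GSym.wt_le_coaugFiltration 𝒱 le_rfl (GSym.one_mem_wt 𝒱)), zero_add]

/-- The rule is linear in `x`, so products of homogeneous elements suffice; the empty product is the
Leibniz rule and the others are condition (4) with the distinguished argument moved to the front. -/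
theorem anchor_of_prod [GradedAlgebra 𝒜] (hδ : GSym.IsFilteredCoderivation 𝒱 δ)
    (ht : ∀ x ∈ GSym.coaugFiltration 𝒱 0, t x = 0)
    (hsm : ∀ i j, ∀ a ∈ 𝒜 i, ∀ v ∈ 𝒱 j, a • v ∈ 𝒱 (i + j))
    (hleib : ∀ i, ∀ a ∈ 𝒜 i, ∀ v, dV.toLin (a • v) = dA.toLin a • v +
      ksgn R i • (a • dV.toLin v)) {i k : ℤ} {a : A} (ha : a ∈ 𝒜 i) {v : V} (hv : v ∈ 𝒱 k)
    (h : ∀ j : ℕ, 1 ≤ j → ∀ (n : Fin j → ℤ) (α : Fin j → V), (∀ l, α l ∈ 𝒱 (n l)) →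
      GSym.projV 𝒱 (GSym.lowerPart 𝒱 j δ
          ((List.ofFn fun l => GSym.ι 𝒱 (α l)).prod * GSym.ι 𝒱 (a • v))) =
        t (GSym.projWt 𝒱 j (List.ofFn fun l => GSym.ι 𝒱 (α l)).prod) a • v +
          (((∑ l, n l) + 1) * i).negOnePow • (a • GSym.projV 𝒱 (GSym.lowerPart 𝒱 j δ
            ((List.ofFn fun l => GSym.ι 𝒱 (α l)).prod * GSym.ι 𝒱 v))))
    {n : ℤ} {x : GSym 𝒱} (hx : x ∈ GSym.deg 𝒱 n) :
    GSym.projV 𝒱 ((GSym.diff 𝒱 dV + δ) (GSym.ι 𝒱 (a • v) * x)) =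
      ksgn R (n * (i + k)) • (totalCochain 𝒱 dA t x a • v) + ksgn R i • (a •
        GSym.projV 𝒱 ((GSym.diff 𝒱 dV + δ) (GSym.ι 𝒱 v * x))) := by
  induction hx using Submodule.span_induction with
  | mem x hx =>
    obtain ⟨l, rfl, rfl⟩ := hx
    rcases l with _ | ⟨y, l⟩
    · have := anchor_one hδ ht hsm hleib ha hv
      simpa using this
    · set l' := y :: l with hl'
      have hα : ∀ m : Fin l'.length, ((l'.get m).2 : V) ∈ 𝒱 (l'.get m).1 := fun m => (l'.get m).2.2
      have hprod : (List.ofFn fun m => GSym.ι 𝒱 ((l'.get m).2 : V)).prod = GSym.listProd 𝒱 l' := by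
        rw [GSym.listProd, ← List.ofFn_getElem_eq_map]
        rfl
      have hsum : ∑ m, (l'.get m).1 = (l'.map fun y => y.1).sum := by
        rw [← List.sum_ofFn, ← List.ofFn_getElem_eq_map]
        rfl
      have hwt : GSym.listProd 𝒱 l' ∈ GSym.wt 𝒱 l'.length := by
        simpa using GSym.listProd_mem 𝒱 (fun _ => (1 : ℕ)) l'
      have := h l'.length (by simp [hl']) _ _ hα
      rw [hprod, hsum] at this
      exact (anchor_iff hsm (by simp [hl']) ha hv (GSym.listProd_mem 𝒱 (fun i => i) l') hwt).2 this
  | zero => simp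
  | add x y _ _ hx hy =>
    -- Only additivity of the total coderivation is needed; naming it keeps `simp` from splitting
    -- the sum.
    generalize GSym.diff 𝒱 dV + δ = D at hx hy ⊢
    generalize ksgn R (n * (i + k)) = c at hx hy ⊢
    simp only [mul_add, map_add, hx, hy, LinearMap.add_apply, add_smul, smul_add]
    abel
  | smul r x _ hx =>
    generalize GSym.diff 𝒱 dV + δ = D at hx ⊢
    simp only [mul_smul_comm, map_smul, hx, LinearMap.smul_apply, smul_add, smul_assoc]
    rw [smul_comm a r, smul_comm r, smul_comm r (ksgn R i)]

end Anchor

/-! ### The suspension, and the two implications -/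

section Main

variable {R : Type*} [CommRing R] {A : Type*} [Ring A] [Algebra R A]
  {𝒜 : ℤ → Submodule R A} [GradedAlgebra 𝒜]
  {L : Type*} [AddCommGroup L] [Module R L] [Module A L] [IsScalarTower R A L]
  {ℒ : ℤ → Submodule R L}

namespace Susp

instance : IsScalarTower R A (Susp 𝒜 L) where
  smul_assoc r a v := by
    change (sgn 𝒜 1 (r • a) • (s 𝒜).symm v : L) = r • (sgn 𝒜 1 a • (s 𝒜).symm v : L)
    rw [map_smul, smul_assoc]

theorem smul_s_ksgn {i : ℤ} {a : A} (ha : a ∈ 𝒜 i) (x : L) :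
    a • s 𝒜 x = ksgn R i • s 𝒜 (a • x) := by
  rw [smul_s 𝒜 ha, negOnePow_smul R]

theorem smul_mem_grading {dA : Differential 𝒜} {dL : Differential ℒ} (hL : IsDGModule dA dL)
    (i j : ℤ) (a : A) (ha : a ∈ 𝒜 i) (v : Susp 𝒜 L) (hv : v ∈ grading 𝒜 ℒ j) :
    a • v ∈ grading 𝒜 ℒ (i + j) := by
  obtain ⟨x, hx, rfl⟩ := hv
  refine (smul_s_ksgn ha x).symm ▸ Submodule.smul_mem _ _ ⟨a • x, ?_, rfl⟩
  rw [add_sub_assoc]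
  exact hL.smul_mem i (j - 1) a ha x hx

/-- The module sign of d a differs from that of a by −1, which matches the sign in d(s x) = −s(d x);
so sL is again a dg module with the usual Leibniz rule. -/
theorem differential_smul {dA : Differential 𝒜} {dL : Differential ℒ} (hL : IsDGModule dA dL)
    (i : ℤ) (a : A) (ha : a ∈ 𝒜 i) (v : Susp 𝒜 L) :
    (differential 𝒜 dL).toLin (a • v) = dA.toLin a • v +
      ksgn R i • (a • (differential 𝒜 dL).toLin v) := by
  obtain ⟨x, rfl⟩ := (s 𝒜).surjective v
  have h : ∀ y, (differential 𝒜 dL).toLin (s 𝒜 y) = -s 𝒜 (dL.toLin y) := fun y => by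
    simp [differential]
  rw [smul_s_ksgn ha, LinearMap.map_smul, h, h, hL.leibniz i a ha,
    smul_s_ksgn (dA.degree i a ha), smul_neg a, smul_s_ksgn ha, map_add, negOnePow_smul R,
    LinearEquiv.map_smul, ksgn_sub, ksgn_one, mul_neg_one, neg_smul, smul_neg, smul_neg, smul_add,
    neg_add]

/-- If the canonical map of `L` into its double dual is injective, the graded dual of the
suspension of `L` separates the homogeneous elements. -/
theorem eq_zero_of_dualPiece (hinj : ∀ i, Function.Injective (toDoubleDual 𝒜 ℒ i)) (i : ℤ)
    (v : Susp 𝒜 L) (hv : v ∈ grading 𝒜 ℒ i)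
    (h : ∀ q, ∀ f ∈ dualPiece 𝒜 (grading 𝒜 ℒ) q, f v = 0) : v = 0 := by
  obtain ⟨x, hx, rfl⟩ := hv
  have hz : (⟨x, hx⟩ : ℒ (i - 1)) = 0 := by
    refine hinj (i - 1) (Eq.trans ?_ (map_zero _).symm)
    ext q f
    -- Composing with s⁻¹ lowers the degree to q − 1, and the factor (-1)^|a| in the action on sL
    -- supplies the corresponding change of the A-linearity sign.
    have hf : (f : L →ₗ[R] A) ∘ₗ (s 𝒜).symm.toLinearMap ∈ dualPiece 𝒜 (grading 𝒜 ℒ) (q - 1) := by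
      refine ⟨?_, fun j a ha v => ?_⟩
      · rintro j _ ⟨y, hy, rfl⟩
        have := f.2.1 _ y hy
        rw [show j + (q - 1) = j - 1 + q by ring]
        simpa using this
      · obtain ⟨y, rfl⟩ := (s 𝒜).surjective v
        rw [smul_s_ksgn ha, map_smul]
        simp only [LinearMap.comp_apply, LinearEquiv.coe_coe, LinearEquiv.symm_apply_apply,
          f.2.2 j a ha, negOnePow_smul R, smul_smul, ← ksgn_add]
        congr 1
        apply ksgn_congr
        rw [Int.even_iff]
        ring_nf
        omega
    have h0 : (f : L →ₗ[R] A) x = 0 := by simpa using h _ _ hf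
    simp [toDoubleDual, h0]
  have hx0 : x = 0 := congrArg Subtype.val hz
  rw [hx0, map_zero]

end Susp

variable [Algebra ℚ R] [DirectSum.Decomposition ℒ] {dA : Differential 𝒜} {dL : Differential ℒ}
  {δ : SsL 𝒜 ℒ →ₗ[R] SsL 𝒜 ℒ} {t : SsL 𝒜 ℒ →ₗ[R] Module.End R A}

variable (hA : IsDGCommAlgebra 𝒜 dA) (hL : IsDGModule dA dL)
  (hδ : GSym.IsFilteredCoderivation (Susp.grading 𝒜 ℒ) δ)
  (ht : IsFilteredMorphism 𝒜 (Susp.grading 𝒜 ℒ) t)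

include hδ in
theorem diff_add_mem_coaugFiltration (n : ℕ) (x : SsL 𝒜 ℒ)
    (hx : x ∈ GSym.coaugFiltration (Susp.grading 𝒜 ℒ) n) :
    (GSym.diff _ (Susp.differential 𝒜 dL) + δ) x ∈ GSym.coaugFiltration (Susp.grading 𝒜 ℒ) n :=
  add_mem (GSym.diff_mem_coaugFiltration _ hx) (hδ.mem_of_mem hx)

include hA hL hδ ht in
theorem symIsMultiDerivationChainAlgebra_of_isSHLieRinehart (h : IsSHLieRinehart dA dL δ t) :
    SymIsMultiDerivationChainAlgebra dA dL δ t := by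
  have hmd := multiDiff_eq_formOpPart (dA := dA) (dV := Susp.differential 𝒜 dL) hδ ht.map_zero
  rw [SymIsMultiDerivationChainAlgebra, hmd]
  refine isMultiDerivationChainAlgebra_formOpPart _
    (fun i j a ha b hb => by rw [hA.comm i j a ha b hb, negOnePow_smul R])
    (Susp.smul_mem_grading hL) (totalCochain_mem hA ht.degree) (hδ.diff_add _)
    (diff_add_mem_coaugFiltration hδ) (isMultilinear_totalCochain.2 h.multilinear) ?_ ?_ ?_
    h.shLie.sq_zero
  · intro i a ha k v hv n x hx
    exact anchor_of_prod hδ ht.map_zero (Susp.smul_mem_grading hL) (Susp.differential_smul hL)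
      ha hv (fun j hj n α hα => h.anchor j hj n α k v i a hα hv ha) hx
  · intro q φ
    rw [← hmd]
    exact homDiff_homDiff q φ
  · refine homogeneous_ext (GSym.deg _) fun n x hx => ?_
    rw [conv_totalCochain hδ hx, h.twisting.twisting n x hx, LinearMap.zero_apply]

include hA hL hδ ht in
theorem isSHLieRinehart_of_symIsMultiDerivationChainAlgebra
    (hinj : ∀ i, Function.Injective (toDoubleDual 𝒜 ℒ i))
    (h : SymIsMultiDerivationChainAlgebra dA dL δ t) : IsSHLieRinehart dA dL δ t := by
  have hγ := hδ.diff_add (Susp.differential 𝒜 dL)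
  have hsep := Susp.eq_zero_of_dualPiece hinj
  have hsm := Susp.smul_mem_grading hL
  rw [SymIsMultiDerivationChainAlgebra, multiDiff_eq_formOpPart hδ ht.map_zero] at h
  obtain ⟨hop, hsq⟩ := formOp_properties_of_isMultiDerivationChainAlgebra _
    (diff_add_mem_coaugFiltration hδ) h
  have htw := conv_add_comp_eq_zero_of_formOp_formOp _ hγ hsq
  refine ⟨⟨hδ, comp_self_eq_zero_of_formOp_formOp _ hγ hsq hsep⟩, ⟨ht, fun n x hx => ?_⟩,
    isMultilinear_totalCochain.1 (isMultilinear_of_formOp_mem _ hγ hop hsm), ?_⟩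
  · rw [← conv_totalCochain hδ hx, htw, LinearMap.zero_apply]
  · intro j hj n α k β i a hα hβ ha
    have hdeg := prod_ofFn_ι_mem (fun i => i) hα
    have hwt := prod_ofFn_ι_mem (fun _ => (1 : ℕ)) hα
    rw [Finset.sum_const, Finset.card_univ, Fintype.card_fin, smul_eq_mul, mul_one] at hwt
    exact (anchor_iff (dV := Susp.differential 𝒜 dL) (dA := dA) hsm hj ha hβ hdeg hwt).1
      (anchor_of_formOp_mem _ hγ hop (totalCochain_mem hA ht.degree) hsm hsep ha hβ hdeg)

end Main

end

end SHLR

theorem mainTheorem1 {R : Type*} [CommRing R] [Algebra ℚ R]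
    {A : Type*} [Ring A] [Algebra R A] (𝒜 : ℤ → Submodule R A) [GradedAlgebra 𝒜]
    (dA : SHLR.Differential 𝒜) (hA : SHLR.IsDGCommAlgebra 𝒜 dA)
    {L : Type*} [AddCommGroup L] [Module R L] [Module A L] [IsScalarTower R A L]
    (ℒ : ℤ → Submodule R L) [DirectSum.Decomposition ℒ]
    (dL : SHLR.Differential ℒ) (hL : SHLR.IsDGModule dA dL)
    (hinj : ∀ i, Function.Injective (SHLR.toDoubleDual 𝒜 ℒ i))
    (δ : SHLR.SsL 𝒜 ℒ →ₗ[R] SHLR.SsL 𝒜 ℒ)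
    (hδ : SHLR.GSym.IsFilteredCoderivation (SHLR.Susp.grading 𝒜 ℒ) δ)
    (t : SHLR.SsL 𝒜 ℒ →ₗ[R] Module.End R A)
    (ht : SHLR.IsFilteredMorphism 𝒜 (SHLR.Susp.grading 𝒜 ℒ) t) :
    (SHLR.IsSHLieRinehart dA dL δ t ↔ SHLR.SymIsMultiDerivationChainAlgebra dA dL δ t) ∧
      (SHLR.SymIsMultiDerivationChainAlgebra dA dL δ t →
        SHLR.IsAssociatedMaurerCartanAlgebra dA dL δ t
          (SHLR.multiDiff dA (SHLR.Susp.differential 𝒜 dL) δ t)) :=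
  ⟨⟨SHLR.symIsMultiDerivationChainAlgebra_of_isSHLieRinehart hA hL hδ ht,
    SHLR.isSHLieRinehart_of_symIsMultiDerivationChainAlgebra hA hL hδ ht hinj⟩,
    fun h => ⟨SHLR.isSHLieRinehart_of_symIsMultiDerivationChainAlgebra hA hL hδ ht hinj h,
      fun _ _ _ _ => rfl, h⟩⟩
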